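/- Let $n\ge 3$, $a>0$, $1/2<\sigma<4(n-2)^2$ and $b\in\mathbb{R}^n$. Let $V_{-1},V_1:[0,\infty)\to\mathbb{R}$ be non-increasing functions such that $x\mapsto V_{-1}(|x+b|)$ and $x\mapsto V_1(|x-b|)$ are smooth and compactly supported on $\mathbb{R}^n$, and let $$H=-\Delta+V_{-1}(|x+b|)+V_1(|x-b|)\quad\text{on } L^2(\mathbb{R}^n;\mathbb{C}).$$ Write $\langle x\rangle=(1+a|x|^2)^{1/2}$, $f(r)=\int_0^r(1+as^2)^{-\sigma}\,ds$, $F(r)=\int_0^r f(t)\,dt$, $F_c(x)=F(|x-c|)$ for $c\in\mathbb{R}^n$, and define the multipliers $$\gamma_c\psi=-i\sum_{j=1}^n\Big(\partial_j\big((\partial_jF_c)\psi\big)+(\partial_jF_c)\,\partial_j\psi\Big),\qquad \gamma_N=\sum_{k=-N}^{N}\gamma_{kb}.$$ For symmetric operators $A,B$ the form of the commutator $i[A,B]$ is $(\psi,i[A,B]\psi)=i\big((A\psi,B\psi)-(B\psi,A\psi)\big)$ for $\psi\in D(A)\cap D(B)$. Then for every $0<\epsilon<1$ there is $N_\epsilon$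 such that for every integer $N\ge N_\epsilon$, in the sense of quadratic forms on $D(-\Delta)=\{\psi\in L^2:\Delta\psi\in L^2\}=H^2(\mathbb{R}^n)$, $$i[H,\gamma_N]\;\ge\;(1-\epsilon)\,i[-\Delta,\gamma_N]\;\ge\;-(1-\epsilon)\Big(4-\frac{\sigma}{(n-2)^2}\Big)\sum_{k=-N}^{N}\langle x-kb\rangle^{-\sigma}\,\Delta\,\langle x-kb\rangle^{-\sigma}.$$ Here every operator above is defined on all of $D(-\Delta)$. -/

import Mathlib

open MeasureTheory TemperedDistribution
open scoped SchwartzMap LineDeriv Laplacian ContDiff ComplexOrder InnerProductSpace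

namespace MultiCenter

noncomputable section

/-- Euclidean space `ℝⁿ`. -/
abbrev Rn (n : ℕ) : Type := EuclideanSpace ℝ (Fin n)

/-- The Hilbert space `L²(ℝⁿ; ℂ)`, Lebesgue measure. -/
abbrev L2 (n : ℕ) : Type := Lp ℂ 2 (volume : Measure (Rn n))

/-- The inclusion of `L²` into the tempered distributions, as a linear map. -/
def toDist (n : ℕ) : L2 n →ₗ[ℂ] 𝓢'(Rn n, ℂ) :=
  (Lp.toTemperedDistributionCLM ℂ (volume : Measure (Rn n)) 2).toLinearMap

theorem toDist_injective (n : ℕ) : Function.Injective (toDist n) :=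
  LinearMap.ker_eq_bot.mp (Lp.ker_toTemperedDistributionCLM_eq_bot (F := ℂ)
    (μ := (volume : Measure (Rn n))) (p := 2))

/-! ### Unbounded operators on `L²`, each with its natural domain -/

/-- The graph of the `L²` realization of an operator `T` on tempered distributions:
pairs `(ψ, φ)` of `L²` functions with `T ψ = φ` as distributions. -/
def distGraph {n : ℕ} (T : 𝓢'(Rn n, ℂ) →L[ℂ] 𝓢'(Rn n, ℂ)) : Submodule ℂ (L2 n × L2 n) where
  carrier := {p | T (toDist n p.1) = toDist n p.2}
  add_mem' := by
    intro p q hp hq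
    simp only [Set.mem_ofPred_eq] at hp hq ⊢
    simp [hp, hq]
  zero_mem' := by simp
  smul_mem' := by
    intro c p hp
    simp only [Set.mem_ofPred_eq] at hp ⊢
    simp [hp]

theorem mem_distGraph {n : ℕ} (T : 𝓢'(Rn n, ℂ) →L[ℂ] 𝓢'(Rn n, ℂ)) (ψ φ : L2 n) :
    (ψ, φ) ∈ distGraph T ↔ T (ψ : 𝓢'(Rn n, ℂ)) = (φ : 𝓢'(Rn n, ℂ)) := Iff.rfl

/-- The `L²` realization of `T`, on the maximal domain `{ψ ∈ L² : T ψ ∈ L²}`. -/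
def distOp {n : ℕ} (T : 𝓢'(Rn n, ℂ) →L[ℂ] 𝓢'(Rn n, ℂ)) : L2 n →ₗ.[ℂ] L2 n :=
  (distGraph T).toLinearPMap

theorem distOp_graph {n : ℕ} (T : 𝓢'(Rn n, ℂ) →L[ℂ] 𝓢'(Rn n, ℂ)) :
    (distOp T).graph = distGraph T := by
  apply Submodule.toLinearPMap_graph_eq
  rintro ⟨x, y⟩ hx h0
  have h1 : T (toDist n x) = toDist n y := hx
  obtain rfl : x = 0 := h0
  apply toDist_injective n
  simpa using h1.symm

/-- The graph of the multiplication operator by the real function `m`. -/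
def mulGraph {n : ℕ} (m : Rn n → ℝ) : Submodule ℂ (L2 n × L2 n) where
  carrier := {p | ∀ᵐ x, p.2 x = (m x : ℂ) * p.1 x}
  add_mem' := by
    intro p q hp hq
    simp only [Set.mem_ofPred_eq] at hp hq ⊢
    filter_upwards [hp, hq, Lp.coeFn_add p.1 q.1, Lp.coeFn_add p.2 q.2] with x h1 h2 h3 h4
    rw [Prod.snd_add, Prod.fst_add, h4, h3, Pi.add_apply, Pi.add_apply, h1, h2, mul_add]
  zero_mem' := by
    simp only [Set.mem_ofPred_eq]
    filter_upwards [Lp.coeFn_zero ℂ 2 (volume : Measure (Rn n))] with x h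
    rw [Prod.snd_zero, Prod.fst_zero, h, Pi.zero_apply, mul_zero]
  smul_mem' := by
    intro c p hp
    simp only [Set.mem_ofPred_eq] at hp ⊢
    filter_upwards [hp, Lp.coeFn_smul c p.1, Lp.coeFn_smul c p.2] with x h1 h2 h3
    simp only [Prod.smul_fst, Prod.smul_snd, h1, h2, h3, Pi.smul_apply, smul_eq_mul]
    ring

theorem mem_mulGraph {n : ℕ} (m : Rn n → ℝ) (ψ φ : L2 n) :
    (ψ, φ) ∈ mulGraph m ↔ ∀ᵐ x, φ x = (m x : ℂ) * ψ x := Iff.rfl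

/-- Multiplication by `m`, on the maximal domain `{ψ ∈ L² : m ψ ∈ L²}`. -/
def mulOp {n : ℕ} (m : Rn n → ℝ) : L2 n →ₗ.[ℂ] L2 n :=
  (mulGraph m).toLinearPMap

theorem mulOp_graph {n : ℕ} (m : Rn n → ℝ) : (mulOp m).graph = mulGraph m := by
  apply Submodule.toLinearPMap_graph_eq
  rintro ⟨x, y⟩ hx h0
  obtain rfl : x = 0 := h0
  have h1 : ∀ᵐ z, y z = (m z : ℂ) * (0 : L2 n) z := hx
  apply Lp.ext
  filter_upwards [h1, Lp.coeFn_zero ℂ 2 (volume : Measure (Rn n))] with z h2 h3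
  rw [h2, h3, Pi.zero_apply, mul_zero]

/-- The graph of the composition `A B`. -/
def compGraph {n : ℕ} (A B : L2 n →ₗ.[ℂ] L2 n) : Submodule ℂ (L2 n × L2 n) where
  carrier := {p | ∃ y, (p.1, y) ∈ B.graph ∧ (y, p.2) ∈ A.graph}
  add_mem' := by
    rintro p q ⟨y, hy, hy'⟩ ⟨z, hz, hz'⟩
    exact ⟨y + z, B.graph.add_mem hy hz, A.graph.add_mem hy' hz'⟩
  zero_mem' := ⟨0, B.graph.zero_mem, A.graph.zero_mem⟩
  smul_mem' := by
    rintro c p ⟨y, hy, hy'⟩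
    exact ⟨c • y, B.graph.smul_mem c hy, A.graph.smul_mem c hy'⟩

theorem mem_compGraph {n : ℕ} (A B : L2 n →ₗ.[ℂ] L2 n) (ψ φ : L2 n) :
    (ψ, φ) ∈ compGraph A B ↔ ∃ χ, (ψ, χ) ∈ B.graph ∧ (χ, φ) ∈ A.graph := Iff.rfl

/-- The composition `A B` on its natural domain `{ψ ∈ D(B) : B ψ ∈ D(A)}`. -/
def compOp {n : ℕ} (A B : L2 n →ₗ.[ℂ] L2 n) : L2 n →ₗ.[ℂ] L2 n :=
  (compGraph A B).toLinearPMap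

theorem compOp_graph {n : ℕ} (A B : L2 n →ₗ.[ℂ] L2 n) :
    (compOp A B).graph = compGraph A B := by
  apply Submodule.toLinearPMap_graph_eq
  rintro ⟨x, y⟩ ⟨z, hz, hz'⟩ h0
  have h1 : z = 0 := B.graph_fst_eq_zero_snd hz h0
  exact A.graph_fst_eq_zero_snd hz' h1

/-- The Laplacian `Δ` on `L²(ℝⁿ)`, with domain `{ψ ∈ L² : Δψ ∈ L²}` (which is `H²(ℝⁿ)`).
So `-(lap n)` is the free Hamiltonian, with domain `D(-Δ)`. -/
def lap (n : ℕ) : L2 n →ₗ.[ℂ] L2 n :=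
  distOp (LineDeriv.laplacianCLM ℂ (Rn n) 𝓢'(Rn n, ℂ))

/-- The partial derivative `∂_j` on `L²(ℝⁿ)`, with domain `{ψ ∈ L² : ∂_j ψ ∈ L²}`. -/
def partialD {n : ℕ} (j : Fin n) : L2 n →ₗ.[ℂ] L2 n :=
  distOp (LineDeriv.lineDerivOpCLM ℂ 𝓢'(Rn n, ℂ) (EuclideanSpace.single j (1 : ℝ)))

/-- The Schrödinger operator `-Δ + V`. -/
def schrodinger {n : ℕ} (V : Rn n → ℝ) : L2 n →ₗ.[ℂ] L2 n :=
  -(lap n) + mulOp V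

/-! ### The multipliers -/

/-- `g(r) = (1 + a r²)^(-σ/2)`, so that `⟨x⟩^(-σ) = g(|x|)`. -/
def gFun (a σ r : ℝ) : ℝ := 1 / (1 + a * r ^ 2) ^ (σ / 2)

/-- `f(r) = ∫₀^r g(s)² ds`. -/
def fFun (a σ r : ℝ) : ℝ := ∫ s in (0 : ℝ)..r, gFun a σ s ^ 2

/-- `F(r) = ∫₀^r f(t) dt`. -/
def FFun (a σ r : ℝ) : ℝ := ∫ t in (0 : ℝ)..r, fFun a σ t

/-- The `j`-th partial derivative at `x` of `F_c(x) = F(|x - c|)`. -/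
def dF {n : ℕ} (a σ : ℝ) (c : Rn n) (j : Fin n) (x : Rn n) : ℝ :=
  fderiv ℝ (fun y : Rn n => FFun a σ ‖y - c‖) x (EuclideanSpace.single j (1 : ℝ))

/-- The multiplier centered at `c`:
`γ_c ψ = -i ∑_j (∂_j ((∂_j F_c) ψ) + (∂_j F_c) ∂_j ψ)`. -/
def gam {n : ℕ} (a σ : ℝ) (c : Rn n) : L2 n →ₗ.[ℂ] L2 n :=
  (-Complex.I) • ∑ j : Fin n, (compOp (partialD j) (mulOp (dF a σ c j))
    + compOp (mulOp (dF a σ c j)) (partialD j))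

/-- `γ_N = ∑_{k=-N}^{N} γ_{kb}`. -/
def gamN {n : ℕ} (a σ : ℝ) (b : Rn n) (N : ℕ) : L2 n →ₗ.[ℂ] L2 n :=
  ∑ k ∈ Finset.Icc (-(N : ℤ)) (N : ℤ), gam a σ ((k : ℝ) • b)

/-- `∑_{k=-N}^{N} ⟨x - kb⟩^(-σ) Δ ⟨x - kb⟩^(-σ)`. -/
def weightedLapN {n : ℕ} (a σ : ℝ) (b : Rn n) (N : ℕ) : L2 n →ₗ.[ℂ] L2 n :=
  ∑ k ∈ Finset.Icc (-(N : ℤ)) (N : ℤ),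
    compOp (mulOp fun x => gFun a σ ‖x - (k : ℝ) • b‖)
      (compOp (lap n) (mulOp fun x => gFun a σ ‖x - (k : ℝ) • b‖))

/-! ### Quadratic forms -/

/-- The quadratic form `(ψ, A ψ)` of `A` at `ψ ∈ D(A)`. -/
def opForm {n : ℕ} (A : L2 n →ₗ.[ℂ] L2 n) (ψ : L2 n) (hA : ψ ∈ A.domain) : ℂ :=
  ⟪ψ, A ⟨ψ, hA⟩⟫_ℂ

/-- The quadratic form of the commutator `i[A, B]` of symmetric operators at
`ψ ∈ D(A) ∩ D(B)`: `(ψ, i[A, B] ψ) = i ((A ψ, B ψ) - (B ψ, A ψ))`. -/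
def commForm {n : ℕ} (A B : L2 n →ₗ.[ℂ] L2 n) (ψ : L2 n)
    (hA : ψ ∈ A.domain) (hB : ψ ∈ B.domain) : ℂ :=
  Complex.I * (⟪A ⟨ψ, hA⟩, B ⟨ψ, hB⟩⟫_ℂ - ⟪B ⟨ψ, hB⟩, A ⟨ψ, hA⟩⟫_ℂ)

end

end MultiCenter

/-! Write `γ_c = -i D_c` with `D_c = 2 ∇F_c·∇ + ΔF_c` (`dilation`). Each commutator form then
becomes `2 Re ⟨Aψ, Dψ⟩` (`commForm_eq`), where `A` is the Hamiltonian. This is additive in `A`, so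
the theorem splits into a kinetic estimate, centre by centre, and the claim that the potentials cost
at most the fraction `ε` of the kinetic form.

Kinetic part. For a real test function `v`, the integrand `-2 Δv · D_c v` dominates `(4 - σ/(n-2)²)
|∇(⟨x-c⟩^(-σ) v)|²` up to the divergences of four compactly supported fields. What is left over is a
sum of nonnegative terms (`pointwise_bound`), and integrating gives `one_center_bound`. The
hypothesis `σ < 4(n-2)²` makes the constant positive.

Potential part. Integration by parts turns the commutator with `V_1` into `-2 ∫ ∇V_1 · Σ_k ∇F(x-kb)
v²`. Since `V_1` decreases away from `b`, `-∇V_1 = ρ(x)(x-b)` with `ρ ≥ 0`, so the sign of `Σ_k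
(x-b)·∇F(x-kb)` decides. Seen from `b`, the centres `b ± mb` form pairs, and each pair contributes a
nonnegative amount because `∇F` is monotone (`pairTerm_nonneg`). Off the span of `b` the pair
contributes at least `δ/m` (`exists_le_pairTerm`). The two unpaired centres at one end of the chain
cost at most `2M|x-b|`, where `M` bounds `|∇F|`, while the harmonic series diverges. Hence the bad
part of a ball shrinks to a null set as `N` grows (`tendsto_volume_badSet`). On a set of small
measure the Sobolev inequality bounds `∫ v²` by a small multiple of the energy of `⟨x⟩^(-σ) v`
(`exists_setIntegral_sq_le`), and `ε` times the kinetic form of the centre `0` pays for it. The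
potential `V_{-1}` is the same case with `b` replaced by `-b`.

Domains. Test functions are a core of the Laplacian (`exists_approx`). The coefficients are bounded
with enough derivatives, so every operator applied to an approximating sequence converges, and
closedness of the graphs puts the limit in each domain. Both inequalities then pass to the limit. -/

open Filter Topology

namespace MultiCenter

noncomputable section

/-! ### Calculus of compactly supported functions and integration by parts -/

section TestFunctions

variable {n : ℕ} {E : Type*} [NormedAddCommGroup E] [NormedSpace ℝ E]

/-- The `j`-th partial derivative of a function on `ℝⁿ`. -/
def pd (j : Fin n) (v : Rn n → E) (x : Rn n) : E :=
  fderiv ℝ v x (EuclideanSpace.single j (1 : ℝ))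

/-- The Laplacian of a function on `ℝⁿ`. -/
def lapl (v : Rn n → E) (x : Rn n) : E := ∑ j, pd j (pd j v) x

/-- `Cᵏ` functions with compact support. -/
structure IsCc (k : WithTop ℕ∞) (v : Rn n → E) : Prop where
  contDiff : ContDiff ℝ k v
  supp : HasCompactSupport v

theorem contDiff_pd {k m : WithTop ℕ∞} {v : Rn n → E} (hv : ContDiff ℝ m v) (h : k + 1 ≤ m)
    (j : Fin n) : ContDiff ℝ k (pd j v) :=
  (hv.fderiv_right h).clm_apply contDiff_const

theorem IsCc.of_le {k m : WithTop ℕ∞} {v : Rn n → E} (hv : IsCc m v) (h : k ≤ m) : IsCc k v :=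
  ⟨hv.contDiff.of_le h, hv.supp⟩

theorem IsCc.pd {k m : WithTop ℕ∞} {v : Rn n → E} (hv : IsCc m v) (h : k + 1 ≤ m) (j : Fin n) :
    IsCc k (pd j v) :=
  ⟨contDiff_pd hv.contDiff h j, hv.supp.fderiv_apply ℝ _⟩

theorem IsCc.smul {k : WithTop ℕ∞} {X : Rn n → ℝ} {v : Rn n → E} (hX : ContDiff ℝ k X)
    (hv : IsCc k v) : IsCc k (fun x => X x • v x) :=
  ⟨hX.smul hv.contDiff, hv.supp.smul_left (f := X)⟩

theorem IsCc.add {k : WithTop ℕ∞} {v w : Rn n → E} (hv : IsCc k v) (hw : IsCc k w) :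
    IsCc k (fun x => v x + w x) :=
  ⟨hv.contDiff.add hw.contDiff, hv.supp.add hw.supp⟩

theorem IsCc.sub {k : WithTop ℕ∞} {v w : Rn n → E} (hv : IsCc k v) (hw : IsCc k w) :
    IsCc k (fun x => v x - w x) :=
  ⟨hv.contDiff.sub hw.contDiff, hv.supp.sub hw.supp⟩

theorem IsCc.sum {k : WithTop ℕ∞} {ι : Type*} {s : Finset ι} {v : ι → Rn n → E}
    (hv : ∀ i ∈ s, IsCc k (v i)) : IsCc k (fun x => ∑ i ∈ s, v i x) := by
  classical
  induction s using Finset.induction_on with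
  | empty => simpa using ⟨contDiff_const, HasCompactSupport.zero⟩
  | insert i s hi ih =>
    simp only [Finset.sum_insert hi]
    exact (hv i (Finset.mem_insert_self i s)).add
      (ih fun k hk => hv k (Finset.mem_insert_of_mem hk))

theorem IsCc.lapl {k m : WithTop ℕ∞} {v : Rn n → E} (hv : IsCc m v) (h : k + 1 + 1 ≤ m) :
    IsCc k (lapl v) :=
  IsCc.sum fun j _ => (hv.pd h j).pd le_rfl j

theorem IsCc.integrable {k : WithTop ℕ∞} {v : Rn n → E} (hv : IsCc k v) : Integrable v :=
  hv.contDiff.continuous.integrable_of_hasCompactSupport hv.supp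

theorem IsCc.memLp {k : WithTop ℕ∞} {v : Rn n → E} (hv : IsCc k v) : MemLp v 2 :=
  hv.contDiff.continuous.memLp_of_hasCompactSupport hv.supp

theorem pd_smul {X : Rn n → ℝ} {v : Rn n → E} (hX : Differentiable ℝ X) (hv : Differentiable ℝ v)
    (j : Fin n) :
    pd j (fun x => X x • v x) = fun x => pd j X x • v x + X x • pd j v x := by
  ext x
  simp only [pd]
  rw [fderiv_fun_smul (hX x) (hv x)]
  simp [add_comm]

theorem pd_add {v w : Rn n → E} (hv : Differentiable ℝ v) (hw : Differentiable ℝ w) (j : Fin n) :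
    pd j (fun x => v x + w x) = fun x => pd j v x + pd j w x := by
  ext x
  simp only [pd]
  rw [fderiv_fun_add (hv x) (hw x)]
  simp

theorem pd_sub {v w : Rn n → E} (hv : Differentiable ℝ v) (hw : Differentiable ℝ w) (j : Fin n) :
    pd j (fun x => v x - w x) = fun x => pd j v x - pd j w x := by
  ext x
  simp only [pd]
  rw [fderiv_fun_sub (hv x) (hw x)]
  simp

theorem pd_sum {ι : Type*} {s : Finset ι} {v : ι → Rn n → E}
    (hv : ∀ i ∈ s, Differentiable ℝ (v i)) (j : Fin n) :
    pd j (fun x => ∑ i ∈ s, v i x) = fun x => ∑ i ∈ s, pd j (v i) x := by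
  ext x
  simp only [pd]
  rw [fderiv_fun_sum fun i hi => hv i hi x]
  simp

theorem pd_clm {G : Type*} [NormedAddCommGroup G] [NormedSpace ℝ G] (L : E →L[ℝ] G)
    {v : Rn n → E} (hv : Differentiable ℝ v) (j : Fin n) :
    pd j (fun x => L (v x)) = fun x => L (pd j v x) := by
  ext x
  have : HasFDerivAt (fun x => L (v x)) (L.comp (fderiv ℝ v x)) x :=
    L.hasFDerivAt.comp x (hv x).hasFDerivAt
  simp [pd, this.fderiv]

theorem lapl_clm {G : Type*} [NormedAddCommGroup G] [NormedSpace ℝ G] (L : E →L[ℝ] G)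
    {v : Rn n → E} (hv : ContDiff ℝ 2 v) :
    lapl (fun x => L (v x)) = fun x => L (lapl v x) := by
  ext x
  simp only [lapl, map_sum]
  refine Finset.sum_congr rfl fun j _ => ?_
  rw [pd_clm L (hv.differentiable (by norm_num)),
    pd_clm L ((contDiff_pd (k := 1) hv (by norm_num) j).differentiable (by norm_num))]

theorem lapl_sub {v w : Rn n → E} (hv : ContDiff ℝ 2 v) (hw : ContDiff ℝ 2 w) :
    lapl (fun x => v x - w x) = fun x => lapl v x - lapl w x := by
  ext x
  simp only [lapl, ← Finset.sum_sub_distrib]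
  refine Finset.sum_congr rfl fun j _ => ?_
  rw [pd_sub (hv.differentiable (by norm_num)) (hw.differentiable (by norm_num)),
    pd_sub ((contDiff_pd (k := 1) hv (by norm_num) j).differentiable (by norm_num))
      ((contDiff_pd (k := 1) hw (by norm_num) j).differentiable (by norm_num))]

theorem lapl_smul {X : Rn n → ℝ} {v : Rn n → E} (hX : ContDiff ℝ 2 X) (hv : ContDiff ℝ 2 v) :
    lapl (fun x => X x • v x) = fun x => lapl X x • v x + X x • lapl v x
      + (2 : ℝ) • ∑ j, pd j X x • pd j v x := by
  ext x
  have hX1 := hX.differentiable (by norm_num)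
  have hv1 := hv.differentiable (by norm_num)
  have hX2 j := (contDiff_pd (k := 1) hX (by norm_num) j).differentiable (by norm_num)
  have hv2 j := (contDiff_pd (k := 1) hv (by norm_num) j).differentiable (by norm_num)
  simp only [lapl, Finset.sum_smul, Finset.smul_sum, ← Finset.sum_add_distrib]
  refine Finset.sum_congr rfl fun j _ => ?_
  rw [pd_smul hX1 hv1, pd_add (v := fun x => pd j X x • v x) (w := fun x => X x • pd j v x)
    ((hX2 j).smul hv1) (hX1.smul (hv2 j)), pd_smul (hX2 j) hv1, pd_smul hX1 (hv2 j)]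
  simp only [two_smul]
  abel

theorem integral_smul_pd {𝕜 : Type*} [RCLike 𝕜] [NormedSpace 𝕜 E] [IsScalarTower ℝ 𝕜 E]
    {f : Rn n → 𝕜} {v : Rn n → E} (hf : ContDiff ℝ 1 f) (hv : IsCc 1 v) (j : Fin n) :
    ∫ x, f x • pd j v x = - ∫ x, pd j f x • v x := by
  have c1 : Continuous f := hf.continuous
  have c2 : Continuous v := hv.contDiff.continuous
  have c3 : Continuous (pd j f) := (contDiff_pd (k := 0) hf (by norm_num) j).continuous
  have c4 := hv.pd (k := 0) (by norm_num) j
  refine integral_smul_fderiv_eq_neg_fderiv_smul_of_integrable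
    (v := EuclideanSpace.single j (1 : ℝ)) ?_ ?_ ?_
    (fun x _ => (hf.differentiable one_ne_zero) x)
    (fun x _ => (hv.contDiff.differentiable one_ne_zero) x)
  · exact (c3.smul c2).integrable_of_hasCompactSupport (hv.supp.smul_left (f := pd j f))
  · exact (c1.smul c4.contDiff.continuous).integrable_of_hasCompactSupport
      (c4.supp.smul_left (f := f))
  · exact (c1.smul c2).integrable_of_hasCompactSupport (hv.supp.smul_left (f := f))

theorem integral_pd {v : Rn n → ℝ} (hv : IsCc 1 v) (j : Fin n) : ∫ x, pd j v x = 0 := by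
  have h := integral_smul_pd (𝕜 := ℝ) (f := fun _ => (1 : ℝ)) contDiff_const hv j
  simpa [pd] using h

end TestFunctions

/-! ### Test functions as elements of `L²`, with classical and distributional derivatives identified
-/

section Embedding

variable {n : ℕ}

open Classical in
/-- The class in `L²` of a square integrable function (zero for other functions). -/
def toL2 (v : Rn n → ℂ) : L2 n := if h : MemLp v 2 then h.toLp v else 0

theorem coeFn_toL2 {v : Rn n → ℂ} (h : MemLp v 2) : toL2 v =ᵐ[volume] v := by
  rw [toL2, dif_pos h]
  exact h.coeFn_toLp

theorem toL2_add {v w : Rn n → ℂ} (hv : MemLp v 2) (hw : MemLp w 2) :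
    toL2 (fun x => v x + w x) = toL2 v + toL2 w := by
  apply Lp.ext
  filter_upwards [coeFn_toL2 hv, coeFn_toL2 hw, coeFn_toL2 (hv.add hw),
    Lp.coeFn_add (toL2 v) (toL2 w)] with x h1 h2 h3 h4
  rw [h4, Pi.add_apply, h1, h2]
  exact h3

theorem toL2_sub {v w : Rn n → ℂ} (hv : MemLp v 2) (hw : MemLp w 2) :
    toL2 (fun x => v x - w x) = toL2 v - toL2 w := by
  apply Lp.ext
  filter_upwards [coeFn_toL2 hv, coeFn_toL2 hw, coeFn_toL2 (hv.sub hw),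
    Lp.coeFn_sub (toL2 v) (toL2 w)] with x h1 h2 h3 h4
  rw [h4, Pi.sub_apply, h1, h2]
  exact h3

theorem toL2_const_mul {v : Rn n → ℂ} (hv : MemLp v 2) (c : ℂ) :
    toL2 (fun x => c * v x) = c • toL2 v := by
  apply Lp.ext
  filter_upwards [coeFn_toL2 hv, coeFn_toL2 (hv.const_mul c),
    Lp.coeFn_smul c (toL2 v)] with x h1 h2 h3
  rw [h3, Pi.smul_apply, h1, smul_eq_mul]
  exact h2

theorem toL2_sum {ι : Type*} {s : Finset ι} {v : ι → Rn n → ℂ} (hv : ∀ i ∈ s, MemLp (v i) 2) :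
    toL2 (fun x => ∑ i ∈ s, v i x) = ∑ i ∈ s, toL2 (v i) := by
  classical
  induction s using Finset.induction_on with
  | empty =>
    simp only [Finset.sum_empty]
    apply Lp.ext
    filter_upwards [coeFn_toL2 (n := n) (v := fun _ => 0) MemLp.zero,
      Lp.coeFn_zero ℂ 2 (volume : Measure (Rn n))] with x h1 h2
    rw [h1, h2, Pi.zero_apply]
  | insert i s hi ih =>
    simp only [Finset.sum_insert hi]
    rw [← ih fun k hk => hv k (Finset.mem_insert_of_mem hk)]
    exact toL2_add (hv i (Finset.mem_insert_self i s))
      (memLp_finsetSum s fun k hk => hv k (Finset.mem_insert_of_mem hk))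

theorem inner_toL2 {v w : Rn n → ℂ} (hv : MemLp v 2) (hw : MemLp w 2) :
    ⟪toL2 v, toL2 w⟫_ℂ = ∫ x, (starRingEnd ℂ) (v x) * w x := by
  rw [L2.inner_def]
  refine integral_congr_ae ?_
  filter_upwards [coeFn_toL2 hv, coeFn_toL2 hw] with x h1 h2
  rw [h1, h2, RCLike.inner_apply, mul_comm]

theorem toDist_apply (f : L2 n) (g : 𝓢(Rn n, ℂ)) : toDist n f g = ∫ x, g x * f x := by
  simp [toDist]

theorem toDist_toL2_apply {v : Rn n → ℂ} (hv : MemLp v 2) (g : 𝓢(Rn n, ℂ)) :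
    toDist n (toL2 v) g = ∫ x, g x * v x := by
  rw [toDist_apply]
  refine integral_congr_ae ?_
  filter_upwards [coeFn_toL2 hv] with x h1
  rw [h1]

theorem lineDerivOp_toDist {v : Rn n → ℂ} (hv : IsCc 1 v) (j : Fin n) :
    ∂_{EuclideanSpace.single j (1 : ℝ)} (toDist n (toL2 v)) = toDist n (toL2 (pd j v)) := by
  ext g
  have h1 := integral_smul_pd (𝕜 := ℂ) (f := g) (g.smooth 1) hv j
  have h2 := hv.pd (k := 0) (by norm_num) j
  rw [TemperedDistribution.lineDerivOp_apply_apply, toDist_toL2_apply hv.memLp,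
    toDist_toL2_apply h2.memLp]
  simp only [smul_eq_mul] at h1
  rw [h1, ← integral_neg]
  refine integral_congr_ae (Eventually.of_forall fun x => ?_)
  simp [pd, SchwartzMap.lineDerivOp_apply_eq_fderiv]

theorem pd_mem_graph {v : Rn n → ℂ} (hv : IsCc 1 v) (j : Fin n) :
    (toL2 v, toL2 (pd j v)) ∈ (partialD j).graph := by
  rw [partialD, distOp_graph]
  exact lineDerivOp_toDist hv j

theorem lapl_mem_graph {v : Rn n → ℂ} (hv : IsCc 2 v) :
    (toL2 v, toL2 (lapl v)) ∈ (lap n).graph := by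
  rw [lap, distOp_graph]
  change LineDeriv.laplacianCLM ℂ (Rn n) 𝓢'(Rn n, ℂ) (toDist n (toL2 v)) = toDist n (toL2 (lapl v))
  have h1 j := hv.pd (k := 1) (by norm_num) j
  have h2 j := (h1 j).pd (k := 0) (by norm_num) j
  rw [TemperedDistribution.laplacianCLM_apply,
    TemperedDistribution.laplacian_eq_sum (EuclideanSpace.basisFun (Fin n) ℝ)]
  unfold lapl
  rw [toL2_sum fun j _ => (h2 j).memLp, map_sum]
  refine Finset.sum_congr rfl fun j _ => ?_
  rw [← lineDerivOp_toDist (h1 j), ← lineDerivOp_toDist (hv.of_le (by norm_num)),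
    EuclideanSpace.basisFun_apply]

end Embedding

end

end MultiCenter

namespace MultiCenter

noncomputable section

/-! ### Convergence of sequences through graphs of unbounded operators -/

section Graphs

variable {n : ℕ}

theorem mem_graph_add {A B : L2 n →ₗ.[ℂ] L2 n} {ψ φ χ : L2 n} (hA : (ψ, φ) ∈ A.graph)
    (hB : (ψ, χ) ∈ B.graph) : (ψ, φ + χ) ∈ (A + B).graph := by
  rw [LinearPMap.mem_graph_iff] at hA hB ⊢
  obtain ⟨y, hy, hy'⟩ := hA
  obtain ⟨z, hz, hz'⟩ := hB
  simp only at hy hz hy' hz'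
  have h1 : ψ ∈ A.domain := hy ▸ y.2
  have h2 : ψ ∈ B.domain := hz ▸ z.2
  refine ⟨⟨ψ, h1, h2⟩, rfl, ?_⟩
  rw [LinearPMap.add_apply, ← hy', ← hz']
  exact congrArg₂ (· + ·) (congrArg A (Subtype.ext hy.symm)) (congrArg B (Subtype.ext hz.symm))

theorem mem_graph_neg {A : L2 n →ₗ.[ℂ] L2 n} {ψ φ : L2 n} (hA : (ψ, φ) ∈ A.graph) :
    (ψ, -φ) ∈ (-A).graph := by
  rw [LinearPMap.neg_graph]
  exact ⟨(ψ, φ), hA, rfl⟩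

theorem mem_graph_smul {A : L2 n →ₗ.[ℂ] L2 n} {ψ φ : L2 n} (c : ℂ) (hA : (ψ, φ) ∈ A.graph) :
    (ψ, c • φ) ∈ (c • A).graph := by
  rw [LinearPMap.smul_graph]
  exact ⟨(ψ, φ), hA, rfl⟩

theorem apply_eq_of_mem_graph {A : L2 n →ₗ.[ℂ] L2 n} {ψ φ : L2 n} (hA : (ψ, φ) ∈ A.graph)
    (h : ψ ∈ A.domain) : A ⟨ψ, h⟩ = φ :=
  ((LinearPMap.mem_graph_iff _).1 hA).elim fun _ hy =>
    (congrArg A (Subtype.ext hy.1.symm)).trans hy.2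

/-- The operator `A` maps the sequence `u` to the sequence `v`, and the limit `ψ` to the limit
`φ` of `v`. -/
structure Tracks (u : ℕ → L2 n) (ψ : L2 n) (A : L2 n →ₗ.[ℂ] L2 n) (v : ℕ → L2 n) (φ : L2 n) :
    Prop where
  seq : ∀ m, (u m, v m) ∈ A.graph
  lim : (ψ, φ) ∈ A.graph
  tendsto : Tendsto v atTop (𝓝 φ)

variable {u v w : ℕ → L2 n} {ψ φ χ : L2 n} {A B : L2 n →ₗ.[ℂ] L2 n}

theorem Tracks.add (hA : Tracks u ψ A v φ) (hB : Tracks u ψ B w χ) :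
    Tracks u ψ (A + B) (fun m => v m + w m) (φ + χ) :=
  ⟨fun m => mem_graph_add (hA.seq m) (hB.seq m), mem_graph_add hA.lim hB.lim,
    hA.tendsto.add hB.tendsto⟩

theorem Tracks.neg (hA : Tracks u ψ A v φ) : Tracks u ψ (-A) (fun m => -v m) (-φ) :=
  ⟨fun m => mem_graph_neg (hA.seq m), mem_graph_neg hA.lim, hA.tendsto.neg⟩

theorem Tracks.smul (c : ℂ) (hA : Tracks u ψ A v φ) :
    Tracks u ψ (c • A) (fun m => c • v m) (c • φ) :=
  ⟨fun m => mem_graph_smul c (hA.seq m), mem_graph_smul c hA.lim, hA.tendsto.const_smul c⟩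

theorem Tracks.sum {ι : Type*} {s : Finset ι} {A : ι → L2 n →ₗ.[ℂ] L2 n} {v : ι → ℕ → L2 n}
    {φ : ι → L2 n} (h : ∀ i ∈ s, Tracks u ψ (A i) (v i) (φ i)) :
    Tracks u ψ (∑ i ∈ s, A i) (fun m => ∑ i ∈ s, v i m) (∑ i ∈ s, φ i) := by
  classical
  induction s using Finset.induction_on with
  | empty => exact ⟨fun m => by simp, by simp,
      by simp⟩
  | insert i s hi ih =>
    simp only [Finset.sum_insert hi]
    exact (h i (Finset.mem_insert_self i s)).add
      (ih fun k hk => h k (Finset.mem_insert_of_mem hk))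

theorem Tracks.comp (hB : Tracks u ψ B v φ) (hA : Tracks v φ A w χ) :
    Tracks u ψ (compOp A B) w χ := by
  refine ⟨fun m => ?_, ?_, hA.tendsto⟩
  · rw [compOp_graph]; exact ⟨_, hB.seq m, hA.seq m⟩
  · rw [compOp_graph]; exact ⟨_, hB.lim, hA.lim⟩

theorem Tracks.congr (hA : Tracks u ψ A v φ) (h : ∀ m, w m = v m) : Tracks u ψ A w φ := by
  obtain rfl : w = v := funext h
  exact hA

/-- `L²` convergence implies convergence as distributions and `T` is continuous there, so the graph
is the equalizer of two continuous maps. This is what places limits in the maximal domains. -/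
theorem isClosed_distGraph (T : 𝓢'(Rn n, ℂ) →L[ℂ] 𝓢'(Rn n, ℂ)) :
    IsClosed (distGraph T : Set (L2 n × L2 n)) := by
  have hc : Continuous (toDist n) :=
    (Lp.toTemperedDistributionCLM ℂ (volume : Measure (Rn n)) 2).continuous
  exact isClosed_eq (T.continuous.comp (hc.comp continuous_fst)) (hc.comp continuous_snd)

theorem tracks_distOp {T : 𝓢'(Rn n, ℂ) →L[ℂ] 𝓢'(Rn n, ℂ)}
    (h : ∀ m, (u m, v m) ∈ (distOp T).graph) (hu : Tendsto u atTop (𝓝 ψ))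
    (hv : Tendsto v atTop (𝓝 φ)) : Tracks u ψ (distOp T) v φ := by
  refine ⟨h, ?_, hv⟩
  rw [distOp_graph] at h ⊢
  exact (isClosed_distGraph T).mem_of_tendsto (hu.prodMk_nhds hv) (Eventually.of_forall h)

/-- Multiplication by a bounded continuous function, as a bounded operator on `L²`. -/
theorem exists_mulCLM {m : Rn n → ℝ} (hm : Continuous m) {C : ℝ} (hC : ∀ x, |m x| ≤ C) :
    ∃ M : L2 n →L[ℂ] L2 n, ∀ f : L2 n, M f =ᵐ[volume] fun x => (m x : ℂ) * f x := by
  have hmem (f : L2 n) : MemLp (fun x => (m x : ℂ) * f x) 2 := by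
    refine MemLp.of_le_mul (c := C) (Lp.memLp f)
      ((Complex.continuous_ofReal.comp hm).aestronglyMeasurable.mul (Lp.memLp f).1)
      (Eventually.of_forall fun x => ?_)
    rw [norm_mul, Complex.norm_real, Real.norm_eq_abs]
    exact mul_le_mul_of_nonneg_right (hC x) (norm_nonneg _)
  let L : L2 n →ₗ[ℂ] L2 n :=
    { toFun := fun f => toL2 fun x => (m x : ℂ) * f x
      map_add' := fun f g => by
        apply Lp.ext
        filter_upwards [coeFn_toL2 (hmem f), coeFn_toL2 (hmem g), coeFn_toL2 (hmem (f + g)),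
          Lp.coeFn_add f g, Lp.coeFn_add (toL2 fun x => (m x : ℂ) * f x)
            (toL2 fun x => (m x : ℂ) * g x)] with x h1 h2 h3 h4 h5
        rw [h3, h5, Pi.add_apply, h1, h2, h4, Pi.add_apply, mul_add]
      map_smul' := fun c f => by
        apply Lp.ext
        filter_upwards [coeFn_toL2 (hmem f), coeFn_toL2 (hmem (c • f)), Lp.coeFn_smul c f,
          Lp.coeFn_smul c (toL2 fun x => (m x : ℂ) * f x)] with x h1 h2 h3 h4
        rw [h2, RingHom.id_apply, h4, Pi.smul_apply, h1, h3, Pi.smul_apply, smul_eq_mul,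
          smul_eq_mul]
        ring }
  have hL (f : L2 n) : L f =ᵐ[volume] fun x => (m x : ℂ) * f x := coeFn_toL2 (hmem f)
  refine ⟨L.mkContinuous C fun f => ?_, hL⟩
  refine Lp.norm_le_mul_norm_of_ae_le_mul ?_
  filter_upwards [hL f] with x h1
  rw [h1, norm_mul, Complex.norm_real, Real.norm_eq_abs]
  exact mul_le_mul_of_nonneg_right (hC x) (norm_nonneg _)

theorem mulCLM_toL2 {m : Rn n → ℝ} {M : L2 n →L[ℂ] L2 n}
    (hM : ∀ f : L2 n, M f =ᵐ[volume] fun x => (m x : ℂ) * f x) {v : Rn n → ℂ}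
    (hv : MemLp v 2) (hmv : MemLp (fun x => m x • v x) 2) :
    M (toL2 v) = toL2 fun x => m x • v x := by
  apply Lp.ext
  filter_upwards [hM (toL2 v), coeFn_toL2 hv, coeFn_toL2 hmv] with x h1 h2 h3
  rw [h1, h2, h3, Complex.real_smul]

theorem tracks_mulOp {m : Rn n → ℝ} {M : L2 n →L[ℂ] L2 n}
    (hM : ∀ f : L2 n, M f =ᵐ[volume] fun x => (m x : ℂ) * f x) (hu : Tendsto u atTop (𝓝 ψ)) :
    Tracks u ψ (mulOp m) (fun k => M (u k)) (M ψ) := by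
  refine ⟨fun k => ?_, ?_, (M.continuous.tendsto ψ).comp hu⟩
  · rw [mulOp_graph]; exact hM (u k)
  · rw [mulOp_graph]; exact hM ψ

end Graphs

/-! ### Approximating sequences carried through the operators -/

section Approximation

variable {n : ℕ}

theorem two_le_infty : (2 : WithTop ℕ∞) ≤ ∞ :=
  WithTop.coe_le_coe.2 le_top

theorem integral_conj_mul_pd {v w : Rn n → ℂ} (hv : ContDiff ℝ 1 v) (hw : IsCc 1 w) (j : Fin n) :
    ∫ x, (starRingEnd ℂ) (pd j v x) * w x = -∫ x, (starRingEnd ℂ) (v x) * pd j w x := by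
  have h := integral_smul_pd (𝕜 := ℂ) (f := fun x => Complex.conjCLE (v x))
    (Complex.conjCLE.contDiff.comp hv) hw j
  have h' := pd_clm (Complex.conjCLE : ℂ →L[ℝ] ℂ) (hv.differentiable one_ne_zero) j
  simp only [ContinuousLinearEquiv.coe_coe] at h'
  rw [h'] at h
  simp only [Complex.conjCLE_apply, smul_eq_mul] at h
  rw [h, neg_neg]

theorem sum_inner_pd {w : Rn n → ℂ} (hw : IsCc 2 w) :
    ∑ j, ⟪toL2 (pd j w), toL2 (pd j w)⟫_ℂ = -⟪toL2 w, toL2 (lapl w)⟫_ℂ := by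
  have h1 j := hw.pd (k := 1) (by norm_num) j
  have h2 j := (h1 j).pd (k := 0) (by norm_num) j
  have : toL2 (lapl w) = ∑ j, toL2 (pd j (pd j w)) := toL2_sum fun j _ => (h2 j).memLp
  rw [this, inner_sum, ← Finset.sum_neg_distrib]
  refine Finset.sum_congr rfl fun j _ => ?_
  rw [inner_toL2 (h1 j).memLp (h1 j).memLp, inner_toL2 hw.memLp (h2 j).memLp,
    integral_conj_mul_pd (hw.contDiff.of_le (by norm_num)) (h1 j)]

/-- Integration by parts and Cauchy–Schwarz. Applied to differences, it makes first derivatives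
Cauchy once the functions and their Laplacians are. -/
theorem norm_pd_sq_le {w : Rn n → ℂ} (hw : IsCc 2 w) (j : Fin n) :
    ‖toL2 (pd j w)‖ ^ 2 ≤ ‖toL2 w‖ * ‖toL2 (lapl w)‖ := by
  have h := congrArg Complex.re (sum_inner_pd hw)
  rw [Complex.re_sum] at h
  have h3 (i : Fin n) : (⟪toL2 (pd i w), toL2 (pd i w)⟫_ℂ).re = ‖toL2 (pd i w)‖ ^ 2 := by
    rw [inner_self_eq_norm_sq_to_K]; norm_cast
  simp only [h3] at h
  calc ‖toL2 (pd j w)‖ ^ 2 ≤ ∑ i, ‖toL2 (pd i w)‖ ^ 2 :=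
        Finset.single_le_sum (f := fun i => ‖toL2 (pd i w)‖ ^ 2) (fun i _ => sq_nonneg _)
          (Finset.mem_univ j)
    _ ≤ ‖⟪toL2 w, toL2 (lapl w)⟫_ℂ‖ := by
        rw [h, Complex.neg_re]
        exact (neg_le_abs _).trans (Complex.abs_re_le_norm _)
    _ ≤ _ := norm_inner_le_norm _ _

/-- The test functions `u m` converge to `ψ`, with Laplacians converging to `L`. -/
structure Approx (u : ℕ → Rn n → ℂ) (ψ L : L2 n) : Prop where
  test : ∀ m, IsCc ∞ (u m)
  tendsto : Tendsto (fun m => toL2 (u m)) atTop (𝓝 ψ)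
  tendsto_lapl : Tendsto (fun m => toL2 (lapl (u m))) atTop (𝓝 L)

variable {u : ℕ → Rn n → ℂ} {ψ L : L2 n}

theorem Approx.lap (h : Approx u ψ L) :
    Tracks (fun m => toL2 (u m)) ψ (lap n) (fun m => toL2 (lapl (u m))) L :=
  tracks_distOp (fun m => lapl_mem_graph ((h.test m).of_le two_le_infty)) h.tendsto h.tendsto_lapl

theorem Approx.pd (h : Approx u ψ L) (j : Fin n) :
    ∃ D, Tracks (fun m => toL2 (u m)) ψ (partialD j) (fun m => toL2 (pd j (u m))) D := by
  have h2 m : IsCc 2 (u m) := (h.test m).of_le two_le_infty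
  have h1 m : IsCc 1 (MultiCenter.pd j (u m)) := (h2 m).pd (by norm_num) j
  have hc : CauchySeq fun m => toL2 (MultiCenter.pd j (u m)) := by
    have e (k l : ℕ) : dist (toL2 (MultiCenter.pd j (u k))) (toL2 (MultiCenter.pd j (u l))) ^ 2 ≤
        dist (toL2 (u k)) (toL2 (u l)) * dist (toL2 (lapl (u k))) (toL2 (lapl (u l))) := by
      have := norm_pd_sq_le ((h2 k).sub (h2 l)) j
      rw [pd_sub ((h2 k).contDiff.differentiable (by norm_num))
        ((h2 l).contDiff.differentiable (by norm_num)),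
        lapl_sub (h2 k).contDiff (h2 l).contDiff, toL2_sub (h1 k).memLp (h1 l).memLp,
        toL2_sub (h2 k).memLp (h2 l).memLp,
        toL2_sub ((h2 k).lapl (k := 0) (by norm_num)).memLp
          ((h2 l).lapl (k := 0) (by norm_num)).memLp] at this
      simpa only [dist_eq_norm] using this
    rw [Metric.cauchySeq_iff]
    intro ε hε
    obtain ⟨N1, hN1⟩ := Metric.cauchySeq_iff.1 h.tendsto.cauchySeq ε hε
    obtain ⟨N2, hN2⟩ := Metric.cauchySeq_iff.1 h.tendsto_lapl.cauchySeq ε hε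
    refine ⟨max N1 N2, fun k hk l hl => ?_⟩
    have a1 := hN1 k (le_of_max_le_left hk) l (le_of_max_le_left hl)
    have a2 := hN2 k (le_of_max_le_right hk) l (le_of_max_le_right hl)
    refine lt_of_pow_lt_pow_left₀ 2 hε.le ((e k l).trans_lt ?_)
    rw [sq]
    exact mul_lt_mul'' a1 a2 dist_nonneg dist_nonneg
  obtain ⟨D, hD⟩ := cauchySeq_tendsto_of_complete hc
  exact ⟨D, tracks_distOp (fun m => pd_mem_graph ((h2 m).of_le (by norm_num)) j) h.tendsto hD⟩

variable {X : Rn n → ℝ} {C : ℝ}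

theorem Approx.mul (h : Approx u ψ L) (hX : Continuous X) (hC : ∀ x, |X x| ≤ C) :
    ∃ D, Tracks (fun m => toL2 (u m)) ψ (mulOp X) (fun m => toL2 (fun x => X x • u m x)) D := by
  obtain ⟨M, hM⟩ := exists_mulCLM hX hC
  refine ⟨M ψ, (tracks_mulOp hM h.tendsto).congr fun m => (mulCLM_toL2 hM (h.test m).memLp ?_).symm⟩
  exact (IsCc.smul (contDiff_zero.2 hX) ((h.test m).of_le (by simp))).memLp

theorem Approx.mul_pd (h : Approx u ψ L) (hX : Continuous X) (hC : ∀ x, |X x| ≤ C) (j : Fin n) :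
    ∃ D, Tracks (fun m => toL2 (u m)) ψ (compOp (mulOp X) (partialD j))
      (fun m => toL2 (fun x => X x • MultiCenter.pd j (u m) x)) D := by
  obtain ⟨M, hM⟩ := exists_mulCLM hX hC
  obtain ⟨D, hD⟩ := h.pd j
  have h1 m : IsCc 0 (MultiCenter.pd j (u m)) := (h.test m).pd (by simp) j
  exact ⟨M D, (hD.comp (tracks_mulOp hM hD.tendsto)).congr fun m =>
    (mulCLM_toL2 hM (h1 m).memLp (IsCc.smul (contDiff_zero.2 hX) (h1 m)).memLp).symm⟩

theorem Approx.pd_mul (h : Approx u ψ L) (hX : ContDiff ℝ 1 X) (hC : ∀ x, |X x| ≤ C) (j : Fin n)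
    {C' : ℝ} (hC' : ∀ x, |MultiCenter.pd j X x| ≤ C') :
    ∃ D, Tracks (fun m => toL2 (u m)) ψ (compOp (partialD j) (mulOp X))
      (fun m => toL2 (MultiCenter.pd j fun x => X x • u m x)) D := by
  obtain ⟨D1, h1⟩ := h.mul hX.continuous hC
  obtain ⟨D2, h2⟩ := h.mul_pd hX.continuous hC j
  have hX' := contDiff_pd (k := 0) hX (by norm_num) j
  obtain ⟨D3, h3⟩ := h.mul hX'.continuous hC'
  have c1 m : IsCc 1 (u m) := (h.test m).of_le (by simp)
  refine ⟨D3 + D2, h1.comp (tracks_distOp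
    (fun m => pd_mem_graph (IsCc.smul hX (c1 m)) j) h1.tendsto
    ((h3.tendsto.add h2.tendsto).congr fun m => ?_))⟩
  rw [pd_smul (hX.differentiable one_ne_zero) ((c1 m).contDiff.differentiable one_ne_zero)]
  refine (toL2_add (IsCc.smul hX' ((c1 m).of_le (by simp))).memLp ?_).symm
  exact (IsCc.smul (k := 0) (hX.of_le (by simp)) ((c1 m).pd (by norm_num) j)).memLp

/-- By the Leibniz rule `Δ(Xu)` involves only `u`, its first derivatives and `Δu`, each with a
bounded coefficient, and all of these converge; second derivatives of `u` never occur individually.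
-/
theorem Approx.mul_lap_mul (h : Approx u ψ L) (hX : ContDiff ℝ 2 X) (hC : ∀ x, |X x| ≤ C)
    {C' : ℝ} (hC' : ∀ j x, |MultiCenter.pd j X x| ≤ C') {C'' : ℝ} (hC'' : ∀ x, |lapl X x| ≤ C'') :
    ∃ D, Tracks (fun m => toL2 (u m)) ψ (compOp (mulOp X) (compOp (MultiCenter.lap n) (mulOp X)))
      (fun m => toL2 (fun x => X x • lapl (fun y => X y • u m y) x)) D := by
  obtain ⟨M, hM⟩ := exists_mulCLM hX.continuous hC
  obtain ⟨D1, h1⟩ := h.mul hX.continuous hC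
  have hX1 j := contDiff_pd (k := 1) hX (by norm_num) j
  have hX0 : ContDiff ℝ 0 (lapl X) :=
    ContDiff.sum fun j _ => contDiff_pd (hX1 j) (by norm_num) j
  choose D2 h2 using fun j => h.mul_pd (hX1 j).continuous (hC' j) j
  obtain ⟨D3, h3⟩ := h.mul hX0.continuous hC''
  have c2 m : IsCc 2 (u m) := (h.test m).of_le two_le_infty
  have cXu m : IsCc 2 (fun x => X x • u m x) := IsCc.smul hX (c2 m)
  have c0 m : IsCc 0 (lapl fun x => X x • u m x) := (cXu m).lapl (by norm_num)
  have cl m : IsCc 0 (fun x => X x • lapl (u m) x) :=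
    IsCc.smul (hX.of_le (by simp)) ((c2 m).lapl (by norm_num))
  have cp j m : IsCc 0 (fun x => MultiCenter.pd j X x • MultiCenter.pd j (u m) x) :=
    IsCc.smul ((hX1 j).of_le (by simp)) ((c2 m).pd (by norm_num) j)
  have cL m : IsCc 0 (fun x => lapl X x • u m x) := IsCc.smul hX0 ((c2 m).of_le (by simp))
  have h4 : Tendsto (fun m => toL2 (lapl fun x => X x • u m x)) atTop
      (𝓝 (D3 + M L + (2 : ℂ) • ∑ j, D2 j)) := by
    refine ((h3.tendsto.add ((M.continuous.tendsto L).comp h.tendsto_lapl)).add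
      ((tendsto_finsetSum _ fun j _ => (h2 j).tendsto).const_smul (2 : ℂ))).congr fun m => ?_
    rw [lapl_smul hX (c2 m).contDiff, Function.comp_apply,
      mulCLM_toL2 hM ((c2 m).lapl (k := 0) (by norm_num)).memLp (cl m).memLp,
      ← toL2_add (cL m).memLp (cl m).memLp, ← toL2_sum fun j _ => (cp j m).memLp,
      ← toL2_const_mul (IsCc.sum fun j _ => cp j m).memLp,
      ← toL2_add ((cL m).add (cl m)).memLp ((IsCc.sum fun j _ => cp j m).memLp.const_mul _)]
    congr 1
  have h5 := h1.comp (tracks_distOp (fun m => lapl_mem_graph (cXu m)) h1.tendsto h4)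
  refine ⟨_, (h5.comp (tracks_mulOp hM h4)).congr fun m => ?_⟩
  rw [mulCLM_toL2 hM (c0 m).memLp (IsCc.smul (hX.of_le (by simp)) (c0 m)).memLp]

end Approximation

end

end MultiCenter

namespace MultiCenter

noncomputable section

/-! ### Test functions form a core of the Laplacian -/

section Density

variable {n : ℕ}

theorem norm_toL2_sq {v : Rn n → ℂ} (hv : MemLp v 2) : ‖toL2 v‖ ^ 2 = ∫ x, ‖v x‖ ^ 2 := by
  have h := inner_toL2 hv hv
  have h2 (x : Rn n) : (starRingEnd ℂ) (v x) * v x = ((‖v x‖ ^ 2 : ℝ) : ℂ) := by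
    rw [Complex.conj_mul']; norm_cast
  simp only [h2] at h
  rw [inner_self_eq_norm_sq_to_K, integral_complex_ofReal] at h
  exact Complex.ofReal_injective ((Complex.ofReal_pow _ _).trans h)

/-- Dominated convergence with majorant `(C + |c|)² |w|²`. It serves both the cut-offs, where `c =
1`, and their derivatives, where `c = 0`. -/
theorem tendsto_toL2_smul {a : ℕ → Rn n → ℝ} {w : Rn n → ℂ} (hw : MemLp w 2)
    (ha : ∀ m, Continuous (a m)) {C : ℝ} (hC : ∀ m x, |a m x| ≤ C) {c : ℝ}
    (hlim : ∀ x, Tendsto (fun m => a m x) atTop (𝓝 c)) :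
    Tendsto (fun m => toL2 fun x => a m x • w x) atTop (𝓝 ((c : ℂ) • toL2 w)) := by
  have hm m : MemLp (fun x => a m x • w x) 2 := by
    refine MemLp.of_le_mul (c := C) hw ((ha m).aestronglyMeasurable.smul hw.1)
      (Eventually.of_forall fun x => ?_)
    rw [norm_smul]
    exact mul_le_mul_of_nonneg_right (hC m x) (norm_nonneg _)
  have hd m : toL2 (fun x => a m x • w x) - (c : ℂ) • toL2 w
      = toL2 fun x => a m x • w x - (c : ℂ) * w x := by
    rw [toL2_sub (hm m) (hw.const_mul _), toL2_const_mul hw]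
  rw [tendsto_iff_norm_sub_tendsto_zero]
  have h0 : Tendsto (fun m => ‖toL2 (fun x => a m x • w x) - (c : ℂ) • toL2 w‖ ^ 2) atTop
      (𝓝 0) := by
    simp only [hd]
    have e m := norm_toL2_sq ((hm m).sub (hw.const_mul (c : ℂ)))
    simp only [Pi.sub_def] at e
    simp only [e]
    have := tendsto_integral_of_dominated_convergence (μ := (volume : Measure (Rn n)))
      (F := fun m x => ‖a m x • w x - (c : ℂ) * w x‖ ^ 2) (f := fun _ => (0 : ℝ))
      (fun x => (C + |c|) ^ 2 * ‖w x‖ ^ 2) (fun m => ?_) ?_ (fun m => ?_) ?_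
    · simpa using this
    · exact ((hm m).sub (hw.const_mul (c : ℂ))).1.norm.pow 2
    · exact ((memLp_two_iff_integrable_sq_norm hw.1).1 hw).const_mul _
    · refine Eventually.of_forall fun x => ?_
      rw [Real.norm_eq_abs, abs_pow, abs_norm, ← mul_pow]
      refine pow_le_pow_left₀ (norm_nonneg _) ?_ 2
      rw [Complex.real_smul, ← sub_mul, norm_mul, ← Complex.ofReal_sub, Complex.norm_real,
        Real.norm_eq_abs]
      exact mul_le_mul_of_nonneg_right ((abs_sub _ _).trans (add_le_add_left (hC m x) _))
        (norm_nonneg _)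
    · refine Eventually.of_forall fun x => ?_
      have h1 : Tendsto (fun m => a m x • w x - (c : ℂ) * w x) atTop
          (𝓝 (c • w x - (c : ℂ) * w x)) := ((hlim x).smul_const (w x)).sub_const _
      have h2 := (h1.norm).pow 2
      simpa using h2
  have h1 := h0.sqrt
  simpa using h1

/-- A smooth function which together with its first derivatives and its Laplacian is square
integrable is approximated by test functions. -/
theorem exists_approx_of_contDiff {u : Rn n → ℂ} (hu : ContDiff ℝ ∞ u) (h0 : MemLp u 2)
    (h1 : ∀ j, MemLp (pd j u) 2) (h2 : MemLp (lapl u) 2) :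
    ∃ w, Approx w (toL2 u) (toL2 (lapl u)) := by
  let χ : ContDiffBump (0 : Rn n) := ⟨1, 2, one_pos, one_lt_two⟩
  have hχ : ContDiff ℝ ∞ (χ : Rn n → ℝ) := χ.contDiff
  have hχc : HasCompactSupport (χ : Rn n → ℝ) := χ.hasCompactSupport
  have cχ : IsCc ∞ (χ : Rn n → ℝ) := ⟨hχ, hχc⟩
  -- The cut-offs are `χ(x/(m+1))`. Each derivative falling on one of them produces a factor `r m`,
  -- so only the term in which `Δ` falls on `u` survives in the limit.
  let r : ℕ → ℝ := fun m => 1 / ((m : ℝ) + 1)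
  have hr m : 0 < r m := by positivity
  have hr1 m : r m ≤ 1 := by
    simp only [r]; rw [div_le_one (by positivity)]; linarith [(m.cast_nonneg : (0 : ℝ) ≤ m)]
  have hrlim : Tendsto r atTop (𝓝 0) := tendsto_one_div_add_atTop_nhds_zero_nat
  let a : ℕ → Rn n → ℝ := fun m x => χ (r m • x)
  have hpd (f : Rn n → ℝ) (hf : Differentiable ℝ f) (m : ℕ) (j : Fin n) :
      pd j (fun x => f (r m • x)) = fun x => r m * pd j f (r m • x) := by
    ext x
    have : HasFDerivAt (fun x => f (r m • x))
        ((fderiv ℝ f (r m • x)).comp (r m • ContinuousLinearMap.id ℝ (Rn n))) x :=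
      (hf _).hasFDerivAt.comp x ((hasFDerivAt_id x).const_smul (r m))
    simp [pd, this.fderiv]
  have ha1 m j : pd j (a m) = fun x => r m * pd j χ (r m • x) :=
    hpd _ (hχ.differentiable (by simp)) m j
  have cχ1 j : IsCc 1 (pd j χ) := cχ.pd (two_le_infty) j
  have ha2 m : lapl (a m) = fun x => r m ^ 2 * lapl χ (r m • x) := by
    ext x
    simp only [lapl, Finset.mul_sum]
    refine Finset.sum_congr rfl fun j _ => ?_
    rw [ha1]
    have hd : Differentiable ℝ fun x => pd j χ (r m • x) :=
      ((cχ1 j).contDiff.differentiable one_ne_zero).comp (differentiable_id.const_smul (r m))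
    have := pd_clm (r m • ContinuousLinearMap.id ℝ ℝ) hd j
    simp only [smul_apply, ContinuousLinearMap.id_apply, smul_eq_mul] at this
    rw [this, hpd _ ((cχ1 j).contDiff.differentiable one_ne_zero)]
    ring
  have hsm (m : ℕ) : ContDiff ℝ ∞ (a m) := hχ.comp (contDiff_id.const_smul (r m))
  have hsupp (m : ℕ) : HasCompactSupport (a m) := hχc.comp_smul (hr m).ne'
  have cl : IsCc 0 (lapl χ) := (cχ.of_le two_le_infty).lapl (by norm_num)
  obtain ⟨C1, hC1⟩ : ∃ C, ∀ j x, |pd j χ x| ≤ C := by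
    choose C hC using fun j => (cχ1 j).supp.exists_bound_of_continuous (cχ1 j).contDiff.continuous
    refine ⟨∑ j, |C j|, fun j x => (hC j x).trans ((le_abs_self _).trans ?_)⟩
    exact Finset.single_le_sum (f := fun j => |C j|) (fun i _ => abs_nonneg _) (Finset.mem_univ j)
  obtain ⟨C2, hC2⟩ := cl.supp.exists_bound_of_continuous cl.contDiff.continuous
  have hlim0 : ∀ x, Tendsto (fun m => a m x) atTop (𝓝 1) := fun x => by
    have h : Tendsto (fun m => r m • x) atTop (𝓝 0) := by simpa using hrlim.smul_const x
    have := (χ.continuous.tendsto 0).comp h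
    rwa [χ.one_of_mem_closedBall (by simp [χ])] at this
  have T0 := tendsto_toL2_smul h0 (fun m => (hsm m).continuous) (C := 1)
    (fun m x => by rw [abs_of_nonneg χ.nonneg]; exact χ.le_one) hlim0
  have T2 := tendsto_toL2_smul h2 (fun m => (hsm m).continuous) (C := 1)
    (fun m x => by rw [abs_of_nonneg χ.nonneg]; exact χ.le_one) hlim0
  have c1 m j : ContDiff ℝ 1 (pd j (a m)) := contDiff_pd (hsm m) two_le_infty j
  have cL m : Continuous (lapl (a m)) :=
    continuous_finsetSum _ fun j _ => (contDiff_pd (k := 0) (c1 m j) (by norm_num) j).continuous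
  have T1 j := tendsto_toL2_smul (a := fun m => pd j (a m)) (c := 0) (C := C1) (h1 j)
    (fun m => (c1 m j).continuous) (fun m x => by
      rw [ha1, abs_mul, abs_of_pos (hr m)]
      exact (mul_le_of_le_one_left (abs_nonneg _) (hr1 m)).trans (hC1 j _)) (fun x => by
      simp only [ha1]
      refine squeeze_zero_norm (a := fun m => r m * C1) (fun m => ?_) (by simpa using hrlim.mul_const C1)
      rw [Real.norm_eq_abs, abs_mul, abs_of_pos (hr m)]
      exact mul_le_mul_of_nonneg_left (hC1 j _) (hr m).le)
  have T3 := tendsto_toL2_smul (a := fun m => lapl (a m)) (c := 0) (C := C2) h0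
    (fun m => cL m) (fun m x => by
      rw [ha2, abs_mul, abs_of_pos (pow_pos (hr m) 2)]
      exact (mul_le_of_le_one_left (abs_nonneg _) (pow_le_one₀ (hr m).le (hr1 m))).trans (hC2 _))
    (fun x => by
      simp only [ha2]
      refine squeeze_zero_norm (a := fun m => r m ^ 2 * C2) (fun m => ?_)
        (by simpa using (hrlim.pow 2).mul_const C2)
      rw [Real.norm_eq_abs, abs_mul, abs_of_pos (pow_pos (hr m) 2)]
      exact mul_le_mul_of_nonneg_left (hC2 _) (pow_pos (hr m) 2).le)
  refine ⟨fun m x => a m x • u x, ⟨fun m => ⟨(hsm m).smul hu, (hsupp m).smul_right⟩, ?_, ?_⟩⟩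
  · simpa using T0
  · have T := (T3.add T2).add ((tendsto_finsetSum Finset.univ fun j _ => T1 j).const_smul (2 : ℂ))
    simp only [Complex.ofReal_zero, zero_smul, Complex.ofReal_one, one_smul, zero_add,
      Finset.sum_const_zero, smul_zero, add_zero] at T
    refine T.congr fun m => ?_
    have bdd {b : Rn n → ℝ} {w : Rn n → ℂ} (hb : Continuous b) (hbs : HasCompactSupport b)
        (hw : MemLp w 2) : MemLp (fun x => b x • w x) 2 := by
      obtain ⟨C, hC⟩ := hbs.exists_bound_of_continuous hb
      refine MemLp.of_le_mul (c := C) hw (hb.aestronglyMeasurable.smul hw.1)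
        (Eventually.of_forall fun x => ?_)
      rw [norm_smul]
      exact mul_le_mul_of_nonneg_right (hC x) (norm_nonneg _)
    have ca : IsCc 2 (a m) := ⟨(hsm m).of_le two_le_infty, hsupp m⟩
    have b0 := bdd (cL m) (ca.lapl (k := 0) (by norm_num)).supp h0
    have b2 := bdd (hsm m).continuous (hsupp m) h2
    have b1 j := bdd (c1 m j).continuous (ca.pd (k := 1) (by norm_num) j).supp (h1 j)
    rw [lapl_smul ca.contDiff (hu.of_le two_le_infty), ← toL2_add b0 b2,
      ← toL2_sum fun j _ => b1 j, ← toL2_const_mul (memLp_finsetSum _ fun j _ => b1 j),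
      ← toL2_add (v := fun x => lapl (a m) x • u x + a m x • lapl u x) (b0.add b2) ((memLp_finsetSum _ fun j _ => b1 j).const_mul _)]
    congr 1

theorem pd_schwartz (u : 𝓢(Rn n, ℂ)) (j : Fin n) :
    pd j u = (∂_{EuclideanSpace.single j (1 : ℝ)} u : 𝓢(Rn n, ℂ)) := by
  ext x
  rw [SchwartzMap.lineDerivOp_apply_eq_fderiv, pd]

theorem lapl_schwartz (u : 𝓢(Rn n, ℂ)) : lapl u = (Δ u : 𝓢(Rn n, ℂ)) := by
  ext x
  rw [SchwartzMap.laplacian_eq_sum (EuclideanSpace.basisFun (Fin n) ℝ), lapl,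
    sum_apply]
  refine Finset.sum_congr rfl fun j _ => ?_
  rw [pd_schwartz, pd_schwartz, EuclideanSpace.basisFun_apply]

theorem exists_approx_schwartz (u : 𝓢(Rn n, ℂ)) : ∃ w, Approx w (toL2 u) (toL2 (lapl u)) := by
  refine exists_approx_of_contDiff (u.smooth ⊤) (u.memLp 2) (fun j => ?_) ?_
  · rw [pd_schwartz]; exact SchwartzMap.memLp _ 2 _
  · rw [lapl_schwartz]; exact SchwartzMap.memLp _ 2 _

/-- With this Fourier normalization `Δ` has symbol `-(2π)²|ξ|²`, so the constant `(2π)⁻²` turns the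
operator into multiplication by `1 + |ξ|²`, whose inverse is a symbol of temperate growth. -/
theorem exists_schwartz_resolvent (f : 𝓢(Rn n, ℂ)) :
    ∃ h : 𝓢(Rn n, ℂ), h - ((2 * Real.pi) ^ 2)⁻¹ • Δ h = f := by
  let m : Rn n → ℝ := fun x => (1 + ‖x‖ ^ 2) ^ (-1 : ℝ)
  have hm : m.HasTemperateGrowth := by
    have := Function.hasTemperateGrowth_one_add_norm_sq_rpow (Rn n) (-1)
    exact this
  have hs : (fun x : Rn n => ‖x‖ ^ 2).HasTemperateGrowth := by fun_prop
  refine ⟨SchwartzMap.fourierMultiplierCLM ℂ m f, ?_⟩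
  have h1 : Δ (SchwartzMap.fourierMultiplierCLM ℂ m f) = -(2 * Real.pi) ^ 2 •
      SchwartzMap.fourierMultiplierCLM ℂ ((fun x : Rn n => ‖x‖ ^ 2) * m) f := by
    rw [SchwartzMap.laplacian_eq_fourierMultiplierCLM]
    congr 1
    exact SchwartzMap.fourierMultiplierCLM_fourierMultiplierCLM_apply hs hm f
  have h2 : SchwartzMap.fourierMultiplierCLM ℂ (fun x => m x + ((fun x : Rn n => ‖x‖ ^ 2) * m) x) f
      = SchwartzMap.fourierMultiplierCLM ℂ m f
        + SchwartzMap.fourierMultiplierCLM ℂ ((fun x : Rn n => ‖x‖ ^ 2) * m) f := by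
    have := SchwartzMap.fourierMultiplierCLM_sum (E := Rn n) (F := ℂ) (𝕜 := ℝ) (s := Finset.univ)
      (g := ![m, (fun x : Rn n => ‖x‖ ^ 2) * m]) (by
        intro i _
        fin_cases i
        · exact hm
        · exact hs.mul hm)
    have := congrArg (fun T => T f) this
    simpa [Fin.sum_univ_two] using this
  have h3 : (fun x => m x + ((fun x : Rn n => ‖x‖ ^ 2) * m) x) = fun _ => (1 : ℝ) := by
    ext x
    have : (0 : ℝ) < 1 + ‖x‖ ^ 2 := by positivity
    simp only [m, Pi.mul_apply, Real.rpow_neg_one]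
    field_simp
  rw [h3, SchwartzMap.fourierMultiplierCLM_const] at h2
  simp only [one_smul, ContinuousLinearMap.id_apply] at h2
  have hπ : (2 * Real.pi) ^ 2 ≠ 0 := by positivity
  rw [h1, neg_smul, smul_neg, smul_smul, inv_mul_cancel₀ hπ, one_smul, sub_neg_eq_add, ← h2]

/-- The graph of the Laplacian on test functions. -/
def testGraph (n : ℕ) : Set (L2 n × L2 n) :=
  {p | ∃ u : Rn n → ℂ, IsCc ∞ u ∧ p = (toL2 u, toL2 (lapl u))}

theorem Approx.mem_closure {u : ℕ → Rn n → ℂ} {ψ L : L2 n} (h : Approx u ψ L) :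
    (ψ, L) ∈ closure (testGraph n) :=
  mem_closure_of_tendsto (h.tendsto.prodMk_nhds h.tendsto_lapl)
    (Eventually.of_forall fun m => ⟨u m, h.test m, rfl⟩)

theorem exists_approx_of_mem_closure {ψ L : L2 n} (h : (ψ, L) ∈ closure (testGraph n)) :
    ∃ u, Approx u ψ L := by
  obtain ⟨p, hp, hlim⟩ := mem_closure_iff_seq_limit.1 h
  choose u hu hup using hp
  refine ⟨u, hu, ?_, ?_⟩
  · refine ((continuous_fst.tendsto _).comp hlim).congr fun m => ?_
    rw [Function.comp_apply, hup]
  · refine ((continuous_snd.tendsto _).comp hlim).congr fun m => ?_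
    rw [Function.comp_apply, hup]

theorem re_inner_le_of_mem_closure {p : L2 n × L2 n} (h : p ∈ closure (testGraph n)) :
    (⟪p.1, p.2⟫_ℂ).re ≤ 0 := by
  have hc : IsClosed {p : L2 n × L2 n | (⟪p.1, p.2⟫_ℂ).re ≤ 0} :=
    isClosed_le (Complex.continuous_re.comp (continuous_fst.inner continuous_snd))
      continuous_const
  refine closure_minimal ?_ hc h
  rintro _ ⟨u, hu, rfl⟩
  have h := congrArg Complex.re (sum_inner_pd (hu.of_le two_le_infty))
  rw [Complex.re_sum, Complex.neg_re] at h
  have : 0 ≤ ∑ i, (⟪toL2 (pd i u), toL2 (pd i u)⟫_ℂ).re :=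
    Finset.sum_nonneg fun i _ => inner_self_nonneg (𝕜 := ℂ)
  simp only [Set.mem_ofPred_eq]
  linarith

/-- Dissipativity: `Re ⟨ψ, Δψ⟩ ≤ 0`, so pairing `ψ - κΔψ` with `ψ` and using Cauchy–Schwarz bounds
the resolvent. -/
theorem norm_sq_le_of_mem_closure {p : L2 n × L2 n} (h : p ∈ closure (testGraph n)) {κ : ℝ}
    (hκ : 0 ≤ κ) : ‖p.1‖ ≤ ‖p.1 - (κ : ℂ) • p.2‖ := by
  have h1 := re_inner_le_of_mem_closure h
  have h2 : ‖p.1‖ ^ 2 ≤ ‖p.1‖ * ‖p.1 - (κ : ℂ) • p.2‖ := by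
    refine le_trans ?_ ((Complex.re_le_norm _).trans (norm_inner_le_norm (𝕜 := ℂ) p.1 _))
    rw [inner_sub_right, inner_smul_right, Complex.sub_re, Complex.re_ofReal_mul,
      inner_self_eq_norm_sq_to_K]
    have : (((‖p.1‖ : ℝ) : ℂ) ^ 2).re = ‖p.1‖ ^ 2 := by norm_cast
    rw [show ((RCLike.ofReal ‖p.1‖ : ℂ) ^ 2).re = ‖p.1‖ ^ 2 from this]
    nlinarith
  rcases (norm_nonneg p.1).eq_or_lt with h3 | h3
  · rw [← h3]; exact norm_nonneg _
  · rw [sq] at h2; exact le_of_mul_le_mul_left h2 h3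

/-- Duality: `δ` annihilates every `f - κΔf` with `f` Schwartz, and by `exists_schwartz_resolvent`
these exhaust the Schwartz space. -/
theorem eq_zero_of_lap_eq {δ M : L2 n} (h : (δ, M) ∈ (lap n).graph)
    (hδ : δ = ((((2 * Real.pi) ^ 2)⁻¹ : ℝ) : ℂ) • M) : δ = 0 := by
  rw [lap, distOp_graph] at h
  have h' : Δ (toDist n δ) = toDist n M := by
    rw [← TemperedDistribution.laplacianCLM_apply]; exact h
  apply toDist_injective n
  rw [map_zero]
  ext g
  obtain ⟨f, rfl⟩ := exists_schwartz_resolvent g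
  have h1 : toDist n δ (Δ f) = toDist n M f := by
    rw [← h', TemperedDistribution.laplacian_apply_apply]
  have h2 : toDist n δ f = ((((2 * Real.pi) ^ 2)⁻¹ : ℝ) : ℂ) * toDist n M f := by
    conv_lhs => rw [hδ, map_smul]
    rfl
  have h3 : toDist n δ (f - ((2 * Real.pi) ^ 2)⁻¹ • Δ f)
      = toDist n δ f - ((((2 * Real.pi) ^ 2)⁻¹ : ℝ) : ℂ) * toDist n δ (Δ f) := by
    have h4 : ((2 * Real.pi) ^ 2)⁻¹ • Δ f = ((((2 * Real.pi) ^ 2)⁻¹ : ℝ) : ℂ) • Δ f := by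
      ext x; simp
    rw [map_sub, h4, map_smul, smul_eq_mul]
  rw [h3, h1, h2, sub_self]
  rfl

/-- Test functions are a core of the Laplacian. -/
theorem exists_approx {ψ L : L2 n} (h : (ψ, L) ∈ (lap n).graph) : ∃ u, Approx u ψ L := by
  apply exists_approx_of_mem_closure
  set κ : ℝ := ((2 * Real.pi) ^ 2)⁻¹ with hκ
  have hκ0 : 0 < κ := by positivity
  have hκc : (κ : ℂ) ≠ 0 := by exact_mod_cast hκ0.ne'
  -- Approximate `ψ - κL` rather than `ψ`: solving the resolvent equation with Schwartz data
  -- controls the solutions and their Laplacians at the same time.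
  obtain ⟨q, hq, hlim⟩ := mem_closure_iff_seq_limit.1
    ((SchwartzMap.denseRange_toLpCLM (E := Rn n) (F := ℂ) (p := 2)
      (μ := (volume : Measure (Rn n))) (by simp)) (ψ - (κ : ℂ) • L))
  choose f hf using hq
  choose s hs using fun m => exists_schwartz_resolvent (f m)
  have hK m : (toL2 (s m), toL2 (lapl (s m))) ∈ closure (testGraph n) := by
    obtain ⟨w, hw⟩ := exists_approx_schwartz (s m)
    exact hw.mem_closure
  have hsq m : toL2 (s m) - (κ : ℂ) • toL2 (lapl (s m)) = q m := by
    have e2 : MemLp (lapl (s m)) 2 := by rw [lapl_schwartz]; exact SchwartzMap.memLp _ 2 _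
    rw [← hf m, ← toL2_const_mul e2, ← toL2_sub ((s m).memLp 2) (e2.const_mul _)]
    apply Lp.ext
    refine (coeFn_toL2 (((s m).memLp 2).sub (e2.const_mul _))).trans ?_
    refine EventuallyEq.trans (Eventually.of_forall fun x => ?_)
      (SchwartzMap.coeFn_toLp (f m) 2 volume).symm
    rw [← hs m, lapl_schwartz]
    simp [κ]
  let G : Submodule ℂ (L2 n × L2 n) := (lap n).graph
  have hclosed : IsClosed (G : Set (L2 n × L2 n)) := by
    simp only [G, lap, distOp_graph]; exact isClosed_distGraph _
  have hKG : closure (testGraph n) ⊆ G := by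
    refine closure_minimal ?_ hclosed
    rintro _ ⟨u, hu, rfl⟩
    exact lapl_mem_graph (hu.of_le two_le_infty)
  have hsub m l : (toL2 (s m) - toL2 (s l), toL2 (lapl (s m)) - toL2 (lapl (s l)))
      ∈ closure (testGraph n) := by
    obtain ⟨w, hw⟩ := exists_approx_schwartz (s m - s l)
    have e (k : ℕ) : MemLp (lapl (s k)) 2 := by
      rw [lapl_schwartz]; exact SchwartzMap.memLp _ 2 _
    have e1 : toL2 (s m - s l : 𝓢(Rn n, ℂ)) = toL2 (s m) - toL2 (s l) :=
      toL2_sub ((s m).memLp 2) ((s l).memLp 2)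
    have e2 : toL2 (lapl (s m - s l : 𝓢(Rn n, ℂ))) = toL2 (lapl (s m)) - toL2 (lapl (s l)) := by
      rw [← toL2_sub (e m) (e l),
        ← lapl_sub (((s m).smooth ⊤).of_le two_le_infty) (((s l).smooth ⊤).of_le two_le_infty)]
      rfl
    rw [← e1, ← e2]
    exact hw.mem_closure
  have hcauchy : CauchySeq fun m => toL2 (s m) := by
    refine Metric.cauchySeq_iff.2 fun ε hε => ?_
    obtain ⟨N, hN⟩ := Metric.cauchySeq_iff.1 hlim.cauchySeq ε hε
    refine ⟨N, fun m hm l hl => lt_of_le_of_lt ?_ (hN m hm l hl)⟩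
    have := norm_sq_le_of_mem_closure (hsub m l) hκ0.le
    rw [dist_eq_norm, dist_eq_norm, ← hsq, ← hsq]
    refine this.trans_eq (congrArg _ ?_)
    simp only [smul_sub]
    abel
  obtain ⟨ψ', hψ'⟩ := cauchySeq_tendsto_of_complete hcauchy
  have hL : Tendsto (fun m => toL2 (lapl (s m))) atTop
      (𝓝 ((κ : ℂ)⁻¹ • (ψ' - (ψ - (κ : ℂ) • L)))) := by
    refine ((hψ'.sub hlim).const_smul ((κ : ℂ)⁻¹)).congr fun m => ?_
    rw [← hsq, sub_sub_cancel, inv_smul_smul₀ hκc]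
  have hmem := isClosed_closure.mem_of_tendsto (hψ'.prodMk_nhds hL)
    (Eventually.of_forall fun m => hK m)
  have hdiff := G.sub_mem h (hKG hmem)
  -- The limit `ψ'` and `ψ` solve the same resolvent equation, so their difference satisfies `δ =
  -- κΔδ` and vanishes.
  have h0 := eq_zero_of_lap_eq (δ := ψ - ψ') hdiff (by
    change ψ - ψ' = (κ : ℂ) • (L - (κ : ℂ)⁻¹ • (ψ' - (ψ - (κ : ℂ) • L)))
    rw [smul_sub, smul_inv_smul₀ hκc]
    abel)
  have h1 : ψ' = ψ := (sub_eq_zero.1 h0).symm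
  rw [h1] at hmem
  rwa [sub_sub_cancel, inv_smul_smul₀ hκc] at hmem

end Density

end

end MultiCenter

namespace MultiCenter

noncomputable section

/-! ### The radial profile as a smooth function of `t = r²` -/

section Profile

/-- The power `(1 + a t)^(-τ)`. -/
def powProfile (a τ t : ℝ) : ℝ := (1 + a * t) ^ (-τ)

/-- The moments `∫₀¹ s^(2k) (1 + a t s²)^(-τ) ds`. -/
def moment (a : ℝ) (k : ℕ) (τ t : ℝ) : ℝ :=
  ∫ s in (0 : ℝ)..1, s ^ (2 * k) * powProfile a τ (t * s ^ 2)

/-- A neighbourhood of `[0, ∞)` on which the profiles are smooth. -/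
def profileDom (a : ℝ) : Set ℝ := {t | -(1 / 2) < a * t}

variable {a : ℝ} {k : ℕ} {τ t : ℝ}

theorem isOpen_profileDom (a : ℝ) : IsOpen (profileDom a) :=
  isOpen_lt continuous_const (continuous_const.mul continuous_id)

theorem mem_profileDom (ha : 0 < a) (ht : 0 ≤ t) : t ∈ profileDom a :=
  lt_of_lt_of_le (by norm_num) (mul_nonneg ha.le ht)

theorem half_lt_of_mem (ht : t ∈ profileDom a) : 1 / 2 < 1 + a * t := by
  have : -(1 / 2) < a * t := ht
  linarith

theorem half_le_of_mem (ht : t ∈ profileDom a) {s : ℝ} (hs : s ∈ Set.Icc (0 : ℝ) 1) :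
    1 / 2 ≤ 1 + a * (t * s ^ 2) := by
  have h : -(1 / 2) < a * t := ht
  have h1 : s ^ 2 ≤ 1 := pow_le_one₀ hs.1 hs.2
  nlinarith [sq_nonneg s]

theorem hasDerivAt_powProfile (τ : ℝ) (h : 0 < 1 + a * t) :
    HasDerivAt (powProfile a τ) (-(τ * a) * powProfile a (τ + 1) t) t := by
  have h1 : HasDerivAt (fun t => 1 + a * t) a t := by
    simpa using ((hasDerivAt_id t).const_mul a).const_add 1
  have h2 := h1.rpow_const (p := -τ) (Or.inl h.ne')
  refine HasDerivAt.congr_deriv (f := powProfile a τ) h2 ?_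
  rw [powProfile, show -(τ + 1) = -τ - 1 by ring]
  ring

theorem powProfile_pos (h : 0 < 1 + a * t) : 0 < powProfile a τ t := Real.rpow_pos_of_pos h _

theorem powProfile_succ (h : 0 < 1 + a * t) :
    (1 + a * t) * powProfile a (τ + 1) t = powProfile a τ t := by
  rw [powProfile, powProfile, show -τ = -(τ + 1) + 1 by ring, Real.rpow_add_one h.ne']
  ring

theorem powProfile_le_one (ha : 0 < a) (hτ : 0 ≤ τ) (ht : 0 ≤ t) : powProfile a τ t ≤ 1 :=
  Real.rpow_le_one_of_one_le_of_nonpos (by nlinarith) (by linarith)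

theorem powProfile_anti (hτ : 0 ≤ τ) {s t : ℝ} (h : 0 < 1 + a * s) (hst : a * s ≤ a * t) :
    powProfile a τ t ≤ powProfile a τ s :=
  Real.rpow_le_rpow_of_nonpos h (by linarith) (by linarith)

theorem continuousOn_moment_integrand (ht : t ∈ profileDom a) :
    ContinuousOn (fun s : ℝ => s ^ (2 * k) * powProfile a τ (t * s ^ 2)) (Set.Icc 0 1) := by
  refine (continuous_pow _).continuousOn.mul ?_
  refine ContinuousOn.rpow_const (by fun_prop) fun s hs => Or.inl ?_
  have := half_le_of_mem ht hs
  linarith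

theorem intervalIntegrable_moment (ht : t ∈ profileDom a) :
    IntervalIntegrable (fun s : ℝ => s ^ (2 * k) * powProfile a τ (t * s ^ 2)) volume 0 1 :=
  ContinuousOn.intervalIntegrable (by
    rw [Set.uIcc_of_le zero_le_one]; exact continuousOn_moment_integrand ht)

/-- Differentiation under the integral sign stays inside the family and raises both indices by one,
so smoothness follows by induction. -/
theorem hasDerivAt_moment (hτ : 0 ≤ τ) (ht : t ∈ profileDom a) :
    HasDerivAt (moment a k τ) (-(τ * a) * moment a (k + 1) (τ + 1) t) t := by
  have hsub : Set.uIoc (0 : ℝ) 1 ⊆ Set.Icc 0 1 := by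
    rw [Set.uIoc_of_le zero_le_one]; exact Set.Ioc_subset_Icc_self
  have h := intervalIntegral.hasDerivAt_integral_of_dominated_loc_of_deriv_le (μ := volume)
    (a := 0) (b := 1) (s := profileDom a) (x₀ := t)
    (F := fun t s => s ^ (2 * k) * powProfile a τ (t * s ^ 2))
    (F' := fun t s => -(τ * a) * (s ^ (2 * (k + 1)) * powProfile a (τ + 1) (t * s ^ 2)))
    -- On `profileDom a` the base `1 + a t s²` is at least `1/2` for all `s` in `[0, 1]`, which
    -- bounds the negative power uniformly.
    (bound := fun _ => |τ * a| * (1 / 2) ^ (-(τ + 1)))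
    ((isOpen_profileDom a).mem_nhds ht)
    (by
      filter_upwards [(isOpen_profileDom a).mem_nhds ht] with u hu
      exact (intervalIntegrable_iff.1 (intervalIntegrable_moment hu)).aestronglyMeasurable)
    (intervalIntegrable_moment ht)
    (intervalIntegrable_iff.1 ((intervalIntegrable_moment ht).const_mul _)).aestronglyMeasurable
    (Eventually.of_forall fun s hs u hu => by
      have hs' := hsub hs
      have h1 := half_le_of_mem hu hs'
      have h2 : powProfile a (τ + 1) (u * s ^ 2) ≤ (1 / 2) ^ (-(τ + 1)) :=
        Real.rpow_le_rpow_of_nonpos (by norm_num) h1 (by linarith)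
      have h3 : 0 < powProfile a (τ + 1) (u * s ^ 2) := powProfile_pos (by linarith)
      rw [norm_mul, norm_neg, Real.norm_eq_abs, Real.norm_eq_abs, abs_mul (s ^ _), abs_of_pos h3,
        abs_of_nonneg (pow_nonneg hs'.1 _)]
      refine mul_le_mul_of_nonneg_left ?_ (abs_nonneg _)
      exact (mul_le_of_le_one_left h3.le (pow_le_one₀ hs'.1 hs'.2)).trans h2)
    intervalIntegrable_const
    (Eventually.of_forall fun s hs u hu => by
      have h1 := half_le_of_mem hu (hsub hs)
      have h2 := hasDerivAt_powProfile (a := a) τ (t := u * s ^ 2) (by linarith)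
      have h3 : HasDerivAt (fun u : ℝ => u * s ^ 2) (s ^ 2) u := by
        simpa using (hasDerivAt_id u).mul_const (s ^ 2)
      have h4 := (h2.comp u h3).const_mul (s ^ (2 * k))
      refine HasDerivAt.congr_deriv h4 ?_
      ring)
  refine h.2.congr_deriv ?_
  rw [intervalIntegral.integral_const_mul]
  rfl

theorem contDiffOn_moment (m : ℕ) : ∀ {k : ℕ} {τ : ℝ}, 0 ≤ τ →
    ContDiffOn ℝ m (moment a k τ) (profileDom a) := by
  induction m with
  | zero =>
    intro k τ hτ
    exact contDiffOn_zero.2 fun t ht => (hasDerivAt_moment hτ ht).continuousAt.continuousWithinAt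
  | succ m ih =>
    intro k τ hτ
    push_cast
    rw [contDiffOn_succ_iff_deriv_of_isOpen (isOpen_profileDom a)]
    refine ⟨fun t ht => (hasDerivAt_moment hτ ht).differentiableAt.differentiableWithinAt,
      by simp, ?_⟩
    refine ContDiffOn.congr (contDiffOn_const.mul (ih (k := k + 1) (τ := τ + 1) (by linarith)))
      (f := fun t => -(τ * a) * moment a (k + 1) (τ + 1) t) fun t ht => ?_
    exact (hasDerivAt_moment hτ ht).deriv

theorem moment_nonneg (ht : t ∈ profileDom a) : 0 ≤ moment a k τ t := by
  refine intervalIntegral.integral_nonneg zero_le_one fun s hs => ?_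
  have := half_le_of_mem ht hs
  exact mul_nonneg (pow_nonneg hs.1 _) (powProfile_pos (by linarith)).le

/-- The integrand is the `s`-derivative of `s (1 + a t s²)^(-τ)`. For `τ = σ` and `t = r²` this is
the identity `f'(r) = g(r)²`. -/
theorem moment_zero_add (ht : t ∈ profileDom a) :
    moment a 0 τ t + 2 * t * (-(τ * a) * moment a 1 (τ + 1) t) = powProfile a τ t := by
  have hI : Set.uIcc (0 : ℝ) 1 = Set.Icc 0 1 := Set.uIcc_of_le zero_le_one
  have h : ∫ s in (0 : ℝ)..1, (s ^ (2 * 0) * powProfile a τ (t * s ^ 2)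
      + 2 * t * (-(τ * a)) * (s ^ (2 * 1) * powProfile a (τ + 1) (t * s ^ 2)))
      = 1 * powProfile a τ (t * 1 ^ 2) - 0 * powProfile a τ (t * 0 ^ 2) := by
    refine intervalIntegral.integral_eq_sub_of_hasDerivAt
      (f := fun s => s * powProfile a τ (t * s ^ 2)) (fun s hs => ?_)
      ((intervalIntegrable_moment ht).add ((intervalIntegrable_moment ht).const_mul _))
    rw [hI] at hs
    have h1 := half_le_of_mem ht hs
    have h2 := hasDerivAt_powProfile (a := a) τ (t := t * s ^ 2) (by linarith)
    have h3 : HasDerivAt (fun s : ℝ => t * s ^ 2) (t * (2 * s)) s := by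
      simpa using (hasDerivAt_pow 2 s).const_mul t
    have h4 := (hasDerivAt_id s).mul (h2.comp s h3)
    refine HasDerivAt.congr_deriv h4 ?_
    simp only [id, Function.comp_apply]
    ring
  rw [intervalIntegral.integral_add (intervalIntegrable_moment ht)
    ((intervalIntegrable_moment ht).const_mul _), intervalIntegral.integral_const_mul] at h
  simp only [one_pow, mul_one, one_mul, zero_mul, sub_zero] at h
  rw [← h, moment, moment]
  ring

end Profile

/-! ### Identities and bounds for `φ`, where `f(r) = r φ(r²)` -/

section RadialProfile

variable {a σ t : ℝ}

/-- The profile of the vector field `∇F`: `f(r) = r φ(r²)`. -/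
def phi (a σ t : ℝ) : ℝ := moment a 0 σ t

/-- The derivative of `phi`. -/
def phi' (a σ t : ℝ) : ℝ := -(σ * a) * moment a 1 (σ + 1) t

/-- The second derivative of `phi`. -/
def phi'' (a σ t : ℝ) : ℝ := -(σ * a) * (-((σ + 1) * a) * moment a 2 (σ + 2) t)

theorem hasDerivAt_phi (hσ : 0 ≤ σ) (ht : t ∈ profileDom a) :
    HasDerivAt (phi a σ) (phi' a σ t) t :=
  hasDerivAt_moment hσ ht

theorem hasDerivAt_phi' (hσ : 0 ≤ σ) (ht : t ∈ profileDom a) :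
    HasDerivAt (phi' a σ) (phi'' a σ t) t := by
  have := (hasDerivAt_moment (k := 1) (τ := σ + 1) (by linarith) ht).const_mul (-(σ * a))
  rwa [show σ + 1 + 1 = σ + 2 by ring] at this

theorem contDiffOn_phi (m : ℕ) (hσ : 0 ≤ σ) : ContDiffOn ℝ m (phi a σ) (profileDom a) :=
  contDiffOn_moment m hσ

theorem contDiffOn_phi' (m : ℕ) (hσ : 0 ≤ σ) : ContDiffOn ℝ m (phi' a σ) (profileDom a) :=
  contDiffOn_const.mul (contDiffOn_moment m (by linarith))

theorem phi'_nonpos (ha : 0 < a) (hσ : 0 ≤ σ) (ht : t ∈ profileDom a) : phi' a σ t ≤ 0 :=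
  mul_nonpos_of_nonpos_of_nonneg (by nlinarith) (moment_nonneg ht)

theorem phi_add (ht : t ∈ profileDom a) :
    phi a σ t + 2 * t * phi' a σ t = powProfile a σ t := moment_zero_add ht

/-- The derivative of `phi_add`. It eliminates `phi''` from every divergence computed below. -/
theorem three_mul_phi'_add (hσ : 0 ≤ σ) (ht : t ∈ profileDom a) :
    3 * phi' a σ t + 2 * t * phi'' a σ t = -(σ * a) * powProfile a (σ + 1) t := by
  have h1 : HasDerivAt (fun t => phi a σ t + 2 * t * phi' a σ t)
      (phi' a σ t + (2 * phi' a σ t + 2 * t * phi'' a σ t)) t := by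
    refine (hasDerivAt_phi hσ ht).add ?_
    have := ((hasDerivAt_id t).const_mul 2).mul (hasDerivAt_phi' hσ ht)
    refine HasDerivAt.congr_deriv this ?_
    simp
  have h2 : HasDerivAt (fun t => phi a σ t + 2 * t * phi' a σ t)
      (-(σ * a) * powProfile a (σ + 1) t) t := by
    refine (hasDerivAt_powProfile σ (by linarith [half_lt_of_mem ht])).congr_of_eventuallyEq ?_
    filter_upwards [(isOpen_profileDom a).mem_nhds ht] with u hu using phi_add hu
  rw [← h1.unique h2]
  ring

theorem phi_nonneg (ht : t ∈ profileDom a) : 0 ≤ phi a σ t := moment_nonneg ht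

theorem phi_le_one (ha : 0 < a) (hσ : 0 ≤ σ) (ht : 0 ≤ t) : phi a σ t ≤ 1 := by
  have h : phi a σ t ≤ ∫ _ in (0 : ℝ)..1, (1 : ℝ) := by
    refine intervalIntegral.integral_mono_on zero_le_one
      (intervalIntegrable_moment (mem_profileDom ha ht)) intervalIntegrable_const fun s hs => ?_
    rw [mul_zero, pow_zero, one_mul]
    exact powProfile_le_one ha hσ (by positivity)
  simpa using h

/-- On `0 ≤ s ≤ 1/(1+r)` one has `rs ≤ 1`, so the integrand there is at least its value at `rs = 1`.
The resulting `1/r` decay is what produces a harmonic series over the pairs of centres. -/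
theorem phi_ge (ha : 0 < a) (hσ : 0 ≤ σ) {r : ℝ} (hr : 0 ≤ r) :
    powProfile a σ 1 / (1 + r) ≤ phi a σ (r ^ 2) := by
  have hr' : (0 : ℝ) < 1 + r := by linarith
  have hle : 1 / (1 + r) ≤ 1 := by rw [div_le_one hr']; linarith
  have h0 : (0 : ℝ) ≤ 1 / (1 + r) := by positivity
  have hd := mem_profileDom ha (sq_nonneg r)
  have hint := intervalIntegrable_moment (k := 0) (τ := σ) hd
  have hint1 : IntervalIntegrable (fun s : ℝ => s ^ (2 * 0) * powProfile a σ (r ^ 2 * s ^ 2))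
      volume 0 (1 / (1 + r)) :=
    hint.mono_set (by rw [Set.uIcc_of_le h0, Set.uIcc_of_le zero_le_one];
                      exact Set.Icc_subset_Icc_right hle)
  have hint2 : IntervalIntegrable (fun s : ℝ => s ^ (2 * 0) * powProfile a σ (r ^ 2 * s ^ 2))
      volume (1 / (1 + r)) 1 :=
    hint.mono_set (by rw [Set.uIcc_of_le hle, Set.uIcc_of_le zero_le_one];
                      exact Set.Icc_subset_Icc_left h0)
  have h2 : 0 ≤ ∫ s in (1 / (1 + r))..1, s ^ (2 * 0) * powProfile a σ (r ^ 2 * s ^ 2) := by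
    refine intervalIntegral.integral_nonneg hle fun s hs => ?_
    have h3 : (0 : ℝ) ≤ r ^ 2 * s ^ 2 := by positivity
    exact mul_nonneg (pow_nonneg (h0.trans hs.1) _) (powProfile_pos (by nlinarith)).le
  have h1 : ∫ _ in (0 : ℝ)..(1 / (1 + r)), powProfile a σ 1
      ≤ ∫ s in (0 : ℝ)..(1 / (1 + r)), s ^ (2 * 0) * powProfile a σ (r ^ 2 * s ^ 2) := by
    refine intervalIntegral.integral_mono_on h0 intervalIntegrable_const hint1 fun s hs => ?_
    rw [mul_zero, pow_zero, one_mul, ← mul_pow]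
    have h3 : r * s ≤ 1 := by
      calc r * s ≤ r * (1 / (1 + r)) := mul_le_mul_of_nonneg_left hs.2 hr
        _ ≤ 1 := by rw [mul_one_div, div_le_one hr']; linarith
    have h4 : (r * s) ^ 2 ≤ 1 := pow_le_one₀ (mul_nonneg hr hs.1) h3
    exact powProfile_anti hσ (by nlinarith [sq_nonneg (r * s)]) (by nlinarith)
  rw [intervalIntegral.integral_const, sub_zero, smul_eq_mul] at h1
  have h5 := intervalIntegral.integral_add_adjacent_intervals hint1 hint2
  have h6 : phi a σ (r ^ 2) = ∫ s in (0 : ℝ)..1, s ^ (2 * 0) * powProfile a σ (r ^ 2 * s ^ 2) := rfl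
  rw [h6, ← h5, div_eq_mul_one_div, mul_comm]
  linarith

theorem gFun_eq (ha : 0 < a) (r : ℝ) : gFun a σ r = powProfile a (σ / 2) (r ^ 2) := by
  rw [gFun, powProfile, Real.rpow_neg (by positivity), one_div]

theorem powProfile_half_sq (h : 0 < 1 + a * t) :
    powProfile a (σ / 2) t ^ 2 = powProfile a σ t := by
  rw [powProfile, powProfile, sq, ← Real.rpow_add h]
  congr 1; ring

theorem gFun_sq (ha : 0 < a) (r : ℝ) : gFun a σ r ^ 2 = powProfile a σ (r ^ 2) := by
  rw [gFun_eq ha, powProfile_half_sq (by positivity)]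

theorem fFun_eq (ha : 0 < a) (r : ℝ) : fFun a σ r = r * phi a σ (r ^ 2) := by
  have h := intervalIntegral.smul_integral_comp_mul_left (a := 0) (b := 1)
    (fun s => powProfile a σ (s ^ 2)) r
  simp only [mul_zero, mul_one, smul_eq_mul] at h
  simp only [fFun, gFun_sq ha]
  rw [← h, phi, moment]
  simp only [mul_zero, pow_zero, one_mul, mul_pow]

/-- Substituting `t = s²` exhibits `F` as a function of `r²`, so `F_c` can be differentiated at its
own centre without a separate case. -/
theorem FFun_eq (ha : 0 < a) (hσ : 0 ≤ σ) (r : ℝ) :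
    FFun a σ r = (1 / 2) * ∫ t in (0 : ℝ)..(r ^ 2), phi a σ t := by
  have h := intervalIntegral.integral_comp_mul_deriv' (a := 0) (b := r) (f := fun t => t ^ 2)
    (f' := fun t => 2 * t) (g := phi a σ) (fun t _ => by simpa using hasDerivAt_pow 2 t)
    (by fun_prop) (fun u hu => by
      obtain ⟨s, -, rfl⟩ := hu
      exact (hasDerivAt_phi hσ (mem_profileDom ha (sq_nonneg s))).continuousAt.continuousWithinAt)
  simp only [ne_eq, OfNat.ofNat_ne_zero, not_false_eq_true, zero_pow] at h
  rw [← h, ← intervalIntegral.integral_const_mul, FFun]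
  refine intervalIntegral.integral_congr fun t _ => ?_
  simp only [fFun_eq ha, Function.comp_apply]
  ring

theorem hasDerivAt_integral_phi (ha : 0 < a) (hσ : 0 ≤ σ) (ht : 0 ≤ t) :
    HasDerivAt (fun u => ∫ s in (0 : ℝ)..u, phi a σ s) (phi a σ t) t := by
  have hc : ContinuousOn (phi a σ) (profileDom a) := (contDiffOn_phi 0 hσ).continuousOn
  refine intervalIntegral.integral_hasDerivAt_right ?_
    (hc.stronglyMeasurableAtFilter (isOpen_profileDom a) t (mem_profileDom ha ht))
    (hasDerivAt_phi hσ (mem_profileDom ha ht)).continuousAt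
  refine (hc.mono fun s hs => ?_).intervalIntegrable
  rw [Set.uIcc_of_le ht] at hs
  exact mem_profileDom ha hs.1

/-- The bounded quantity is `f(r)`, the integral of `(1 + a s²)^(-σ)` over `[0, r]`; the integrand
is integrable on the line because `2σ > 1`. Thus `∇F` is bounded. -/
theorem exists_bound_mul_phi (ha : 0 < a) (hσ : 1 / 2 < σ) :
    ∃ M, 0 ≤ M ∧ ∀ r, 0 ≤ r → r * phi a σ (r ^ 2) ≤ M := by
  have hi : Integrable (fun s : ℝ => powProfile a σ (s ^ 2)) := by
    have h1 : Integrable (fun s : ℝ => (1 + ‖s‖ ^ 2) ^ (-(2 * σ) / 2)) :=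
      integrable_rpow_neg_one_add_norm_sq (by simp; linarith)
    set c := min 1 a
    have hc : 0 < c := lt_min one_pos ha
    refine (h1.const_mul (c ^ (-σ))).mono' ?_ (Eventually.of_forall fun s => ?_)
    · have : Continuous fun s : ℝ => powProfile a σ (s ^ 2) :=
        Continuous.rpow_const (by fun_prop) fun s => Or.inl (by positivity)
      exact this.aestronglyMeasurable
    · rw [Real.norm_of_nonneg (powProfile_pos (by positivity)).le, Real.norm_eq_abs, sq_abs,
        show -(2 * σ) / 2 = -σ by ring, ← Real.mul_rpow hc.le (by positivity), powProfile]
      refine Real.rpow_le_rpow_of_nonpos (by positivity) ?_ (by linarith)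
      nlinarith [min_le_left 1 a, min_le_right 1 a, sq_nonneg s]
  refine ⟨∫ s, powProfile a σ (s ^ 2),
    integral_nonneg fun s => (powProfile_pos (by positivity)).le, fun r hr => ?_⟩
  rw [← fFun_eq ha, fFun]
  simp only [gFun_sq ha]
  rw [intervalIntegral.integral_of_le hr]
  exact setIntegral_le_integral hi
    (Eventually.of_forall fun s => (powProfile_pos (by positivity)).le)

/-- `f` has derivative `g² ≥ 0`; in other words `F` is convex. The pairing of centres rests on this.
-/
theorem mul_phi_mono (ha : 0 < a) {r s : ℝ} (hrs : r ≤ s) :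
    r * phi a σ (r ^ 2) ≤ s * phi a σ (s ^ 2) := by
  rw [← fFun_eq ha, ← fFun_eq ha, fFun, fFun]
  simp only [gFun_sq ha]
  have hc : Continuous fun s : ℝ => powProfile a σ (s ^ 2) :=
    Continuous.rpow_const (by fun_prop) fun s => Or.inl (by positivity)
  rw [← intervalIntegral.integral_add_adjacent_intervals (hc.intervalIntegrable 0 r)
    (hc.intervalIntegrable r s)]
  have : 0 ≤ ∫ u in r..s, powProfile a σ (u ^ 2) :=
    intervalIntegral.integral_nonneg hrs fun u _ => (powProfile_pos (by positivity)).le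
  linarith

end RadialProfile

/-! ### Radial functions about a centre and the components of `∇F_c` -/

section Radial

variable {n : ℕ} {a σ : ℝ}

theorem hasFDerivAt_norm_sub_sq (c x : Rn n) :
    HasFDerivAt (fun y : Rn n => ‖y - c‖ ^ 2) (2 • innerSL ℝ (x - c)) x := by
  have := (hasStrictFDerivAt_norm_sq (x - c)).hasFDerivAt.comp x
    ((hasFDerivAt_id x).sub_const c)
  rwa [ContinuousLinearMap.comp_id] at this

theorem hasFDerivAt_radial {θ : ℝ → ℝ} {d : ℝ} {c x : Rn n} (h : HasDerivAt θ d (‖x - c‖ ^ 2)) :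
    HasFDerivAt (fun y : Rn n => θ (‖y - c‖ ^ 2)) (d • (2 • innerSL ℝ (x - c))) x :=
  h.comp_hasFDerivAt x (hasFDerivAt_norm_sub_sq c x)

theorem pd_radial {θ : ℝ → ℝ} {d : ℝ} {c x : Rn n} (h : HasDerivAt θ d (‖x - c‖ ^ 2)) (j : Fin n) :
    pd j (fun y : Rn n => θ (‖y - c‖ ^ 2)) x = 2 * d * (x j - c j) := by
  rw [pd, (hasFDerivAt_radial h).fderiv]
  simp [EuclideanSpace.inner_single_right]
  ring

theorem contDiff_radial {θ : ℝ → ℝ} {m : WithTop ℕ∞} (ha : 0 < a)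
    (h : ContDiffOn ℝ m θ (profileDom a)) (c : Rn n) :
    ContDiff ℝ m fun y : Rn n => θ (‖y - c‖ ^ 2) := by
  have h1 : ContDiff ℝ m fun y : Rn n => ‖y - c‖ ^ 2 :=
    (contDiff_id.sub contDiff_const).norm_sq ℝ
  exact h.comp_contDiff h1 fun x => mem_profileDom ha (sq_nonneg _)

theorem contDiffOn_powProfile (m : WithTop ℕ∞) (τ : ℝ) :
    ContDiffOn ℝ m (powProfile a τ) (profileDom a) :=
  ContDiffOn.rpow_const_of_ne (by fun_prop) fun t ht => by linarith [half_lt_of_mem ht]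

theorem contDiff_coord (m : WithTop ℕ∞) (c : Rn n) (j : Fin n) :
    ContDiff ℝ m fun x : Rn n => x j - c j :=
  (EuclideanSpace.proj (𝕜 := ℝ) j).contDiff.sub contDiff_const

theorem pd_coord (c x : Rn n) (i j : Fin n) :
    pd i (fun x : Rn n => x j - c j) x = if i = j then 1 else 0 := by
  have : HasFDerivAt (fun x : Rn n => x j - c j) (EuclideanSpace.proj (𝕜 := ℝ) j) x :=
    (EuclideanSpace.proj (𝕜 := ℝ) j).hasFDerivAt.sub_const _
  rw [pd, this.fderiv]
  simp [eq_comm]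

theorem dF_eq (ha : 0 < a) (hσ : 0 ≤ σ) (c : Rn n) (j : Fin n) (x : Rn n) :
    dF a σ c j x = phi a σ (‖x - c‖ ^ 2) * (x j - c j) := by
  have h : HasDerivAt (fun t => (1 / 2) * ∫ s in (0 : ℝ)..t, phi a σ s)
      ((1 / 2) * phi a σ (‖x - c‖ ^ 2)) (‖x - c‖ ^ 2) :=
    (hasDerivAt_integral_phi ha hσ (sq_nonneg _)).const_mul _
  have h2 := pd_radial h j
  simp only [dF, FFun_eq ha hσ]
  rw [pd] at h2
  rw [h2]
  ring

end Radial

end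

end MultiCenter

namespace MultiCenter

noncomputable section

/-! ### The kinetic commutator estimate for a single centre -/

section OneCenter

variable {n : ℕ} {a σ : ℝ}

theorem pd_mul {f g : Rn n → ℝ} (hf : Differentiable ℝ f) (hg : Differentiable ℝ g) (j : Fin n)
    (x : Rn n) : pd j (fun x => f x * g x) x = pd j f x * g x + f x * pd j g x :=
  congrFun (pd_smul hf hg j) x

theorem pd_comm {v : Rn n → ℝ} (hv : ContDiff ℝ 2 v) (i j : Fin n) (x : Rn n) :
    pd i (pd j v) x = pd j (pd i v) x := by
  have hd : DifferentiableAt ℝ (fderiv ℝ v) x :=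
    ((hv.fderiv_right (m := 1) (by norm_num)).differentiable one_ne_zero) x
  have h (k l : Fin n) : pd k (pd l v) x
      = fderiv ℝ (fderiv ℝ v) x (EuclideanSpace.single k 1) (EuclideanSpace.single l 1) := by
    have := (hd.hasFDerivAt.clm_apply (hasFDerivAt_const (EuclideanSpace.single l (1 : ℝ)) x))
    rw [pd, show pd l v = fun y => fderiv ℝ v y (EuclideanSpace.single l (1 : ℝ)) from rfl,
      this.fderiv]
    simp
  rw [h, h]
  exact (hv.contDiffAt.isSymmSndFDerivAt (by simp)) _ _

theorem sum_coord_sq (c x : Rn n) : ∑ i, (x i - c i) * (x i - c i) = ‖x - c‖ ^ 2 := by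
  rw [EuclideanSpace.norm_sq_eq]
  refine Finset.sum_congr rfl fun i _ => ?_
  simp [sq]

/-- The divergence of the vector field `∇F_c`. -/
def divF (n : ℕ) (a σ t : ℝ) : ℝ := n * phi a σ t + 2 * t * phi' a σ t

theorem contDiffOn_divF (m : ℕ) (hσ : 0 ≤ σ) : ContDiffOn ℝ m (divF n a σ) (profileDom a) :=
  (contDiffOn_const.mul (contDiffOn_phi m hσ)).add
    ((contDiffOn_const.mul contDiffOn_id).mul (contDiffOn_phi' m hσ))

theorem hasDerivAt_divF (hσ : 0 ≤ σ) {t : ℝ} (ht : t ∈ profileDom a) :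
    HasDerivAt (divF n a σ)
      ((n - 1) * phi' a σ t - σ * a * powProfile a (σ + 1) t) t := by
  have h := ((hasDerivAt_phi hσ ht).const_mul (n : ℝ)).add
    (((hasDerivAt_id t).const_mul 2).mul (hasDerivAt_phi' hσ ht))
  refine HasDerivAt.congr_deriv (f := divF n a σ) h ?_
  have := three_mul_phi'_add hσ ht
  simp only [id]
  linarith

theorem contDiff_dF (m : ℕ) (ha : 0 < a) (hσ : 0 ≤ σ) (c : Rn n) (j : Fin n) :
    ContDiff ℝ m (dF a σ c j) := by
  rw [show dF a σ c j = _ from funext (dF_eq ha hσ c j)]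
  exact (contDiff_radial ha (contDiffOn_phi m hσ) c).mul (contDiff_coord m c j)

theorem pd_dF (ha : 0 < a) (hσ : 0 ≤ σ) (c : Rn n) (i j : Fin n) (x : Rn n) :
    pd i (dF a σ c j) x = 2 * phi' a σ (‖x - c‖ ^ 2) * (x i - c i) * (x j - c j)
      + phi a σ (‖x - c‖ ^ 2) * (if i = j then 1 else 0) := by
  rw [show dF a σ c j = _ from funext (dF_eq ha hσ c j),
    pd_mul ((contDiff_radial ha (contDiffOn_phi 1 hσ) c).differentiable (by simp))
      ((contDiff_coord 1 c j).differentiable one_ne_zero),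
    pd_radial (hasDerivAt_phi hσ (mem_profileDom ha (sq_nonneg _))), pd_coord]

theorem sum_pd_dF (ha : 0 < a) (hσ : 0 ≤ σ) (c : Rn n) (x : Rn n) :
    ∑ j, pd j (dF a σ c j) x = divF n a σ (‖x - c‖ ^ 2) := by
  simp only [pd_dF ha hσ, if_true, mul_one, Finset.sum_add_distrib, Finset.sum_const,
    Finset.card_univ, Fintype.card_fin, nsmul_eq_mul, mul_assoc, ← Finset.mul_sum, sum_coord_sq,
    divF]
  ring

/-- The first order operator `2 ∇F_c · ∇ + Δ F_c`, which is `i γ_c`. -/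
def dilation {E : Type*} [NormedAddCommGroup E] [NormedSpace ℝ E] (a σ : ℝ) (c : Rn n)
    (v : Rn n → E) (x : Rn n) : E :=
  ∑ j, (pd j (fun y => dF a σ c j y • v y) x + dF a σ c j x • pd j v x)

theorem dilation_eq (ha : 0 < a) (hσ : 0 ≤ σ) (c : Rn n) {v : Rn n → ℝ}
    (hv : Differentiable ℝ v) (x : Rn n) :
    dilation a σ c v x = 2 * (phi a σ (‖x - c‖ ^ 2) * ∑ k, (x k - c k) * pd k v x)
      + divF n a σ (‖x - c‖ ^ 2) * v x := by
  rw [← sum_pd_dF ha hσ, Finset.sum_mul, Finset.mul_sum, Finset.mul_sum,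
    ← Finset.sum_add_distrib, dilation]
  refine Finset.sum_congr rfl fun j _ => ?_
  rw [pd_smul ((contDiff_dF 1 ha hσ c j).differentiable (by simp)) hv]
  simp only [smul_eq_mul, dF_eq ha hσ c j x]
  ring

/-- The radial weight `⟨x - c⟩^(-σ)`. -/
theorem contDiff_weight (m : WithTop ℕ∞) (ha : 0 < a) (c : Rn n) :
    ContDiff ℝ m fun x : Rn n => gFun a σ ‖x - c‖ := by
  simp only [gFun_eq ha]
  exact contDiff_radial ha (contDiffOn_powProfile m _) c

theorem pd_weight (ha : 0 < a) (c : Rn n) (j : Fin n) (x : Rn n) :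
    pd j (fun x : Rn n => gFun a σ ‖x - c‖) x
      = -(σ * a) * powProfile a (σ / 2 + 1) (‖x - c‖ ^ 2) * (x j - c j) := by
  simp only [gFun_eq ha]
  rw [pd_radial (hasDerivAt_powProfile _ (by positivity))]
  ring

/-- All powers of `q = 1 + a|x-c|²` are written as polynomials in `q` times the single factor
`powProfile a (σ + 2)`, so that the comparison in `pointwise_bound` is polynomial. -/
theorem sum_sq_pd_weight_mul (ha : 0 < a) (c : Rn n) {v : Rn n → ℝ}
    (hv : Differentiable ℝ v) (x : Rn n) :
    ∑ j, pd j (fun x => gFun a σ ‖x - c‖ * v x) x ^ 2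
      = (1 + a * ‖x - c‖ ^ 2) ^ 2 * powProfile a (σ + 2) (‖x - c‖ ^ 2) * ∑ j, pd j v x * pd j v x
        - 2 * σ * a * (1 + a * ‖x - c‖ ^ 2) * powProfile a (σ + 2) (‖x - c‖ ^ 2)
          * (v x * ∑ k, (x k - c k) * pd k v x)
        + σ ^ 2 * a ^ 2 * ‖x - c‖ ^ 2 * powProfile a (σ + 2) (‖x - c‖ ^ 2) * (v x * v x) := by
  have hq : 0 < 1 + a * ‖x - c‖ ^ 2 := by positivity
  have hK := powProfile_half_sq (σ := σ + 2) hq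
  rw [show (σ + 2) / 2 = σ / 2 + 1 by ring] at hK
  have hG := powProfile_succ (τ := σ / 2) hq
  have e1 (j : Fin n) : pd j (fun x => gFun a σ ‖x - c‖ * v x) x ^ 2
      = (1 + a * ‖x - c‖ ^ 2) ^ 2 * powProfile a (σ / 2 + 1) (‖x - c‖ ^ 2) ^ 2
          * (pd j v x * pd j v x)
        - 2 * σ * a * (1 + a * ‖x - c‖ ^ 2) * powProfile a (σ / 2 + 1) (‖x - c‖ ^ 2) ^ 2
          * v x * ((x j - c j) * pd j v x)
        + σ ^ 2 * a ^ 2 * powProfile a (σ / 2 + 1) (‖x - c‖ ^ 2) ^ 2 * (v x * v x)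
          * ((x j - c j) * (x j - c j)) := by
    rw [pd_mul ((contDiff_weight 1 ha c).differentiable one_ne_zero) hv, pd_weight ha, gFun_eq ha,
      ← hG]
    ring
  simp only [e1, Finset.sum_add_distrib, Finset.sum_sub_distrib, ← Finset.mul_sum, sum_coord_sq]
  rw [hK]
  ring

/-- The algebraic core of the kinetic estimate. `D2` cancels the second derivatives `B` and the term
`d S` of `D1`. `D3` cancels the cross term `P₁ v Z` and leaves a signed multiple of `P₁ v²`. The
coefficient of `D4` is tuned so that the remaining cross term completes a square. -/
theorem pointwise_bound (hn : 3 ≤ n) (ha : 0 < a) (hσ : 0 < σ) {v : ℝ}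
    {t P P₁ h S Z lapη D1 D2 D3 D4 W B d : ℝ}
    (ht : 0 ≤ t) (hP₁ : P₁ ≤ 0) (hh : 0 ≤ h) (hS : 0 ≤ S) (hZ : Z ^ 2 ≤ t * S)
    (hP : P + 2 * t * P₁ = (1 + a * t) ^ 2 * h)
    (hD1 : D1 = lapη + (4 * P₁ * Z ^ 2 + 2 * P * (S + B)
      + 2 * ((n - 1) * P₁ - σ * a * ((1 + a * t) * h)) * (v * Z) + d * S))
    (hD2 : D2 = d * S + 2 * P * B)
    (hD3 : D3 = ((n - 3) * P₁ - σ * a * ((1 + a * t) * h)) * (v * v) + 2 * P₁ * (v * Z))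
    (hD4 : D4 = (n * ((1 + a * t) * h) - 2 * (σ + 1) * a * t * h) * (v * v)
      + 2 * ((1 + a * t) * h) * (v * Z))
    (hW : W = (1 + a * t) ^ 2 * h * S - 2 * σ * a * (1 + a * t) * h * (v * Z)
      + σ ^ 2 * a ^ 2 * t * h * (v * v)) :
    -2 * D1 + 2 * D2 + 2 * (n - 1) * D3 + (2 * σ - 2 * σ / (n - 2)) * a * D4
      ≤ -2 * lapη - (4 - σ / ((n : ℝ) - 2) ^ 2) * W := by
  have hn' : (3 : ℝ) ≤ n := by exact_mod_cast hn
  obtain ⟨m, hm⟩ : ∃ m : ℝ, m = (n : ℝ) - 2 := ⟨_, rfl⟩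
  have hm1 : 1 ≤ m := by linarith
  have hm0 : 0 < m := by linarith
  have hnm : (n : ℝ) = m + 2 := by linarith
  set κ := 2 * m - σ
  set q := 1 + a * t with hq
  have hq0 : 0 < q := by positivity
  -- In the application this is `|q ∇v + κ a v (x-c)|²`; in the abstract variables Cauchy–Schwarz,
  -- `Z² ≤ t S`, replaces the geometry.
  have hQ : 0 ≤ q ^ 2 * S + 2 * (κ * a * q * (v * Z)) + κ ^ 2 * a ^ 2 * t * (v * v) := by
    have h1 : (κ * a * q * (v * Z)) ^ 2 ≤ (q ^ 2 * S) * (κ ^ 2 * a ^ 2 * t * (v * v)) := by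
      have h2 : 0 ≤ (κ * a * q * v) ^ 2 * (t * S - Z ^ 2) :=
        mul_nonneg (sq_nonneg _) (by linarith)
      linarith
    have hX : 0 ≤ q ^ 2 * S := by positivity
    have hY : 0 ≤ κ ^ 2 * a ^ 2 * t * (v * v) :=
      mul_nonneg (by positivity) (mul_self_nonneg v)
    have h3 := abs_le_of_sq_le_sq' (a := 2 * (κ * a * q * (v * Z)))
      (b := q ^ 2 * S + κ ^ 2 * a ^ 2 * t * (v * v)) (by
        nlinarith [sq_nonneg (q ^ 2 * S - κ ^ 2 * a ^ 2 * t * (v * v))]) (by linarith)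
    linarith [h3.1]
  -- The defect is a sum of four nonnegative terms: the non-radial part of the gradient, a
  -- zero-order term with factor `(n-1)(n-3)`, the completed square, and a zero-order remainder.
  have hid : (-2 * lapη - (4 - σ / ((n : ℝ) - 2) ^ 2) * W) -
      (-2 * D1 + 2 * D2 + 2 * (n - 1) * D3 + (2 * σ - 2 * σ / (n - 2)) * a * D4)
      = 8 * (-P₁) * (t * S - Z ^ 2) + 2 * (m + 1) * (m - 1) * (-P₁) * (v * v)
        + σ / m ^ 2 * (h * (q ^ 2 * S + 2 * (κ * a * q * (v * Z))
          + κ ^ 2 * a ^ 2 * t * (v * v))) + 4 * σ / m * (a * h * (v * v)) := by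
    obtain rfl : P = q ^ 2 * h - 2 * t * P₁ := by linarith
    rw [hD1, hD2, hD3, hD4, hW, hnm]
    simp only [q, κ, add_sub_cancel_right]
    field_simp
    ring
  have t1 : 0 ≤ 8 * (-P₁) * (t * S - Z ^ 2) := mul_nonneg (by linarith) (by linarith)
  have t2 : 0 ≤ 2 * (m + 1) * (m - 1) * (-P₁) * (v * v) :=
    mul_nonneg (mul_nonneg (mul_nonneg (by linarith) (by linarith)) (by linarith))
      (mul_self_nonneg v)
  have t3 := mul_nonneg (div_nonneg hσ.le (sq_nonneg m)) (mul_nonneg hh hQ)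
  have t4 : 0 ≤ 4 * σ / m * (a * h * (v * v)) :=
    mul_nonneg (by positivity) (mul_nonneg (by positivity) (mul_self_nonneg v))
  linarith

/-- The left side of `pointwise_bound` is a combination of divergences of compactly supported `C¹`
fields, so it integrates to zero. -/
theorem one_center_bound (hn : 3 ≤ n) (ha : 0 < a) (hσ : 0 < σ) (c : Rn n) {v : Rn n → ℝ}
    (hv : IsCc ∞ v) :
    (4 - σ / ((n : ℝ) - 2) ^ 2) * ∫ x, ∑ j, pd j (fun x => gFun a σ ‖x - c‖ * v x) x ^ 2
      ≤ -2 * ∫ x, lapl v x * dilation a σ c v x := by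
  have hv3 : IsCc 3 v := hv.of_le (WithTop.coe_le_coe.2 le_top)
  have hv2 : IsCc 2 v := hv.of_le two_le_infty
  have hvd : Differentiable ℝ v := hv2.contDiff.differentiable (by norm_num)
  have hp2 j : IsCc 2 (pd j v) := hv3.pd (by norm_num) j
  have hpd j : Differentiable ℝ (pd j v) := (hp2 j).contDiff.differentiable (by norm_num)
  set Pf : Rn n → ℝ := fun x => phi a σ (‖x - c‖ ^ 2) with hPf
  set Qf : Rn n → ℝ := fun x => phi' a σ (‖x - c‖ ^ 2) with hQf
  set Hf : Rn n → ℝ := fun x => powProfile a (σ + 1) (‖x - c‖ ^ 2) with hHf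
  set df : Rn n → ℝ := fun x => divF n a σ (‖x - c‖ ^ 2) with hdf
  set Zf : Rn n → ℝ := fun x => ∑ k, (x k - c k) * pd k v x with hZf
  set Sf : Rn n → ℝ := fun x => ∑ k, pd k v x * pd k v x with hSf
  have cP : ContDiff ℝ 1 Pf := contDiff_radial ha (contDiffOn_phi 1 hσ.le) c
  have cQ : ContDiff ℝ 1 Qf := contDiff_radial ha (contDiffOn_phi' 1 hσ.le) c
  have cH : ContDiff ℝ 1 Hf := contDiff_radial ha (contDiffOn_powProfile 1 _) c
  have cd : ContDiff ℝ 1 df := contDiff_radial ha (contDiffOn_divF 1 hσ.le) c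
  have hmem x : ‖x - c‖ ^ 2 ∈ profileDom a := mem_profileDom ha (sq_nonneg _)
  have pP i x : pd i Pf x = 2 * Qf x * (x i - c i) := pd_radial (hasDerivAt_phi hσ.le (hmem x)) i
  have pQ i x : pd i Qf x = 2 * phi'' a σ (‖x - c‖ ^ 2) * (x i - c i) :=
    pd_radial (hasDerivAt_phi' hσ.le (hmem x)) i
  have pH i x : pd i Hf x = 2 * (-((σ + 1) * a) * powProfile a (σ + 2) (‖x - c‖ ^ 2))
      * (x i - c i) := by
    have := pd_radial (hasDerivAt_powProfile (a := a) (σ + 1) (t := ‖x - c‖ ^ 2) (by positivity)) i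
    rwa [show σ + 1 + 1 = σ + 2 by ring] at this
  have pdf i x : pd i df x = 2 * ((n - 1) * Qf x - σ * a * Hf x) * (x i - c i) :=
    pd_radial (hasDerivAt_divF hσ.le (hmem x)) i
  have ccoord j : ContDiff ℝ 1 fun x : Rn n => x j - c j := contDiff_coord 1 c j
  have dcoord j : Differentiable ℝ fun x : Rn n => x j - c j :=
    (ccoord j).differentiable one_ne_zero
  have hp1 j : IsCc 1 (pd j v) := (hp2 j).of_le (by norm_num)
  have hv1 : IsCc 1 v := hv2.of_le (by norm_num)
  have cZ : IsCc 1 Zf := IsCc.sum fun k _ => IsCc.smul (ccoord k) (hp1 k)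
  have cS : IsCc 1 Sf := IsCc.sum fun k _ => IsCc.smul (hp1 k).contDiff (hp1 k)
  have cvv : IsCc 1 fun x => v x * v x := IsCc.smul hv1.contDiff hv1
  have pZ i x : pd i Zf x = pd i v x + ∑ k, (x k - c k) * pd i (pd k v) x := by
    simp only [hZf]
    rw [pd_sum (v := fun k x => (x k - c k) * pd k v x) fun k _ => (dcoord k).mul (hpd k)]
    simp only [pd_mul (dcoord _) (hpd _), pd_coord, Finset.sum_add_distrib, ite_mul, one_mul,
      zero_mul, Finset.sum_ite_eq, Finset.mem_univ, if_true]
  have pS i x : pd i Sf x = 2 * ∑ k, pd k v x * pd i (pd k v) x := by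
    simp only [hSf]
    rw [pd_sum (v := fun k x => pd k v x * pd k v x) fun k _ => (hpd k).mul (hpd k),
      Finset.mul_sum]
    refine Finset.sum_congr rfl fun k _ => ?_
    rw [pd_mul (hpd k) (hpd k)]
    ring
  have pvv i x : pd i (fun x => v x * v x) x = 2 * (v x * pd i v x) := by
    rw [pd_mul hvd hvd]; ring
  set ηf : Rn n → ℝ := fun x => 2 * (Pf x * Zf x) + df x * v x with hηf
  have hη x : dilation a σ c v x = ηf x := dilation_eq ha hσ.le c hvd x
  have cη : IsCc 1 ηf := (IsCc.smul (contDiff_const (c := (2 : ℝ))) (IsCc.smul cP cZ)).add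
    (IsCc.smul cd hv1)
  have pη i x : pd i ηf x = 4 * Qf x * (x i - c i) * Zf x + 2 * Pf x * pd i Zf x
      + 2 * ((n - 1) * Qf x - σ * a * Hf x) * (x i - c i) * v x + df x * pd i v x := by
    have dP := cP.differentiable one_ne_zero
    have dZ := cZ.contDiff.differentiable one_ne_zero
    have dd := cd.differentiable one_ne_zero
    simp only [hηf]
    rw [pd_add (v := fun x => 2 * (Pf x * Zf x)) (w := fun x => df x * v x)
      ((dP.mul dZ).const_mul 2) (dd.mul hvd)]
    beta_reduce
    rw [pd_mul dd hvd,
      pd_mul (f := fun _ => (2 : ℝ)) (g := fun x => Pf x * Zf x) (differentiable_const _) (dP.mul dZ), pd_mul dP dZ, pP, pdf]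
    have : pd i (fun _ : Rn n => (2 : ℝ)) x = 0 := by simp [pd]
    rw [this]
    ring
  -- the four divergences
  have cW1 i : IsCc 1 fun x => pd i v x * ηf x := IsCc.smul (hp1 i).contDiff cη
  have cW2 i : IsCc 1 fun x => (Pf x * (x i - c i)) * Sf x :=
    IsCc.smul (cP.mul (ccoord i)) cS
  have cW3 i : IsCc 1 fun x => (Qf x * (x i - c i)) * (v x * v x) :=
    IsCc.smul (cQ.mul (ccoord i)) cvv
  have cW4 i : IsCc 1 fun x => (Hf x * (x i - c i)) * (v x * v x) :=
    IsCc.smul (cH.mul (ccoord i)) cvv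
  have divcoord {f : Rn n → ℝ} (hf : ContDiff ℝ 1 f) {w : Rn n → ℝ} (hw : IsCc 1 w) (x : Rn n)
      {δ : ℝ} (hδ : ∀ i, pd i f x = δ * (x i - c i)) :
      ∑ i, pd i (fun x => (f x * (x i - c i)) * w x) x
        = (δ * ‖x - c‖ ^ 2 + n * f x) * w x + f x * ∑ i, (x i - c i) * pd i w x := by
    have df := hf.differentiable one_ne_zero
    have dw := hw.contDiff.differentiable one_ne_zero
    have e i : pd i (fun x => (f x * (x i - c i)) * w x) x
        = δ * w x * ((x i - c i) * (x i - c i)) + f x * w x + f x * ((x i - c i) * pd i w x) := by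
      rw [pd_mul (f := fun x => f x * (x i - c i)) (df.mul (dcoord i)) dw, pd_mul df (dcoord i),
        pd_coord, if_pos rfl, hδ]
      ring
    simp only [e, Finset.sum_add_distrib, ← Finset.mul_sum, sum_coord_sq, Finset.sum_const,
      Finset.card_univ, Fintype.card_fin, nsmul_eq_mul]
    ring
  have hpt x : -2 * (∑ i, pd i (fun x => pd i v x * ηf x) x)
      + 2 * (∑ i, pd i (fun x => (Pf x * (x i - c i)) * Sf x) x)
      + 2 * (n - 1) * (∑ i, pd i (fun x => (Qf x * (x i - c i)) * (v x * v x)) x)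
      + (2 * σ - 2 * σ / (n - 2)) * a
        * (∑ i, pd i (fun x => (Hf x * (x i - c i)) * (v x * v x)) x)
      ≤ -2 * (lapl v x * ηf x)
        - (4 - σ / ((n : ℝ) - 2) ^ 2) * ∑ j, pd j (fun x => gFun a σ ‖x - c‖ * v x) x ^ 2 := by
    have hq : 0 < 1 + a * ‖x - c‖ ^ 2 := by positivity
    have hH : Hf x = (1 + a * ‖x - c‖ ^ 2) * powProfile a (σ + 2) (‖x - c‖ ^ 2) := by
      rw [show σ + 2 = σ + 1 + 1 by ring, powProfile_succ hq]
    -- These are the only second-derivative terms outside `Δv`; the first two divergences both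
    -- produce them, and they cancel.
    obtain ⟨Bi, hBi⟩ : ∃ Bi : Fin n → ℝ, ∀ i, Bi i
      = ∑ k, pd i v x * ((x k - c k) * pd i (pd k v) x) := ⟨_, fun _ => rfl⟩
    refine pointwise_bound hn ha hσ (v := v x) (t := ‖x - c‖ ^ 2) (P := Pf x) (P₁ := Qf x)
      (h := powProfile a (σ + 2) (‖x - c‖ ^ 2)) (S := Sf x) (Z := Zf x) (d := df x)
      (B := ∑ i, Bi i)
      (sq_nonneg _) (phi'_nonpos ha hσ.le (hmem x)) (powProfile_pos hq).le
      (Finset.sum_nonneg fun k _ => mul_self_nonneg _) ?_ ?_ ?_ ?_ ?_ ?_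
      (sum_sq_pd_weight_mul ha c hvd x)
    · have := Finset.sum_mul_sq_le_sq_mul_sq Finset.univ (fun k => x k - c k) (fun k => pd k v x)
      simp only [sq, sum_coord_sq, hZf, hSf] at this ⊢
      simpa only [sq, sum_coord_sq] using this
    · refine (phi_add (hmem x)).trans ?_
      rw [← powProfile_succ hq]
      linear_combination (1 + a * ‖x - c‖ ^ 2) * hH
    · have e i : pd i (fun x => pd i v x * ηf x) x = pd i (pd i v) x * ηf x
          + (4 * Qf x * Zf x * ((x i - c i) * pd i v x) + 2 * Pf x * (pd i v x * pd i v x)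
          + 2 * Pf x * Bi i
          + 2 * ((n - 1) * Qf x - σ * a * Hf x) * v x * ((x i - c i) * pd i v x)
          + df x * (pd i v x * pd i v x)) := by
        rw [pd_mul (hpd i) (cη.contDiff.differentiable one_ne_zero), pη, pZ, hBi, ← Finset.mul_sum]
        ring
      simp only [e, Finset.sum_add_distrib, ← Finset.mul_sum, ← Finset.sum_mul]
      rw [← hH]
      simp only [lapl, hZf, hSf]
      ring
    · rw [divcoord cP cS x (pP · x)]
      have e : ∑ i, (x i - c i) * pd i Sf x = 2 * ∑ i, Bi i := by
        simp only [hBi, pS, Finset.mul_sum]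
        rw [Finset.sum_comm]
        refine Finset.sum_congr rfl fun i _ => Finset.sum_congr rfl fun k _ => ?_
        -- Symmetry of second derivatives identifies this sum with the one coming from the first
        -- divergence.
        rw [pd_comm hv2.contDiff k i]
        ring
      rw [e]
      simp only [hdf, hPf, hQf, divF]
      ring
    · rw [divcoord cQ cvv x (pQ · x)]
      have h3 := three_mul_phi'_add hσ.le (hmem x)
      simp only [pvv, hZf]
      rw [← hH]
      have e : ∑ i, (x i - c i) * (2 * (v x * pd i v x))
          = 2 * (v x * ∑ k, (x k - c k) * pd k v x) := by
        simp only [Finset.mul_sum]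
        exact Finset.sum_congr rfl fun i _ => by ring
      rw [e]
      simp only [hQf, hHf]
      linear_combination (v x * v x) * h3
    · rw [divcoord cH cvv x (pH · x)]
      simp only [pvv, hZf]
      have e : ∑ i, (x i - c i) * (2 * (v x * pd i v x))
          = 2 * (v x * ∑ k, (x k - c k) * pd k v x) := by
        simp only [Finset.mul_sum]
        exact Finset.sum_congr rfl fun i _ => by ring
      rw [e, ← hH]
      ring
  have iW {W : Fin n → Rn n → ℝ} (hW : ∀ i, IsCc 1 (W i)) :
      Integrable (fun x => ∑ i, pd i (W i) x) ∧ ∫ x, ∑ i, pd i (W i) x = 0 := by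
    have hi i : Integrable (pd i (W i)) := ((hW i).pd (k := 0) (by norm_num) i).integrable
    refine ⟨integrable_finsetSum _ fun i _ => hi i, ?_⟩
    rw [integral_finsetSum _ fun i _ => hi i]
    exact Finset.sum_eq_zero fun i _ => integral_pd (hW i) i
  have hL : Integrable fun x => lapl v x * ηf x :=
    (IsCc.smul (k := 0) (hv2.lapl (k := 0) (by norm_num)).contDiff
      (cη.of_le (by simp))).integrable
  have hG : Integrable fun x => ∑ j, pd j (fun x => gFun a σ ‖x - c‖ * v x) x ^ 2 := by
    refine integrable_finsetSum _ fun j _ => ?_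
    have cw : IsCc 1 fun x => gFun a σ ‖x - c‖ * v x := IsCc.smul (contDiff_weight 1 ha c) hv1
    have := cw.pd (k := 0) (by norm_num) j
    simpa only [sq, smul_eq_mul] using (IsCc.smul this.contDiff this).integrable
  have I1 := iW cW1
  have I2 := iW cW2
  have I3 := iW cW3
  have I4 := iW cW4
  have hmono := integral_mono ((((I1.1.const_mul (-2)).add (I2.1.const_mul 2)).add
    (I3.1.const_mul (2 * (n - 1)))).add (I4.1.const_mul ((2 * σ - 2 * σ / (n - 2)) * a)))
    ((hL.const_mul (-2)).sub (hG.const_mul (4 - σ / ((n : ℝ) - 2) ^ 2))) hpt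
  simp only [hη]
  have hl : ∫ x, lapl v x * dilation a σ c v x = ∫ x, lapl v x * ηf x := by simp only [hη]
  rw [integral_sub' (hL.const_mul _) (hG.const_mul _), integral_const_mul, integral_const_mul,
    integral_add' (((I1.1.const_mul _).add (I2.1.const_mul _)).add (I3.1.const_mul _))
      (I4.1.const_mul _),
    integral_add' ((I1.1.const_mul _).add (I2.1.const_mul _)) (I3.1.const_mul _),
    integral_add' (I1.1.const_mul _) (I2.1.const_mul _), integral_const_mul, integral_const_mul,
    integral_const_mul, integral_const_mul, I1.2, I2.2, I3.2, I4.2] at hmono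
  linarith

end OneCenter

end

end MultiCenter

namespace MultiCenter

noncomputable section

/-! ### Sobolev's inequality on sets of small measure -/

section SmallSets

variable {n : ℕ}

theorem norm_fderiv_sq_le (w : Rn n → ℝ) (x : Rn n) :
    ‖fderiv ℝ w x‖ ^ 2 ≤ ∑ j, pd j w x ^ 2 := by
  have h0 : 0 ≤ ∑ j, pd j w x ^ 2 := Finset.sum_nonneg fun j _ => sq_nonneg _
  have h : ‖fderiv ℝ w x‖ ≤ √(∑ j, pd j w x ^ 2) := by
    refine ContinuousLinearMap.opNorm_le_bound _ (Real.sqrt_nonneg _) fun y => ?_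
    have hy : y = ∑ j, y j • EuclideanSpace.single j (1 : ℝ) := by
      have := (EuclideanSpace.basisFun (Fin n) ℝ).sum_repr y
      simpa using this.symm
    have h1 : fderiv ℝ w x y = ∑ j, y j * pd j w x := by
      conv_lhs => rw [hy]
      simp [map_sum, pd]
    rw [h1, Real.norm_eq_abs, EuclideanSpace.norm_eq, mul_comm]
    refine Real.abs_le_sqrt ?_ |>.trans_eq (Real.sqrt_mul (Finset.sum_nonneg fun j _ => sq_nonneg _) _)
    simpa using Finset.sum_mul_sq_le_sq_mul_sq Finset.univ (fun j => y j) (fun j => pd j w x)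
  calc _ ≤ √(∑ j, pd j w x ^ 2) ^ 2 := pow_le_pow_left₀ (norm_nonneg _) h 2
    _ = _ := Real.sq_sqrt h0

theorem integrable_sum_sq_pd {w : Rn n → ℝ} (hw : IsCc 1 w) :
    Integrable fun x => ∑ j, pd j w x ^ 2 := by
  refine integrable_finsetSum _ fun j _ => ?_
  have := hw.pd (k := 0) (by norm_num) j
  simpa only [sq, smul_eq_mul] using (IsCc.smul this.contDiff this).integrable

open ENNReal NNReal in
/-- On sets of small measure, the `L²` norm of a compactly supported function is a small multiple
of the norm of its gradient. -/
theorem exists_setIntegral_sq_le (hn : 3 ≤ n) {η : ℝ} (hη : 0 < η) :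
    ∃ δ : ℝ≥0∞, 0 < δ ∧ ∀ s : Set (Rn n), volume s ≤ δ → ∀ w : Rn n → ℝ, IsCc 1 w →
      ∫ x in s, w x ^ 2 ≤ η * ∫ x, ∑ j, pd j w x ^ 2 := by
  have hn' : (3 : ℝ) ≤ n := by exact_mod_cast hn
  have hfin : Module.finrank ℝ (Rn n) = n := finrank_euclideanSpace_fin
  -- The Sobolev exponent of `2`, finite because `n ≥ 3`.
  obtain ⟨p', hp'inv⟩ : ∃ p' : ℝ≥0, (p' : ℝ)⁻¹ = 2⁻¹ - (n : ℝ)⁻¹ := by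
    have : (n : ℝ)⁻¹ ≤ 2⁻¹ := inv_anti₀ (by norm_num) (by linarith)
    exact ⟨((2 : ℝ)⁻¹ - (n : ℝ)⁻¹)⁻¹.toNNReal, by
      rw [Real.coe_toNNReal _ (inv_nonneg.2 (by linarith)), inv_inv]⟩
  have h2p : (2 : ℝ) ≤ p' := by
    have h1 : 0 < (n : ℝ)⁻¹ := by positivity
    have h2 : (n : ℝ)⁻¹ ≤ 3⁻¹ := inv_anti₀ (by norm_num) hn'
    have h3 : (p' : ℝ)⁻¹ ≤ 2⁻¹ := by rw [hp'inv]; linarith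
    have h4 : (0 : ℝ) < (p' : ℝ)⁻¹ := by rw [hp'inv]; norm_num at h2 ⊢; linarith
    exact (inv_le_inv₀ (inv_pos.1 h4) two_pos).1 h3
  set K : ℝ≥0 := eLpNormLESNormFDerivOfEqInnerConst (volume : Measure (Rn n)) (2 : ℝ≥0)
  -- Hölder from exponent `p'` down to `2` on `s` costs `|s|^(1/n)`, since `1/2 - 1/p' = 1/n`. The
  -- root of `η` appears because norms are compared before squaring.
  obtain ⟨δ, hδ, hδK⟩ : ∃ δ : ℝ≥0∞, 0 < δ ∧ (K : ℝ≥0∞) * δ ^ (n : ℝ)⁻¹ ≤ ENNReal.ofReal (√η) := by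
    have ht : Tendsto (fun δ : ℝ≥0∞ => (K : ℝ≥0∞) * δ ^ (n : ℝ)⁻¹) (𝓝 0) (𝓝 0) := by
      have h1 := (ENNReal.continuous_rpow_const (y := (n : ℝ)⁻¹)).tendsto 0
      rw [ENNReal.zero_rpow_of_pos (by positivity)] at h1
      simpa using ENNReal.Tendsto.const_mul h1 (Or.inr (coe_ne_top (r := K)))
    have h2 := ht.eventually_le_const
      (show (0 : ℝ≥0∞) < ENNReal.ofReal (√η) by simpa using hη)
    obtain ⟨e, he, he'⟩ := ENNReal.nhds_zero_basis.eventually_iff.1 h2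
    obtain ⟨d, hd0, hd⟩ := exists_between he
    exact ⟨d, hd0, he' hd⟩
  refine ⟨δ, hδ, fun s hs w hw => ?_⟩
  have hgns := eLpNorm_le_eLpNorm_fderiv_of_eq_inner (volume : Measure (Rn n)) (p := 2) (p' := p')
    hw.contDiff hw.supp (by norm_num) (by rw [hfin]; omega) (by rw [hfin, hp'inv]; norm_num)
  have hres : eLpNorm w 2 (volume.restrict s) ≤
      ENNReal.ofReal (√η) * eLpNorm (fderiv ℝ w) 2 volume := by
    have h1 := eLpNorm_le_eLpNorm_mul_rpow_measure_univ (μ := volume.restrict s) (p := 2)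
      (q := (p' : ℝ≥0∞)) (f := w) (by exact_mod_cast h2p)
      hw.contDiff.continuous.aestronglyMeasurable
    have hexp : 1 / (2 : ℝ≥0∞).toReal - 1 / (p' : ℝ≥0∞).toReal = (n : ℝ)⁻¹ := by
      rw [ENNReal.coe_toReal, one_div, one_div, hp'inv]; simp
    rw [hexp, Measure.restrict_apply_univ] at h1
    calc _ ≤ eLpNorm w p' (volume.restrict s) * volume s ^ (n : ℝ)⁻¹ := h1
      _ ≤ (K * eLpNorm (fderiv ℝ w) 2 volume) * δ ^ (n : ℝ)⁻¹ := by
          gcongr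
          exact (eLpNorm_restrict_le w p' volume s).trans hgns
      _ = (K * δ ^ (n : ℝ)⁻¹) * eLpNorm (fderiv ℝ w) 2 volume := by ring
      _ ≤ _ := by gcongr
  have hfm : MemLp (fderiv ℝ w) 2 volume :=
    ((hw.contDiff.continuous_fderiv (by norm_num)).memLp_of_hasCompactSupport
      (hw.supp.fderiv (𝕜 := ℝ)))
  have hwm : MemLp w 2 (volume.restrict s) := hw.memLp.restrict s
  rw [hwm.eLpNorm_eq_integral_rpow_norm (by norm_num) (by norm_num),
    hfm.eLpNorm_eq_integral_rpow_norm (by norm_num) (by norm_num),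
    ← ENNReal.ofReal_mul (Real.sqrt_nonneg _), ENNReal.ofReal_le_ofReal_iff (by positivity)] at hres
  simp only [ENNReal.toReal_ofNat, Real.rpow_ofNat] at hres
  have i1 : 0 ≤ ∫ x in s, ‖w x‖ ^ 2 := integral_nonneg fun x => by positivity
  have i2 : 0 ≤ ∫ x, ‖fderiv ℝ w x‖ ^ 2 := integral_nonneg fun x => by positivity
  have hsq := pow_le_pow_left₀ (by positivity) hres 2
  rw [mul_pow, Real.sq_sqrt hη.le, show (2 : ℝ)⁻¹ = 1 / 2 by norm_num, ← Real.sqrt_eq_rpow,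
    ← Real.sqrt_eq_rpow, Real.sq_sqrt i1, Real.sq_sqrt i2] at hsq
  have hle : ∫ x, ‖fderiv ℝ w x‖ ^ 2 ≤ ∫ x, ∑ j, pd j w x ^ 2 :=
    integral_mono ((memLp_two_iff_integrable_sq_norm hfm.1).1 hfm) (integrable_sum_sq_pd hw)
      (norm_fderiv_sq_le w)
  simp only [Real.norm_eq_abs, sq_abs] at hsq
  exact hsq.trans (mul_le_mul_of_nonneg_left hle hη.le)

end SmallSets

/-! ### Symmetric pairs of centres and the divergence of their sum -/

section Pairing

variable {n : ℕ} {a σ : ℝ}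

/-- The gradient of `F(|z|)`. -/
def gradF (a σ : ℝ) (z : Rn n) : Rn n := phi a σ (‖z‖ ^ 2) • z

theorem gradF_neg (z : Rn n) : gradF a σ (-z) = -gradF a σ z := by
  simp [gradF]

theorem norm_gradF (ha : 0 < a) (z : Rn n) : ‖gradF a σ z‖ = ‖z‖ * phi a σ (‖z‖ ^ 2) := by
  rw [gradF, norm_smul, Real.norm_of_nonneg (phi_nonneg (mem_profileDom ha (sq_nonneg _))), mul_comm]

/-- Quantitative monotonicity of `∇F`. The pairing equals `(f(|z|) - f(|z'|))(|z| - |z'|)`,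
nonnegative because `f` increases, plus the angular defect, which is kept. -/
theorem le_inner_gradF_sub (ha : 0 < a) (z z' : Rn n) :
    (phi a σ (‖z‖ ^ 2) + phi a σ (‖z'‖ ^ 2)) * (‖z‖ * ‖z'‖ - ⟪z, z'⟫_ℝ)
      ≤ ⟪z - z', gradF a σ z - gradF a σ z'⟫_ℝ := by
  have hid : ⟪z - z', gradF a σ z - gradF a σ z'⟫_ℝ
      = (‖z‖ * phi a σ (‖z‖ ^ 2) - ‖z'‖ * phi a σ (‖z'‖ ^ 2)) * (‖z‖ - ‖z'‖)
        + (phi a σ (‖z‖ ^ 2) + phi a σ (‖z'‖ ^ 2)) * (‖z‖ * ‖z'‖ - ⟪z, z'⟫_ℝ) := by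
    simp only [gradF, inner_sub_left, inner_sub_right, inner_smul_right,
      real_inner_self_eq_norm_sq, real_inner_comm z z']
    ring
  have hm : 0 ≤ (‖z‖ * phi a σ (‖z‖ ^ 2) - ‖z'‖ * phi a σ (‖z'‖ ^ 2)) * (‖z‖ - ‖z'‖) := by
    rcases le_total ‖z‖ ‖z'‖ with h | h
    · exact mul_nonneg_of_nonpos_of_nonpos (by linarith [mul_phi_mono (σ := σ) ha h])
        (by linarith)
    · exact mul_nonneg (by linarith [mul_phi_mono (σ := σ) ha h]) (by linarith)
  linarith

/-- The joint contribution of the centers `± m b`. -/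
def pairTerm (a σ : ℝ) (b : Rn n) (m : ℕ) (y : Rn n) : ℝ :=
  ⟪y, gradF a σ (y - (m : ℝ) • b)⟫_ℝ + ⟪y, gradF a σ (y + (m : ℝ) • b)⟫_ℝ

/-- Take `z = y + mb` and `z' = mb - y`: then `z - z' = 2y`, whence the factor `1/2`, and oddness of
`∇F` converts `z'` to `y - mb`. -/
theorem le_pairTerm (ha : 0 < a) (b : Rn n) (m : ℕ) (y : Rn n) :
    (1 / 2) * ((phi a σ (‖y + (m : ℝ) • b‖ ^ 2) + phi a σ (‖(m : ℝ) • b - y‖ ^ 2))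
      * (‖y + (m : ℝ) • b‖ * ‖(m : ℝ) • b - y‖ - ⟪y + (m : ℝ) • b, (m : ℝ) • b - y⟫_ℝ))
      ≤ pairTerm a σ b m y := by
  have h := le_inner_gradF_sub (σ := σ) ha (y + (m : ℝ) • b) ((m : ℝ) • b - y)
  have h1 : y - (m : ℝ) • b = -((m : ℝ) • b - y) := by abel
  have h2 : y + (m : ℝ) • b - ((m : ℝ) • b - y) = (2 : ℝ) • y := by rw [two_smul]; abel
  rw [h2, inner_smul_left, conj_trivial,
    inner_sub_right y (gradF a σ (y + (m : ℝ) • b))] at h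
  rw [pairTerm, h1, gradF_neg, inner_neg_right]
  linarith

theorem pairTerm_nonneg (ha : 0 < a) (b : Rn n) (m : ℕ) (y : Rn n) : 0 ≤ pairTerm a σ b m y := by
  refine le_trans ?_ (le_pairTerm ha b m y)
  have h1 := phi_nonneg (σ := σ) (mem_profileDom ha (sq_nonneg ‖y + (m : ℝ) • b‖))
  have h2 := phi_nonneg (σ := σ) (mem_profileDom ha (sq_nonneg ‖(m : ℝ) • b - y‖))
  have h3 := real_inner_le_norm (y + (m : ℝ) • b) ((m : ℝ) • b - y)
  exact mul_nonneg (by norm_num) (mul_nonneg (by linarith) (by linarith))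

/-- For `b ≠ 0` the Gram determinant of `b` and `y` is positive off the line, so the angular defect
is bounded below uniformly in `m`, while `φ` at distance of order `m` is at least a multiple of
`1/m`. For `b = 0` the pair term is a positive constant. -/
theorem exists_le_pairTerm (ha : 0 < a) (hσ : 0 ≤ σ) {b y : Rn n}
    (hy : y ∉ Submodule.span ℝ {b}) :
    ∃ δ > 0, ∀ m : ℕ, δ * (1 / ((m : ℝ) + 1)) ≤ pairTerm a σ b (m + 1) y := by
  have hy0 : y ≠ 0 := fun h => hy (h ▸ Submodule.zero_mem _)
  have hc0 : 0 < powProfile a σ 1 := powProfile_pos (by linarith)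
  have hyn : 0 < ‖y‖ := norm_pos_iff.2 hy0
  by_cases hb : b = 0
  · subst hb
    refine ⟨2 * (phi a σ (‖y‖ ^ 2) * ‖y‖ ^ 2), ?_, fun m => ?_⟩
    · have := phi_ge ha hσ (norm_nonneg y)
      have h2 : 0 < powProfile a σ 1 / (1 + ‖y‖) := by positivity
      have h3 := h2.trans_le this
      positivity
    · have h3 := phi_nonneg (σ := σ) (mem_profileDom ha (sq_nonneg ‖y‖))
      have h4 : 1 / ((m : ℝ) + 1) ≤ 1 := by
        rw [div_le_one (by positivity)]; linarith [(m.cast_nonneg : (0 : ℝ) ≤ m)]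
      simp only [pairTerm, smul_zero, sub_zero, add_zero, gradF, inner_smul_right,
        real_inner_self_eq_norm_sq]
      have h5 : 0 ≤ phi a σ (‖y‖ ^ 2) * ‖y‖ ^ 2 := by positivity
      nlinarith
  · set G := ‖b‖ ^ 2 * ‖y‖ ^ 2 - ⟪b, y⟫_ℝ ^ 2 with hG
    have hG0 : 0 < G := by
      have h1 := abs_real_inner_le_norm b y
      have h2 : |⟪b, y⟫_ℝ| ≠ ‖b‖ * ‖y‖ := by
        intro h
        have := (norm_inner_eq_norm_iff (𝕜 := ℝ) hb hy0).1 (by rw [Real.norm_eq_abs]; exact h)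
        obtain ⟨r, -, hr⟩ := this
        exact hy (Submodule.mem_span_singleton.2 ⟨r, hr.symm⟩)
      have h3 := lt_of_le_of_ne h1 h2
      have h4 := pow_lt_pow_left₀ h3 (abs_nonneg _) two_ne_zero
      rw [sq_abs, mul_pow] at h4
      linarith
    have hbn : 0 < ‖b‖ := norm_pos_iff.2 hb
    set β := ‖b‖ + ‖y‖ with hβ
    have hβ0 : 0 < β := by positivity
    set c := powProfile a σ 1
    refine ⟨(1 / 2) * ((2 * (c / (1 + β))) * (2 * G / β ^ 2)), by positivity, fun m => ?_⟩
    refine le_trans ?_ (le_pairTerm ha b (m + 1) y)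
    set M : ℝ := ((m + 1 : ℕ) : ℝ) with hM
    have hM1 : 1 ≤ M := by rw [hM]; push_cast; linarith [(m.cast_nonneg : (0 : ℝ) ≤ m)]
    have hM0 : 0 < M := by linarith
    have hMm : (m : ℝ) + 1 = M := by rw [hM]; push_cast; ring
    have nb : ‖M • b‖ = M * ‖b‖ := by rw [norm_smul, Real.norm_of_nonneg hM0.le]
    have n1 : ‖y + M • b‖ ≤ M * β := by
      have := norm_add_le y (M • b)
      rw [nb] at this
      nlinarith
    have n2 : ‖M • b - y‖ ≤ M * β := by
      have := norm_sub_le (M • b) y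
      rw [nb] at this
      nlinarith
    have hphi {z : Rn n} (hz : ‖z‖ ≤ M * β) : c / (1 + β) * (1 / M) ≤ phi a σ (‖z‖ ^ 2) := by
      refine le_trans ?_ (phi_ge ha hσ (norm_nonneg z))
      rw [div_mul_div_comm, mul_one]
      refine div_le_div_of_nonneg_left hc0.le (by positivity) ?_
      nlinarith
    have hp := add_le_add (hphi n1) (hphi n2)
    have hgram : 2 * G / β ^ 2 ≤ ‖y + M • b‖ * ‖M • b - y‖ - ⟪y + M • b, M • b - y⟫_ℝ := by
      set P := ‖y + M • b‖ * ‖M • b - y‖ with hP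
      set q := ⟪y + M • b, M • b - y⟫_ℝ with hq
      have hqP : q ≤ P := real_inner_le_norm _ _
      have hPβ : P ≤ (M * β) * (M * β) :=
        mul_le_mul n1 n2 (norm_nonneg _) (by positivity)
      -- The left side is the Gram determinant of `y + Mb` and `Mb - y`. Dividing by `P + q ≤
      -- 2(Mβ)²` removes the dependence on `M`.
      have hid : P ^ 2 - q ^ 2 = 4 * M ^ 2 * G := by
        have e1 : ‖y + M • b‖ ^ 2 = ‖y‖ ^ 2 + 2 * (M * ⟪b, y⟫_ℝ) + M ^ 2 * ‖b‖ ^ 2 := by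
          rw [norm_add_sq_real, inner_smul_right, nb, real_inner_comm]; ring
        have e2 : ‖M • b - y‖ ^ 2 = M ^ 2 * ‖b‖ ^ 2 - 2 * (M * ⟪b, y⟫_ℝ) + ‖y‖ ^ 2 := by
          rw [norm_sub_sq_real, inner_smul_left, nb]; simp; ring
        have e3 : q = M ^ 2 * ‖b‖ ^ 2 - ‖y‖ ^ 2 := by
          rw [hq]
          simp only [inner_add_left, inner_sub_right, inner_smul_left, inner_smul_right,
            real_inner_self_eq_norm_sq, conj_trivial, real_inner_comm b y]
          ring
        rw [hP, mul_pow, e1, e2, e3, hG]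
        ring
      rw [div_le_iff₀ (by positivity)]
      by_contra! hlt
      have h6 : (P - q) * (P + q) ≤ (P - q) * (2 * (M * β) ^ 2) :=
        mul_le_mul_of_nonneg_left (by nlinarith) (by linarith)
      have h7 : (P - q) * β ^ 2 * (2 * M ^ 2) < 2 * G * (2 * M ^ 2) :=
        mul_lt_mul_of_pos_right hlt (by positivity)
      nlinarith
    rw [hMm]
    calc _ = (1 / 2) * ((c / (1 + β) * (1 / M) + c / (1 + β) * (1 / M)) * (2 * G / β ^ 2)) := by ring
      _ ≤ _ := by
        refine mul_le_mul_of_nonneg_left ?_ (by norm_num)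
        exact mul_le_mul hp hgram (by positivity) ((by positivity : (0:ℝ) ≤ _).trans hp)

theorem tendsto_sum_pairTerm (ha : 0 < a) (hσ : 0 ≤ σ) {b y : Rn n}
    (hy : y ∉ Submodule.span ℝ {b}) :
    Tendsto (fun N => ∑ m ∈ Finset.range N, pairTerm a σ b (m + 1) y) atTop atTop := by
  obtain ⟨δ, hδ, h⟩ := exists_le_pairTerm ha hσ hy
  refine tendsto_atTop_mono (fun N => ?_)
    (Real.tendsto_sum_range_one_div_nat_succ_atTop.const_mul_atTop hδ)
  rw [Finset.mul_sum]
  exact Finset.sum_le_sum fun m _ => h m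

/-- Re-centring the chain at `b` makes its index range asymmetric: `N` full pairs, the centre
itself, and two unpaired indices at the negative end. -/
theorem sum_Icc_shift (f : ℤ → ℝ) (N : ℕ) :
    ∑ k ∈ Finset.Icc (-((N + 1 : ℕ) : ℤ)) ((N + 1 : ℕ) : ℤ), f (k - 1)
      = f (-(N : ℤ) - 2) + f (-(N : ℤ) - 1) + f 0
        + ∑ m ∈ Finset.range N, (f ((m : ℤ) + 1) + f (-((m : ℤ) + 1))) := by
  induction N with
  | zero =>
    have : Finset.Icc (-((0 + 1 : ℕ) : ℤ)) ((0 + 1 : ℕ) : ℤ) = {-1, 0, 1} := by decide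
    rw [this]
    simp
    ring
  | succ N ih =>
    have : Finset.Icc (-((N + 1 + 1 : ℕ) : ℤ)) ((N + 1 + 1 : ℕ) : ℤ)
        = insert (-((N : ℤ) + 2)) (insert ((N : ℤ) + 2)
          (Finset.Icc (-((N + 1 : ℕ) : ℤ)) ((N + 1 : ℕ) : ℤ))) := by
      ext k
      simp only [Finset.mem_Icc, Finset.mem_insert]
      push_cast
      omega
    rw [this, Finset.sum_insert (by simp; omega), Finset.sum_insert (by simp), ih,
      Finset.sum_range_succ]
    push_cast
    rw [show -((N : ℤ) + 2) - 1 = -((N : ℤ) + 1) - 2 by ring,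
      show (N : ℤ) + 2 - 1 = N + 1 by ring,
      show -((N : ℤ) + 1) - 1 = -(N : ℤ) - 2 by ring,
      show -(N : ℤ) - 1 = -((N : ℤ) + 1) by ring]
    ring

/-- The centre `b` itself contributes `φ |y|² ≥ 0`, and each of the two unpaired centres at least
`-M|y|`. -/
theorem sum_inner_gradF_ge (ha : 0 < a) {M : ℝ}
    (hM : ∀ r, 0 ≤ r → r * phi a σ (r ^ 2) ≤ M) (b y : Rn n) (N : ℕ) :
    ∑ m ∈ Finset.range N, pairTerm a σ b (m + 1) y - 2 * M * ‖y‖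
      ≤ ∑ k ∈ Finset.Icc (-((N + 1 : ℕ) : ℤ)) ((N + 1 : ℕ) : ℤ),
        ⟪y, gradF a σ (y + b - (k : ℝ) • b)⟫_ℝ := by
  have e (k : ℤ) : ⟪y, gradF a σ (y + b - (k : ℝ) • b)⟫_ℝ
      = ⟪y, gradF a σ (y - ((k - 1 : ℤ) : ℝ) • b)⟫_ℝ := by
    simp only [Int.cast_sub, Int.cast_one, sub_smul, one_smul]
    congr 2
    abel
  rw [Finset.sum_congr rfl fun k _ => e k,
    sum_Icc_shift (fun m : ℤ => ⟪y, gradF a σ (y - (m : ℝ) • b)⟫_ℝ)]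
  have hb (z : Rn n) : -(M * ‖y‖) ≤ ⟪y, gradF a σ z⟫_ℝ := by
    have h1 := neg_le_of_abs_le (abs_real_inner_le_norm y (gradF a σ z))
    have h2 := hM ‖z‖ (norm_nonneg z)
    rw [norm_gradF ha] at h1
    nlinarith [norm_nonneg y]
  have h0 : 0 ≤ ⟪y, gradF a σ (y - ((0 : ℤ) : ℝ) • b)⟫_ℝ := by
    simp only [Int.cast_zero, zero_smul, sub_zero, gradF, inner_smul_right,
      real_inner_self_eq_norm_sq]
    exact mul_nonneg (phi_nonneg (mem_profileDom ha (sq_nonneg _))) (sq_nonneg _)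
  have hs : ∑ m ∈ Finset.range N, pairTerm a σ b (m + 1) y
      = ∑ m ∈ Finset.range N, (⟪y, gradF a σ (y - (((m : ℤ) + 1 : ℤ) : ℝ) • b)⟫_ℝ
        + ⟪y, gradF a σ (y - ((-((m : ℤ) + 1) : ℤ) : ℝ) • b)⟫_ℝ) := by
    refine Finset.sum_congr rfl fun m _ => ?_
    rw [pairTerm]
    push_cast
    rw [neg_smul, sub_neg_eq_add]
  rw [hs]
  have h1 := hb (y - ((-(N : ℤ) - 2 : ℤ) : ℝ) • b)
  have h2 := hb (y - ((-(N : ℤ) - 1 : ℤ) : ℝ) • b)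
  linarith

end Pairing

end

end MultiCenter

namespace MultiCenter

noncomputable section

/-! ### The commutator with one radially decreasing potential -/

section Potential

variable {n : ℕ} {a σ : ℝ}

/-- The gradient of a radially decreasing function points towards its centre. At the centre there is
a maximum, so the gradient vanishes and `ρ = 0` serves. -/
theorem exists_fderiv_radial {V : ℝ → ℝ} {b : Rn n}
    (hV : ContDiff ℝ 1 fun x : Rn n => V ‖x - b‖) (hanti : AntitoneOn V (Set.Ici 0)) (x : Rn n) :
    ∃ ρ, 0 ≤ ρ ∧ ρ * ‖x - b‖ ≤ ‖fderiv ℝ (fun x : Rn n => V ‖x - b‖) x‖ ∧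
      ∀ w, fderiv ℝ (fun x : Rn n => V ‖x - b‖) x w = -ρ * ⟪x - b, w⟫_ℝ := by
  by_cases hx : x = b
  · subst hx
    have hmax : IsLocalMax (fun y : Rn n => V ‖y - x‖) x := by
      refine Eventually.of_forall fun y => ?_
      simp only [sub_self, norm_zero]
      exact hanti (Set.mem_Ici.2 le_rfl) (norm_nonneg _) (norm_nonneg _)
    exact ⟨0, le_rfl, by simp, fun w => by rw [hmax.fderiv_eq_zero]; simp⟩
  have hy : 0 < ‖x - b‖ := norm_pos_iff.2 (sub_ne_zero.2 hx)
  have ht : 0 < ‖x - b‖ ^ 2 := by positivity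
  have hdiff : DifferentiableAt ℝ (fun t => V √t) (‖x - b‖ ^ 2) := by
    -- Smoothness is assumed only for the function on `ℝⁿ`; restricting it to the ray from `b`
    -- through `x` recovers differentiability of the profile.
    have h1 : (fun t => V √t) =ᶠ[𝓝 (‖x - b‖ ^ 2)]
        (fun x : Rn n => V ‖x - b‖) ∘ fun t => b + (√t * ‖x - b‖⁻¹) • (x - b) := by
      refine Eventually.of_forall fun t => ?_
      simp only [Function.comp_apply, add_sub_cancel_left, norm_smul]
      rw [Real.norm_of_nonneg (by positivity), mul_assoc, inv_mul_cancel₀ hy.ne', mul_one]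
    refine DifferentiableAt.congr_of_eventuallyEq ?_ h1
    refine DifferentiableAt.comp _ ((hV.differentiable (by norm_num)).differentiableAt) ?_
    exact (((differentiableAt_id.sqrt ht.ne').mul_const _).smul_const _).const_add _
  have hd : deriv (fun t => V √t) (‖x - b‖ ^ 2) ≤ 0 := by
    have h1 : AntitoneOn (fun t => V √t) (Set.Ioi 0) := fun s _ t _ hst =>
      hanti (Real.sqrt_nonneg s) (Real.sqrt_nonneg t) (Real.sqrt_le_sqrt hst)
    rw [← derivWithin_of_isOpen isOpen_Ioi (Set.mem_Ioi.2 ht)]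
    exact h1.derivWithin_nonpos
  have hf := (hasFDerivAt_radial (c := b) hdiff.hasDerivAt).fderiv
  simp only [Real.sqrt_sq (norm_nonneg _)] at hf
  have hw (w : Rn n) : fderiv ℝ (fun x : Rn n => V ‖x - b‖) x w
      = -(-2 * deriv (fun t => V √t) (‖x - b‖ ^ 2)) * ⟪x - b, w⟫_ℝ := by
    rw [hf]
    simp only [smul_apply, innerSL_apply_apply, nsmul_eq_mul, smul_eq_mul]
    push_cast
    ring
  refine ⟨_, by linarith, ?_, hw⟩
  have h2 := (neg_le_abs _).trans
    ((fderiv ℝ (fun x : Rn n => V ‖x - b‖) x).le_opNorm (x - b))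
  rw [hw, real_inner_self_eq_norm_sq] at h2
  refine le_of_mul_le_mul_right ?_ hy
  linarith

/-- The points of a ball at which the first `N` pairs of centers do not yet dominate. -/
def badSet (a σ : ℝ) (b : Rn n) (M R : ℝ) (N : ℕ) : Set (Rn n) :=
  {x | ‖x‖ ≤ R ∧ ∑ m ∈ Finset.range N, pairTerm a σ b (m + 1) (x - b) < 2 * M * ‖x - b‖}

theorem continuous_gradF (ha : 0 < a) (hσ : 0 ≤ σ) :
    Continuous (gradF a σ : Rn n → Rn n) := by
  have h := contDiff_radial (m := (0 : ℕ)) ha (contDiffOn_phi 0 hσ) (0 : Rn n)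
  simp only [sub_zero] at h
  exact h.continuous.smul continuous_id

theorem continuous_pairTerm (ha : 0 < a) (hσ : 0 ≤ σ) (b : Rn n) (m : ℕ) :
    Continuous (pairTerm a σ b m) := by
  have h := continuous_gradF (n := n) ha hσ
  unfold pairTerm
  fun_prop

theorem measurableSet_badSet (ha : 0 < a) (hσ : 0 ≤ σ) (b : Rn n) (M R : ℝ) (N : ℕ) :
    MeasurableSet (badSet a σ b M R N) := by
  have h (m : ℕ) := continuous_pairTerm ha hσ b m
  have h1 : MeasurableSet {x : Rn n | ‖x‖ ≤ R} :=
    (isClosed_le continuous_norm continuous_const).measurableSet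
  have h2 : MeasurableSet {x : Rn n |
      ∑ m ∈ Finset.range N, pairTerm a σ b (m + 1) (x - b) < 2 * M * ‖x - b‖} := by
    refine (isOpen_lt ?_ (by fun_prop)).measurableSet
    exact continuous_finsetSum _ fun m _ => (h (m + 1)).comp (continuous_id.sub continuous_const)
  exact h1.inter h2

/-- The sets decrease because pair terms are nonnegative. A point in all of them has `x - b` in the
span of `b`, where alone the pair sums may fail to diverge, and that subspace is null. -/
theorem tendsto_volume_badSet (hn : 3 ≤ n) (ha : 0 < a) (hσ : 0 ≤ σ) (b : Rn n) (M R : ℝ) :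
    Tendsto (fun N => volume (badSet a σ b M R N)) atTop (𝓝 0) := by
  have hanti : Antitone (badSet a σ b M R) := by
    refine antitone_nat_of_succ_le fun N x hx => ⟨hx.1, lt_of_le_of_lt ?_ hx.2⟩
    rw [Finset.sum_range_succ]
    linarith [pairTerm_nonneg (σ := σ) ha b (N + 1) (x - b)]
  have hfin : volume (badSet a σ b M R 0) ≠ ⊤ := by
    refine ((measure_mono (t := Metric.closedBall 0 R) fun x hx => ?_).trans_lt
      measure_closedBall_lt_top).ne
    simpa using hx.1
  have h := tendsto_measure_iInter_atTop (μ := (volume : Measure (Rn n)))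
    (fun N => (measurableSet_badSet ha hσ b M R N).nullMeasurableSet) hanti ⟨0, hfin⟩
  suffices hnull : volume (⋂ N, badSet a σ b M R N) = 0 by rwa [hnull] at h
  have hspan : Submodule.span ℝ {b} ≠ ⊤ := by
    intro htop
    have h1 := (finrank_span_le_card (R := ℝ) {b}).trans_eq (by simp : _ = 1)
    rw [htop, finrank_top, finrank_euclideanSpace_fin] at h1
    omega
  have hnull := Measure.addHaar_submodule (volume : Measure (Rn n)) _ hspan
  refine measure_mono_null (t := (fun x => x - b) ⁻¹' (Submodule.span ℝ {b} : Set (Rn n)))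
    (fun x hx => ?_) (by simpa [sub_eq_add_neg] using hnull)
  by_contra hxb
  have h1 := (tendsto_sum_pairTerm ha hσ hxb).eventually_ge_atTop (2 * M * ‖x - b‖)
  obtain ⟨N, hN⟩ := h1.exists
  exact absurd (Set.mem_iInter.1 hx N).2 (not_lt.2 hN)

theorem sum_dF_mul_pd (ha : 0 < a) (hσ : 0 ≤ σ) (c : Rn n) (U : Rn n → ℝ) (x : Rn n) :
    ∑ j, dF a σ c j x * pd j U x = fderiv ℝ U x (gradF a σ (x - c)) := by
  have hy : gradF a σ (x - c)
      = ∑ j, (gradF a σ (x - c)) j • EuclideanSpace.single j (1 : ℝ) := by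
    have := (EuclideanSpace.basisFun (Fin n) ℝ).sum_repr (gradF a σ (x - c))
    simpa using this.symm
  rw [hy, map_sum]
  refine Finset.sum_congr rfl fun j _ => ?_
  rw [map_smul, smul_eq_mul, dF_eq ha hσ, pd]
  simp [gradF]

/-- `v D_c v` is the divergence of `v² ∇F_c`. -/
theorem integral_mul_dilation (ha : 0 < a) (hσ : 0 ≤ σ) (c : Rn n) {U v : Rn n → ℝ}
    (hU : ContDiff ℝ 1 U) (hv : IsCc ∞ v) :
    ∫ x, U x * (v x * dilation a σ c v x)
      = -∫ x, fderiv ℝ U x (gradF a σ (x - c)) * v x ^ 2 := by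
  have hdF (j : Fin n) := contDiff_dF 1 ha hσ c j
  have hv1 : IsCc ((1 : ℕ) : WithTop ℕ∞) v := hv.of_le (by exact_mod_cast le_top)
  have hdv (j : Fin n) : IsCc ((1 : ℕ) : WithTop ℕ∞) fun x => dF a σ c j x • v x :=
    IsCc.smul (hdF j) hv1
  have hw (j : Fin n) : IsCc ((1 : ℕ) : WithTop ℕ∞) fun x => v x • (dF a σ c j x • v x) :=
    IsCc.smul hv1.contDiff (hdv j)
  have hdil (x : Rn n) : U x * (v x * dilation a σ c v x)
      = ∑ j, U x • pd j (fun x => v x • (dF a σ c j x • v x)) x := by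
    simp only [dilation, Finset.mul_sum]
    refine Finset.sum_congr rfl fun j _ => ?_
    have := pd_mul (hv1.contDiff.differentiable (by norm_num))
      ((hdv j).contDiff.differentiable (by norm_num)) j x
    simp only [smul_eq_mul] at this ⊢
    rw [this]
    ring
  have hi1 (j : Fin n) : Integrable fun x => U x • pd j (fun x => v x • (dF a σ c j x • v x)) x :=
    (IsCc.smul (k := 0) (hU.of_le (by norm_num)) ((hw j).pd (k := 0) (by norm_num) j)).integrable
  have hi2 (j : Fin n) : Integrable fun x => pd j U x • (v x • (dF a σ c j x • v x)) :=
    (IsCc.smul (k := 0) (contDiff_pd hU (by norm_num) j)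
      ((hw j).of_le (by exact_mod_cast zero_le_one))).integrable
  simp only [hdil]
  rw [integral_finsetSum _ fun j _ => hi1 j, ← integral_neg]
  have h3 (j : Fin n) := integral_smul_pd (𝕜 := ℝ) hU (by exact_mod_cast hw j) j
  simp only [h3]
  rw [Finset.sum_neg_distrib, ← integral_finsetSum _ fun j _ => hi2 j, integral_neg]
  congr 1
  refine integral_congr_ae (Eventually.of_forall fun x => ?_)
  simp only [← sum_dF_mul_pd ha hσ, Finset.sum_mul, smul_eq_mul]
  exact Finset.sum_congr rfl fun j _ => by ring

/-- Off the bad set the pairs outweigh the unpaired centres and the sign is favourable. On it only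
the unpaired centres can hurt, by at most `2Mρ|x-b| ≤ 2MC`. -/
theorem fderiv_sum_gradF_le (ha : 0 < a) {M : ℝ} (hM0 : 0 ≤ M)
    (hM : ∀ r, 0 ≤ r → r * phi a σ (r ^ 2) ≤ M) {V : ℝ → ℝ} {b : Rn n}
    (hV : ContDiff ℝ 1 fun x : Rn n => V ‖x - b‖) (hanti : AntitoneOn V (Set.Ici 0)) {C R : ℝ}
    (hC : ∀ x, ‖fderiv ℝ (fun x : Rn n => V ‖x - b‖) x‖ ≤ C)
    (hR : ∀ x, R < ‖x‖ → fderiv ℝ (fun x : Rn n => V ‖x - b‖) x = 0) (N : ℕ) (x : Rn n) :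
    fderiv ℝ (fun x : Rn n => V ‖x - b‖) x
        (∑ k ∈ Finset.Icc (-((N + 1 : ℕ) : ℤ)) ((N + 1 : ℕ) : ℤ), gradF a σ (x - (k : ℝ) • b))
      ≤ (badSet a σ b M R N).indicator (fun _ => 2 * M * C) x := by
  have hC0 : 0 ≤ C := (norm_nonneg _).trans (hC x)
  rcases lt_or_ge R ‖x‖ with hx | hx
  · rw [hR x hx]
    exact Set.indicator_nonneg (fun _ _ => by positivity) _
  obtain ⟨ρ, hρ0, hρ, hw⟩ := exists_fderiv_radial hV hanti x
  rw [hw, inner_sum]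
  have h1 := sum_inner_gradF_ge (σ := σ) ha hM b (x - b) N
  rw [sub_add_cancel] at h1
  by_cases hE : x ∈ badSet a σ b M R N
  · rw [Set.indicator_of_mem hE]
    have h2 : 0 ≤ ∑ m ∈ Finset.range N, pairTerm a σ b (m + 1) (x - b) :=
      Finset.sum_nonneg fun m _ => pairTerm_nonneg ha b _ _
    have h3 := mul_le_mul_of_nonneg_left h1 hρ0
    have h4 := mul_le_mul_of_nonneg_left (hρ.trans (hC x)) hM0
    have h5 := mul_nonneg hρ0 h2
    nlinarith
  · rw [Set.indicator_of_notMem hE]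
    have h2 : 2 * M * ‖x - b‖ ≤ ∑ m ∈ Finset.range N, pairTerm a σ b (m + 1) (x - b) := by
      by_contra! h
      exact hE ⟨hx, h⟩
    have h3 := mul_nonneg hρ0 ((sub_nonneg.2 h2).trans h1)
    linarith

/-- The unfavourable contribution lives on a set of small measure, where the Sobolev bound applied
to `⟨x-c⟩^(-σ) v` absorbs it. The threshold is uniform in `v`. -/
theorem exists_potential_bound (hn : 3 ≤ n) (ha : 0 < a) (hσ : 1 / 2 < σ) {V : ℝ → ℝ} {b : Rn n}
    (hV : ContDiff ℝ 1 fun x : Rn n => V ‖x - b‖)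
    (hsupp : HasCompactSupport fun x : Rn n => V ‖x - b‖)
    (hanti : AntitoneOn V (Set.Ici 0)) (c : Rn n) {η : ℝ} (hη : 0 < η) :
    ∃ N₀ : ℕ, ∀ N, N₀ ≤ N → ∀ v : Rn n → ℝ, IsCc ∞ v →
      -η * ∫ x, ∑ j, pd j (fun x => gFun a σ ‖x - c‖ * v x) x ^ 2
        ≤ 2 * ∑ k ∈ Finset.Icc (-(N : ℤ)) (N : ℤ),
          ∫ x, V ‖x - b‖ * (v x * dilation a σ ((k : ℝ) • b) v x) := by
  have hσ0 : 0 ≤ σ := by linarith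
  obtain ⟨M, hM0, hM⟩ := exists_bound_mul_phi ha hσ
  obtain ⟨C, hC⟩ := (hsupp.fderiv (𝕜 := ℝ)).exists_bound_of_continuous
    (hV.continuous_fderiv (by norm_num))
  have hC0 : 0 ≤ C := (norm_nonneg _).trans (hC 0)
  obtain ⟨R, hR⟩ := (hsupp.fderiv (𝕜 := ℝ)).isCompact.isBounded.subset_closedBall 0
  have hR' (x : Rn n) (hx : R < ‖x‖) : fderiv ℝ (fun x : Rn n => V ‖x - b‖) x = 0 := by
    refine image_eq_zero_of_notMem_tsupport fun h => ?_
    have := hR h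
    rw [mem_closedBall_zero_iff] at this
    linarith
  -- A lower bound for the squared weight on the ball of radius `R`, used to pass from `v` to
  -- `⟨x-c⟩^(-σ) v`.
  set p := powProfile a σ ((R + ‖c‖) ^ 2) with hp
  have hp0 : 0 < p := powProfile_pos (by positivity)
  -- Chosen so that `4MC ∫ v²` over the bad set is at most `η` times the weighted energy; the `+ 1`
  -- keeps the denominator positive when `MC = 0`.
  obtain ⟨δ, hδ, hsmall⟩ := exists_setIntegral_sq_le hn
    (show 0 < η * p / (4 * M * C + 1) by positivity)
  obtain ⟨N₀, hN₀⟩ := eventually_atTop.1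
    ((tendsto_volume_badSet hn ha hσ0 b M R).eventually_le_const hδ)
  -- The chain from `-(K+1)` to `K+1` contains only `K` complete pairs around `b`, whence the shift
  -- by one.
  refine ⟨N₀ + 1, fun N hN v hv => ?_⟩
  obtain ⟨N, rfl⟩ : ∃ K, N = K + 1 := ⟨N - 1, by omega⟩
  have hv1 : IsCc 1 v := hv.of_le (by exact_mod_cast le_top)
  have hwt : IsCc 1 fun x => gFun a σ ‖x - c‖ * v x := IsCc.smul (contDiff_weight 1 ha c) hv1
  have h1 := hsmall _ (hN₀ N (by omega)) _ hwt
  set D := ∫ x, ∑ j, pd j (fun x => gFun a σ ‖x - c‖ * v x) x ^ 2 with hD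
  have hD0 : 0 ≤ D := integral_nonneg fun x => Finset.sum_nonneg fun j _ => sq_nonneg _
  have hE := measurableSet_badSet ha hσ0 b M R N
  have hvsq : Integrable fun x => v x ^ 2 := by
    simpa only [sq, smul_eq_mul] using (IsCc.smul hv1.contDiff hv1).integrable
  have hwsq : Integrable fun x => (gFun a σ ‖x - c‖ * v x) ^ 2 := by
    simpa only [sq, smul_eq_mul] using (IsCc.smul hwt.contDiff hwt).integrable
  have h2 : p * ∫ x in badSet a σ b M R N, v x ^ 2
      ≤ ∫ x in badSet a σ b M R N, (gFun a σ ‖x - c‖ * v x) ^ 2 := by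
    rw [← integral_const_mul]
    refine setIntegral_mono_on (hvsq.const_mul p).integrableOn hwsq.integrableOn hE fun x hx => ?_
    rw [mul_pow, gFun_sq ha]
    refine mul_le_mul_of_nonneg_right ?_ (sq_nonneg _)
    refine powProfile_anti hσ0 (by positivity) (mul_le_mul_of_nonneg_left ?_ ha.le)
    have := (norm_sub_le x c).trans (add_le_add_left hx.1 ‖c‖)
    exact pow_le_pow_left₀ (norm_nonneg _) this 2
  set I := ∫ x in badSet a σ b M R N, v x ^ 2 with hI
  have hI0 : 0 ≤ I := integral_nonneg fun x => sq_nonneg _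
  have h3 : (4 * M * C) * I ≤ η * D := by
    have h4 : (4 * M * C + 1) * (p * I) ≤ η * p * D := by
      have := mul_le_mul_of_nonneg_left (h2.trans h1) (show 0 ≤ 4 * M * C + 1 by positivity)
      refine this.trans_eq ?_
      field_simp
    have h5 : ((4 * M * C + 1) * I) * p ≤ (η * D) * p := by linarith
    have h6 := le_of_mul_le_mul_right h5 hp0
    linarith
  have hint (k : ℤ) : Integrable fun x =>
      fderiv ℝ (fun x : Rn n => V ‖x - b‖) x (gradF a σ (x - (k : ℝ) • b)) * v x ^ 2 := by
    have hc : Continuous fun x : Rn n =>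
        fderiv ℝ (fun x : Rn n => V ‖x - b‖) x (gradF a σ (x - (k : ℝ) • b)) :=
      (hV.continuous_fderiv (by norm_num)).clm_apply
        ((continuous_gradF ha hσ0).comp (continuous_id.sub continuous_const))
    have := (IsCc.smul (k := 0) (contDiff_zero.2 (hc.mul hv1.contDiff.continuous))
      (hv1.of_le (by norm_num))).integrable
    refine this.congr (Eventually.of_forall fun x => ?_)
    simp only [smul_eq_mul, Pi.mul_apply]
    ring
  simp only [integral_mul_dilation ha hσ0 _ hV hv]
  rw [Finset.sum_neg_distrib, ← integral_finsetSum _ fun k _ => hint k]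
  have h7 : ∫ x, ∑ k ∈ Finset.Icc (-((N + 1 : ℕ) : ℤ)) ((N + 1 : ℕ) : ℤ),
      fderiv ℝ (fun x : Rn n => V ‖x - b‖) x (gradF a σ (x - (k : ℝ) • b)) * v x ^ 2
      ≤ 2 * M * C * I := by
    rw [hI, ← integral_const_mul, ← integral_indicator hE]
    refine integral_mono (integrable_finsetSum _ fun k _ => hint k)
      ((hvsq.const_mul _).indicator hE) fun x => ?_
    simp only [← Finset.sum_mul, ← map_sum]
    refine (mul_le_mul_of_nonneg_right
      (fderiv_sum_gradF_le ha hM0 hM hV hanti hC hR' N x) (sq_nonneg (v x))).trans_eq ?_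
    by_cases hx : x ∈ badSet a σ b M R N
    · rw [Set.indicator_of_mem hx, Set.indicator_of_mem hx]
    · rw [Set.indicator_of_notMem hx, Set.indicator_of_notMem hx, zero_mul]
  linarith

end Potential

end

end MultiCenter

namespace MultiCenter

noncomputable section

/-! ### Uniform bounds on the coefficients -/

section Bounds

variable {n : ℕ} {a σ : ℝ}

theorem abs_coord_sub_le (c x : Rn n) (j : Fin n) : |x j - c j| ≤ ‖x - c‖ :=
  PiLp.norm_apply_le (x - c) j

theorem abs_dF_le (ha : 0 < a) (hσ : 0 ≤ σ) {M : ℝ}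
    (hM : ∀ r, 0 ≤ r → r * phi a σ (r ^ 2) ≤ M) (c : Rn n) (j : Fin n) (x : Rn n) :
    |dF a σ c j x| ≤ M := by
  have h0 := phi_nonneg (σ := σ) (mem_profileDom ha (sq_nonneg ‖x - c‖))
  rw [dF_eq ha hσ, abs_mul, abs_of_nonneg h0, mul_comm]
  exact (mul_le_mul_of_nonneg_right (abs_coord_sub_le c x j) h0).trans (hM _ (norm_nonneg _))

theorem abs_mul_coord_le (c x : Rn n) (i j : Fin n) :
    |(x i - c i) * (x j - c j)| ≤ ‖x - c‖ ^ 2 := by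
  rw [abs_mul, sq]
  exact mul_le_mul (abs_coord_sub_le c x i) (abs_coord_sub_le c x j) (abs_nonneg _) (norm_nonneg _)

/-- Since `φ + 2tφ' > 0` and `φ' ≤ 0`, one has `2t|φ'| ≤ φ ≤ 1`; each of the two terms of the
Hessian entry is at most `1`. -/
theorem abs_pd_dF_le (ha : 0 < a) (hσ : 0 ≤ σ) (c : Rn n) (i j : Fin n) (x : Rn n) :
    |pd i (dF a σ c j) x| ≤ 2 := by
  have hm := mem_profileDom ha (sq_nonneg ‖x - c‖)
  have h0 := phi_nonneg (σ := σ) hm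
  have h1 := phi_le_one ha hσ (sq_nonneg ‖x - c‖)
  have h2 := phi'_nonpos ha hσ hm
  have h3 := phi_add (σ := σ) hm
  have h4 := powProfile_pos (a := a) (τ := σ) (t := ‖x - c‖ ^ 2) (by positivity)
  have h5 := abs_mul_coord_le c x i j
  have h6 : |2 * phi' a σ (‖x - c‖ ^ 2) * (x i - c i) * (x j - c j)| ≤ 1 := by
    rw [mul_assoc, abs_mul, abs_mul, abs_of_nonpos h2, abs_two]
    have := mul_le_mul_of_nonneg_left h5 (show 0 ≤ 2 * -phi' a σ (‖x - c‖ ^ 2) by linarith)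
    linarith
  have h7 : |phi a σ (‖x - c‖ ^ 2) * (if i = j then 1 else 0)| ≤ 1 := by
    split_ifs
    · rwa [mul_one, abs_of_nonneg h0]
    · simp
  rw [pd_dF ha hσ]
  exact (abs_add_le _ _).trans (by linarith)

theorem abs_weight_le (ha : 0 < a) (hσ : 0 ≤ σ) (c x : Rn n) : |gFun a σ ‖x - c‖| ≤ 1 := by
  rw [gFun_eq ha, abs_of_pos (powProfile_pos (by positivity))]
  exact powProfile_le_one ha (by linarith) (sq_nonneg _)

theorem abs_pd_weight_le (ha : 0 < a) (hσ : 0 ≤ σ) (c : Rn n) (j : Fin n) (x : Rn n) :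
    |pd j (fun x : Rn n => gFun a σ ‖x - c‖) x| ≤ σ * (1 + a) := by
  have hp : 0 < 1 + a * ‖x - c‖ ^ 2 := by positivity
  have h0 := powProfile_pos (τ := σ / 2 + 1) hp
  have h1 := powProfile_succ (τ := σ / 2) hp
  have h2 := powProfile_le_one (τ := σ / 2) ha (by linarith) (sq_nonneg ‖x - c‖)
  have h3 : a * ‖x - c‖ ≤ (1 + a) * (1 + a * ‖x - c‖ ^ 2) := by
    nlinarith [sq_nonneg (‖x - c‖ - 1), sq_nonneg (a * ‖x - c‖), norm_nonneg (x - c),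
      mul_nonneg ha.le (norm_nonneg (x - c)), sq_nonneg (a * ‖x - c‖ - 1)]
  rw [pd_weight ha, abs_mul, abs_mul, abs_neg, abs_of_nonneg (mul_nonneg hσ ha.le), abs_of_pos h0]
  calc σ * a * powProfile a (σ / 2 + 1) (‖x - c‖ ^ 2) * |x j - c j|
      ≤ σ * a * powProfile a (σ / 2 + 1) (‖x - c‖ ^ 2) * ‖x - c‖ :=
        mul_le_mul_of_nonneg_left (abs_coord_sub_le c x j) (by positivity)
    _ = σ * (powProfile a (σ / 2 + 1) (‖x - c‖ ^ 2) * (a * ‖x - c‖)) := by ring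
    _ ≤ σ * (powProfile a (σ / 2 + 1) (‖x - c‖ ^ 2) * ((1 + a) * (1 + a * ‖x - c‖ ^ 2))) := by
        gcongr
    _ = σ * ((1 + a) * ((1 + a * ‖x - c‖ ^ 2) * powProfile a (σ / 2 + 1) (‖x - c‖ ^ 2))) := by ring
    _ ≤ σ * (1 + a) := by
        rw [h1]
        exact mul_le_mul_of_nonneg_left (mul_le_of_le_one_right (by linarith) h2) hσ

theorem abs_lapl_weight_le (ha : 0 < a) (hσ : 0 ≤ σ) (c x : Rn n) :
    |lapl (fun x : Rn n => gFun a σ ‖x - c‖) x| ≤ n * (σ * a * (σ + 3)) := by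
  have hp : 0 < 1 + a * ‖x - c‖ ^ 2 := by positivity
  have h (j : Fin n) : |pd j (pd j fun x : Rn n => gFun a σ ‖x - c‖) x| ≤ σ * a * (σ + 3) := by
    rw [show pd j (fun x : Rn n => gFun a σ ‖x - c‖) = _ from funext (pd_weight ha c j),
      pd_mul ((contDiff_const.mul (contDiff_radial ha (contDiffOn_powProfile 1 _) c)).differentiable
        one_ne_zero) ((contDiff_coord 1 c j).differentiable one_ne_zero),
      pd_radial (θ := fun t => -(σ * a) * powProfile a (σ / 2 + 1) t)
        ((hasDerivAt_powProfile _ hp).const_mul _), pd_coord, if_pos rfl, mul_one]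
    have h0 := powProfile_pos (τ := σ / 2 + 1 + 1) hp
    have h1 := powProfile_succ (τ := σ / 2 + 1) hp
    have h2 := powProfile_le_one (τ := σ / 2 + 1) ha (by linarith) (sq_nonneg ‖x - c‖)
    have h3 := powProfile_pos (τ := σ / 2 + 1) hp
    have h4 := abs_mul_coord_le c x j j
    have h5 : powProfile a (σ / 2 + 1 + 1) (‖x - c‖ ^ 2) * (a * ‖x - c‖ ^ 2) ≤ 1 := by nlinarith
    have e1 : 2 * (-(σ * a) * (-((σ / 2 + 1) * a) * powProfile a (σ / 2 + 1 + 1) (‖x - c‖ ^ 2)))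
        * (x j - c j) * (x j - c j) = (σ * a * (σ + 2)) *
          (powProfile a (σ / 2 + 1 + 1) (‖x - c‖ ^ 2) * (a * ((x j - c j) * (x j - c j)))) := by
      ring
    refine (abs_add_le _ _).trans ?_
    rw [e1, abs_mul, abs_mul _ (a * _), abs_mul a, abs_of_pos ha, abs_of_pos h0,
      abs_of_nonneg (show 0 ≤ σ * a * (σ + 2) by positivity), abs_mul (-(σ * a)), abs_neg,
      abs_of_nonneg (show 0 ≤ σ * a by positivity), abs_of_pos h3]
    have h6 := (mul_le_mul_of_nonneg_left (mul_le_mul_of_nonneg_left h4 ha.le) h0.le).trans h5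
    have h7 := mul_le_mul_of_nonneg_left h6 (show 0 ≤ σ * a * (σ + 2) by positivity)
    have h8 := mul_le_mul_of_nonneg_left h2 (show 0 ≤ σ * a by positivity)
    linarith
  refine (Finset.abs_sum_le_sum_abs _ _).trans ((Finset.sum_le_sum fun j _ => h j).trans_eq ?_)
  simp

end Bounds

/-! ### Every operator of the theorem is defined on the domain of the Laplacian -/

section Operators

variable {n : ℕ} {a σ : ℝ} {u : ℕ → Rn n → ℂ} {ψ L : L2 n}

theorem IsCc.dilation {E : Type*} [NormedAddCommGroup E] [NormedSpace ℝ E] (ha : 0 < a)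
    (hσ : 0 ≤ σ) (c : Rn n) {v : Rn n → E} (hv : IsCc 1 v) : IsCc 0 (dilation a σ c v) := by
  refine IsCc.sum fun j _ => ?_
  have h1 : ContDiff ℝ 1 (dF a σ c j) := by exact_mod_cast contDiff_dF 1 ha hσ c j
  exact ((IsCc.smul h1 hv).pd (by norm_num) j).add
    (IsCc.smul (h1.of_le (by norm_num)) (hv.pd (by norm_num) j))

theorem Approx.gam (h : Approx u ψ L) (ha : 0 < a) (hσ : 1 / 2 < σ) (c : Rn n) :
    ∃ D, Tendsto (fun m => toL2 (dilation a σ c (u m))) atTop (𝓝 D) ∧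
      (ψ, (-Complex.I) • D) ∈ (gam a σ c).graph := by
  have hσ0 : 0 ≤ σ := by linarith
  obtain ⟨M, -, hM⟩ := exists_bound_mul_phi ha hσ
  have hd (j : Fin n) : ContDiff ℝ 1 (dF a σ c j) := by exact_mod_cast contDiff_dF 1 ha hσ0 c j
  have hC (j : Fin n) := abs_dF_le ha hσ0 hM c j
  choose D1 h1 using fun j => h.pd_mul (hd j) (hC j) j (abs_pd_dF_le ha hσ0 c j j)
  choose D2 h2 using fun j => h.mul_pd (hd j).continuous (hC j) j
  have h3 := Tracks.sum (s := Finset.univ) fun j _ => (h1 j).add (h2 j)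
  refine ⟨_, h3.tendsto.congr fun m => ?_, (h3.smul (-Complex.I)).lim⟩
  have c1 : IsCc 1 (u m) := (h.test m).of_le (by simp)
  have e1 (j : Fin n) : IsCc 0 (MultiCenter.pd j fun x => dF a σ c j x • u m x) :=
    (IsCc.smul (hd j) c1).pd (by norm_num) j
  have e2 (j : Fin n) : IsCc 0 fun x => dF a σ c j x • MultiCenter.pd j (u m) x :=
    IsCc.smul ((hd j).of_le (by norm_num)) (c1.pd (by norm_num) j)
  simp only [← toL2_add (e1 _).memLp (e2 _).memLp]
  exact (toL2_sum fun j _ => ((e1 j).add (e2 j)).memLp).symm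

theorem Approx.gamN (h : Approx u ψ L) (ha : 0 < a) (hσ : 1 / 2 < σ) (b : Rn n) (N : ℕ) :
    ∃ D, Tendsto (fun m => ∑ k ∈ Finset.Icc (-(N : ℤ)) (N : ℤ),
        toL2 (dilation a σ ((k : ℝ) • b) (u m))) atTop (𝓝 D) ∧
      (ψ, (-Complex.I) • D) ∈ (gamN a σ b N).graph := by
  choose D h1 h2 using fun k : ℤ => h.gam ha hσ ((k : ℝ) • b)
  refine ⟨_, tendsto_finsetSum _ fun k _ => h1 k, ?_⟩
  rw [Finset.smul_sum]
  exact (Tracks.sum (u := fun _ => ψ) (v := fun k _ => (-Complex.I) • D k)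
    (s := Finset.Icc (-(N : ℤ)) (N : ℤ)) fun k _ =>
      ⟨fun _ => h2 k, h2 k, tendsto_const_nhds⟩).lim

theorem Approx.weightedLapN (h : Approx u ψ L) (ha : 0 < a) (hσ : 0 ≤ σ) (b : Rn n) (N : ℕ) :
    ∃ W, Tendsto (fun m => ∑ k ∈ Finset.Icc (-(N : ℤ)) (N : ℤ),
        toL2 fun x => gFun a σ ‖x - (k : ℝ) • b‖ •
          lapl (fun y => gFun a σ ‖y - (k : ℝ) • b‖ • u m y) x) atTop (𝓝 W) ∧
      (ψ, W) ∈ (weightedLapN a σ b N).graph := by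
  choose W h1 using fun k : ℤ => h.mul_lap_mul (contDiff_weight (σ := σ) 2 ha ((k : ℝ) • b))
    (abs_weight_le ha hσ _) (abs_pd_weight_le ha hσ _) (abs_lapl_weight_le ha hσ _)
  have h2 := Tracks.sum (s := Finset.Icc (-(N : ℤ)) (N : ℤ)) fun k _ => h1 k
  exact ⟨_, h2.tendsto, h2.lim⟩

theorem Approx.schrodinger (h : Approx u ψ L) {V : Rn n → ℝ} (hV : Continuous V) {C : ℝ}
    (hC : ∀ x, |V x| ≤ C) :
    ∃ D, Tendsto (fun m => -toL2 (lapl (u m)) + toL2 fun x => V x • u m x) atTop (𝓝 D) ∧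
      (ψ, D) ∈ (schrodinger V).graph := by
  obtain ⟨D, hD⟩ := h.mul hV hC
  exact ⟨_, (h.lap.neg.add hD).tendsto, (h.lap.neg.add hD).lim⟩

end Operators

end

end MultiCenter

namespace MultiCenter

noncomputable section

/-! ### Both potentials together, and reduction from complex to real test functions -/

section TestFunctionBounds

variable {n : ℕ} {a σ : ℝ}

/-- The energy of `⟨x - c⟩^(-σ) v`. -/
def weightedEnergy (a σ : ℝ) (c : Rn n) (v : Rn n → ℝ) : ℝ :=
  ∫ x, ∑ j, pd j (fun x => gFun a σ ‖x - c‖ * v x) x ^ 2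

theorem weightedEnergy_nonneg (c : Rn n) (v : Rn n → ℝ) : 0 ≤ weightedEnergy a σ c v :=
  integral_nonneg fun _ => Finset.sum_nonneg fun _ _ => sq_nonneg _

theorem sum_Icc_neg {α : Type*} [AddCommMonoid α] (f : ℤ → α) (N : ℕ) :
    ∑ k ∈ Finset.Icc (-(N : ℤ)) (N : ℤ), f (-k) = ∑ k ∈ Finset.Icc (-(N : ℤ)) (N : ℤ), f k :=
  Finset.sum_nbij' (fun k => -k) (fun k => -k)
    (fun k hk => by simp only [Finset.mem_Icc] at hk ⊢; omega)
    (fun k hk => by simp only [Finset.mem_Icc] at hk ⊢; omega)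
    (fun k _ => neg_neg k) (fun k _ => neg_neg k) (fun k _ => rfl)

/-- The fraction `ε` of the kinetic form controls the weighted energy at the centre `0`, because the
constant of `one_center_bound` is positive, and that energy absorbs both potentials. -/
theorem exists_potentials_bound (hn : 3 ≤ n) (ha : 0 < a) (hσ : 1 / 2 < σ)
    (hσ' : σ < 4 * ((n : ℝ) - 2) ^ 2) {Vm Vp : ℝ → ℝ} {b : Rn n}
    (hVm : ContDiff ℝ 1 fun x : Rn n => Vm ‖x + b‖) (hVp : ContDiff ℝ 1 fun x : Rn n => Vp ‖x - b‖)
    (hVm' : HasCompactSupport fun x : Rn n => Vm ‖x + b‖)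
    (hVp' : HasCompactSupport fun x : Rn n => Vp ‖x - b‖)
    (hVm_anti : AntitoneOn Vm (Set.Ici 0)) (hVp_anti : AntitoneOn Vp (Set.Ici 0))
    {ε : ℝ} (hε : 0 < ε) :
    ∃ N₀ : ℕ, ∀ N, N₀ ≤ N → ∀ v : Rn n → ℝ, IsCc ∞ v →
      0 ≤ ∑ k ∈ Finset.Icc (-(N : ℤ)) (N : ℤ),
        (ε * (-2 * ∫ x, lapl v x * dilation a σ ((k : ℝ) • b) v x)
          + 2 * ∫ x, (Vm ‖x + b‖ + Vp ‖x - b‖) * (v x * dilation a σ ((k : ℝ) • b) v x)) := by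
  have hσ0 : 0 < σ := by linarith
  have hn' : (3 : ℝ) ≤ n := by exact_mod_cast hn
  have hκ : 0 < 4 - σ / ((n : ℝ) - 2) ^ 2 := by
    have : (0 : ℝ) < ((n : ℝ) - 2) ^ 2 := pow_pos (by linarith) 2
    rwa [sub_pos, div_lt_iff₀ this]
  set κ := 4 - σ / ((n : ℝ) - 2) ^ 2 with hκd
  -- Half of the available kinetic energy for each potential.
  have hη : 0 < ε * κ / 2 := by positivity
  simp only [← sub_neg_eq_add _ b] at hVm hVm'
  obtain ⟨N₁, h1⟩ := exists_potential_bound hn ha hσ hVm hVm' hVm_anti (((0 : ℤ) : ℝ) • b) hη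
  obtain ⟨N₂, h2⟩ := exists_potential_bound hn ha hσ hVp hVp' hVp_anti (((0 : ℤ) : ℝ) • b) hη
  refine ⟨max N₁ N₂, fun N hN v hv => ?_⟩
  have h1 := h1 N (le_of_max_le_left hN) v hv
  have h2 := h2 N (le_of_max_le_right hN) v hv
  have hd (c : Rn n) : IsCc 0 (dilation a σ c v) := (hv.of_le (by simp)).dilation ha hσ0.le c
  have hi {U : Rn n → ℝ} (hU : ContDiff ℝ 1 U) (c : Rn n) :
      Integrable fun x => U x * (v x * dilation a σ c v x) :=
    (IsCc.smul (hU.of_le (by norm_num))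
      (IsCc.smul (hv.contDiff.of_le (by simp)) (hd c))).integrable
  have hsplit (k : ℤ) : ∫ x, (Vm ‖x + b‖ + Vp ‖x - b‖) * (v x * dilation a σ ((k : ℝ) • b) v x)
      = (∫ x, Vm ‖x - -b‖ * (v x * dilation a σ ((k : ℝ) • b) v x))
        + ∫ x, Vp ‖x - b‖ * (v x * dilation a σ ((k : ℝ) • b) v x) := by
    rw [← integral_add (hi hVm _) (hi hVp _)]
    simp only [sub_neg_eq_add, add_mul]
  -- The chain of centres is symmetric under `k ↦ -k`, so the one-potential bound for `-b` refers to
  -- the same multiplier.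
  have h3 := sum_Icc_neg
    (fun k => ∫ x, Vm ‖x - -b‖ * (v x * dilation a σ ((k : ℝ) • b) v x)) N
  simp only [Int.cast_neg, neg_smul, ← smul_neg] at h3
  rw [h3] at h1
  have hone (k : ℤ) : κ * _ ≤ _ := one_center_bound hn ha hσ0 ((k : ℝ) • b) hv
  have hpos (k : ℤ) : 0 ≤ ε * (-2 * ∫ x, lapl v x * dilation a σ ((k : ℝ) • b) v x) :=
    mul_nonneg hε.le ((mul_nonneg hκ.le (weightedEnergy_nonneg _ v)).trans (hone k))
  -- Only the centre `0` is needed; the kinetic terms of the others are nonnegative and dropped.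
  have h4 := Finset.single_le_sum (fun k _ => hpos k)
    (show (0 : ℤ) ∈ Finset.Icc (-(N : ℤ)) (N : ℤ) by simp)
  have h5 := mul_le_mul_of_nonneg_left (hone 0) hε.le
  simp only [hsplit, mul_add, Finset.sum_add_distrib, Finset.mul_sum] at h1 h2 h4 h5 ⊢
  exact le_of_eq_of_le (by ring) (add_le_add (h5.trans h4) (add_le_add h1 h2))

theorem IsCc.re {k : WithTop ℕ∞} {v : Rn n → ℂ} (hv : IsCc k v) : IsCc k fun x => (v x).re :=
  ⟨Complex.reCLM.contDiff.comp hv.contDiff, hv.supp.comp_left Complex.zero_re⟩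

theorem IsCc.im {k : WithTop ℕ∞} {v : Rn n → ℂ} (hv : IsCc k v) : IsCc k fun x => (v x).im :=
  ⟨Complex.imCLM.contDiff.comp hv.contDiff, hv.supp.comp_left Complex.zero_im⟩

/-- All coefficients are real, so the real part of each form splits into the form of `Re u` plus
that of `Im u`, and the estimates for real functions suffice. -/
theorem re_inner_toL2 {v w : Rn n → ℂ} (hv : IsCc 0 v) (hw : IsCc 0 w) :
    (⟪toL2 v, toL2 w⟫_ℂ).re = (∫ x, (v x).re * (w x).re) + ∫ x, (v x).im * (w x).im := by
  have hi : Integrable fun x => (starRingEnd ℂ) (v x) * w x := by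
    have hc : Continuous fun x => (starRingEnd ℂ) (v x) * w x :=
      (Complex.continuous_conj.comp hv.contDiff.continuous).mul hw.contDiff.continuous
    exact hc.integrable_of_hasCompactSupport hw.supp.mul_left
  have h1 : Integrable fun x => (v x).re * (w x).re :=
    (IsCc.smul hv.re.contDiff hw.re).integrable
  have h2 : Integrable fun x => (v x).im * (w x).im :=
    (IsCc.smul hv.im.contDiff hw.im).integrable
  rw [inner_toL2 hv.memLp hw.memLp, ← integral_add h1 h2]
  have h := integral_re hi
  simp only [RCLike.re_to_complex] at h
  rw [← h]
  refine integral_congr_ae (Eventually.of_forall fun x => ?_)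
  simp

theorem dilation_clm {E G : Type*} [NormedAddCommGroup E] [NormedSpace ℝ E]
    [NormedAddCommGroup G] [NormedSpace ℝ G] (Λ : E →L[ℝ] G) (ha : 0 < a) (hσ : 0 ≤ σ) (c : Rn n)
    {v : Rn n → E} (hv : Differentiable ℝ v) (x : Rn n) :
    dilation a σ c (fun x => Λ (v x)) x = Λ (dilation a σ c v x) := by
  simp only [dilation, map_sum, map_add, map_smul]
  refine Finset.sum_congr rfl fun j _ => ?_
  have h1 : Differentiable ℝ fun y => dF a σ c j y • v y :=
    ((contDiff_dF 1 ha hσ c j).differentiable (by simp)).smul hv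
  have h2 := congrFun (pd_clm Λ h1 j) x
  simp only [map_smul] at h2
  rw [h2, pd_clm Λ hv]

theorem re_inner_lapl_dilation (ha : 0 < a) (hσ : 0 ≤ σ) (c : Rn n) {u : Rn n → ℂ}
    (hu : IsCc ∞ u) :
    (⟪toL2 (lapl u), toL2 (dilation a σ c u)⟫_ℂ).re
      = (∫ x, lapl (fun x => (u x).re) x * dilation a σ c (fun x => (u x).re) x)
        + ∫ x, lapl (fun x => (u x).im) x * dilation a σ c (fun x => (u x).im) x := by
  have h2 : IsCc 2 u := hu.of_le two_le_infty
  have hd := h2.contDiff.differentiable (by norm_num)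
  rw [re_inner_toL2 (h2.lapl (by norm_num)) ((hu.of_le (by simp)).dilation ha hσ c)]
  have e1 := lapl_clm Complex.reCLM h2.contDiff
  have e2 := lapl_clm Complex.imCLM h2.contDiff
  have e3 := dilation_clm Complex.reCLM ha hσ c hd
  have e4 := dilation_clm Complex.imCLM ha hσ c hd
  simp only [Complex.reCLM_apply, Complex.imCLM_apply] at e1 e2 e3 e4
  simp only [e1, e2, e3, e4]

theorem re_inner_mul_dilation (ha : 0 < a) (hσ : 0 ≤ σ) (c : Rn n) {V : Rn n → ℝ}
    (hV : Continuous V) {u : Rn n → ℂ} (hu : IsCc ∞ u) :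
    (⟪toL2 fun x => V x • u x, toL2 (dilation a σ c u)⟫_ℂ).re
      = (∫ x, V x * ((u x).re * dilation a σ c (fun x => (u x).re) x))
        + ∫ x, V x * ((u x).im * dilation a σ c (fun x => (u x).im) x) := by
  have hd : Differentiable ℝ u := hu.contDiff.differentiable (by simp)
  rw [re_inner_toL2 (IsCc.smul (contDiff_zero.2 hV) (hu.of_le (by simp)))
    ((hu.of_le (by simp)).dilation ha hσ c)]
  have e3 := dilation_clm Complex.reCLM ha hσ c hd
  have e4 := dilation_clm Complex.imCLM ha hσ c hd
  simp only [Complex.reCLM_apply, Complex.imCLM_apply] at e3 e4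
  simp only [e3, e4, Complex.smul_re, Complex.smul_im, smul_eq_mul, mul_assoc]

/-- The real weight moves to the other side of the inner product, and integration by parts leaves
minus the Dirichlet energy of the weighted function. -/
theorem inner_weighted_lapl (ha : 0 < a) (c : Rn n) {u : Rn n → ℂ} (hu : IsCc ∞ u) :
    ⟪toL2 u, toL2 fun x => gFun a σ ‖x - c‖ • lapl (fun y => gFun a σ ‖y - c‖ • u y) x⟫_ℂ
      = ((-(weightedEnergy a σ c (fun x => (u x).re) + weightedEnergy a σ c fun x => (u x).im) : ℝ)
        : ℂ) := by
  have hg : ContDiff ℝ 2 fun x : Rn n => gFun a σ ‖x - c‖ := contDiff_weight 2 ha c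
  have hw : IsCc 2 fun x => gFun a σ ‖x - c‖ • u x := IsCc.smul hg (hu.of_le two_le_infty)
  have hwd := hw.contDiff.differentiable (by norm_num)
  have hl : IsCc 0 (lapl fun x => gFun a σ ‖x - c‖ • u x) := hw.lapl (by norm_num)
  have h0 (j : Fin n) : IsCc 0 (pd j fun x => gFun a σ ‖x - c‖ • u x) :=
    hw.pd (by norm_num) j
  have h1 := sum_inner_pd hw
  have h2 : ⟪toL2 u, toL2 fun x => gFun a σ ‖x - c‖ • lapl (fun y => gFun a σ ‖y - c‖ • u y) x⟫_ℂ
      = ⟪toL2 fun x => gFun a σ ‖x - c‖ • u x, toL2 (lapl fun x => gFun a σ ‖x - c‖ • u x)⟫_ℂ := by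
    rw [inner_toL2 hu.memLp (IsCc.smul (hg.of_le (by norm_num)) hl).memLp,
      inner_toL2 hw.memLp hl.memLp]
    refine integral_congr_ae (Eventually.of_forall fun x => ?_)
    simp only [Complex.real_smul, map_mul, Complex.conj_ofReal]
    ring
  have hparts (j : Fin n) : (⟪toL2 (pd j fun x => gFun a σ ‖x - c‖ • u x),
      toL2 (pd j fun x => gFun a σ ‖x - c‖ • u x)⟫_ℂ).re
      = (∫ x, pd j (fun x => gFun a σ ‖x - c‖ * (u x).re) x ^ 2)
        + ∫ x, pd j (fun x => gFun a σ ‖x - c‖ * (u x).im) x ^ 2 := by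
    rw [re_inner_toL2 (h0 j) (h0 j)]
    have e1 := pd_clm Complex.reCLM hwd j
    have e2 := pd_clm Complex.imCLM hwd j
    simp only [Complex.reCLM_apply, Complex.imCLM_apply, Complex.smul_re, Complex.smul_im,
      smul_eq_mul] at e1 e2
    simp only [e1, e2, sq]
  have hint {v : Rn n → ℝ} (hv : IsCc 1 v) (j : Fin n) :
      Integrable fun x => pd j (fun x => gFun a σ ‖x - c‖ * v x) x ^ 2 := by
    have := (IsCc.smul (hg.of_le (by norm_num)) hv).pd (k := 0) (by norm_num) j
    simpa only [sq, smul_eq_mul] using (IsCc.smul this.contDiff this).integrable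
  have hu1 : IsCc 1 u := hu.of_le (by simp)
  have hreal (j : Fin n) : ⟪toL2 (pd j fun x => gFun a σ ‖x - c‖ • u x),
      toL2 (pd j fun x => gFun a σ ‖x - c‖ • u x)⟫_ℂ
      = (((∫ x, pd j (fun x => gFun a σ ‖x - c‖ * (u x).re) x ^ 2)
        + ∫ x, pd j (fun x => gFun a σ ‖x - c‖ * (u x).im) x ^ 2 : ℝ) : ℂ) := by
    rw [← hparts, ← RCLike.re_to_complex]
    exact (inner_self_ofReal_re (𝕜 := ℂ) _).symm
  rw [h2, ← neg_eq_iff_eq_neg.2 h1, weightedEnergy, weightedEnergy,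
    integral_finsetSum _ fun j _ => hint hu1.re j, integral_finsetSum _ fun j _ => hint hu1.im j,
    ← Finset.sum_add_distrib]
  simp only [hreal]
  push_cast
  rfl

end TestFunctionBounds

end

end MultiCenter

namespace MultiCenter

noncomputable section

/-! ### The two operator inequalities on test functions -/

section Forms

variable {n : ℕ} {a σ : ℝ}

/-- The factor `-i` in `Bψ = -iD` cancels the `i` of the commutator, leaving `⟨φ, D⟩` plus its
conjugate; in particular the form is real without invoking symmetry. -/
theorem commForm_eq {A B : L2 n →ₗ.[ℂ] L2 n} {ψ φ D : L2 n} (hA : (ψ, φ) ∈ A.graph)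
    (hB : (ψ, (-Complex.I) • D) ∈ B.graph) (h : ψ ∈ A.domain) (h' : ψ ∈ B.domain) :
    commForm A B ψ h h' = ((2 * (⟪φ, D⟫_ℂ).re : ℝ) : ℂ) := by
  have hre : (⟪D, φ⟫_ℂ).re = (⟪φ, D⟫_ℂ).re := inner_re_symm (𝕜 := ℂ) D φ
  have him : (⟪D, φ⟫_ℂ).im = -(⟪φ, D⟫_ℂ).im := inner_im_symm (𝕜 := ℂ) D φ
  rw [commForm, apply_eq_of_mem_graph hA, apply_eq_of_mem_graph hB, inner_smul_left,
    inner_smul_right]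
  apply Complex.ext
  · simp [hre]
    ring
  · simp [him]

theorem weighted_le_kinetic (hn : 3 ≤ n) (ha : 0 < a) (hσ : 0 < σ) (b : Rn n) (N : ℕ)
    {u : Rn n → ℂ} (hu : IsCc ∞ u) :
    -(4 - σ / ((n : ℝ) - 2) ^ 2) * (⟪toL2 u, ∑ k ∈ Finset.Icc (-(N : ℤ)) (N : ℤ),
        toL2 fun x => gFun a σ ‖x - (k : ℝ) • b‖ •
          lapl (fun y => gFun a σ ‖y - (k : ℝ) • b‖ • u y) x⟫_ℂ).re
      ≤ 2 * (⟪-toL2 (lapl u), ∑ k ∈ Finset.Icc (-(N : ℤ)) (N : ℤ),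
        toL2 (dilation a σ ((k : ℝ) • b) u)⟫_ℂ).re := by
  simp only [inner_sum, Complex.re_sum, inner_neg_left, Complex.neg_re,
    re_inner_lapl_dilation ha hσ.le _ hu, inner_weighted_lapl ha _ hu, Complex.ofReal_re,
    Finset.mul_sum]
  refine Finset.sum_le_sum fun k _ => ?_
  have h1 : _ * weightedEnergy a σ _ _ ≤ _ := one_center_bound hn ha hσ ((k : ℝ) • b) hu.re
  have h2 : _ * weightedEnergy a σ _ _ ≤ _ := one_center_bound hn ha hσ ((k : ℝ) • b) hu.im
  exact (le_of_eq (by ring)).trans ((add_le_add h1 h2).trans_eq (by ring))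

theorem im_inner_weighted (ha : 0 < a) (b : Rn n) (N : ℕ) {u : Rn n → ℂ} (hu : IsCc ∞ u) :
    (⟪toL2 u, ∑ k ∈ Finset.Icc (-(N : ℤ)) (N : ℤ),
        toL2 fun x => gFun a σ ‖x - (k : ℝ) • b‖ •
          lapl (fun y => gFun a σ ‖y - (k : ℝ) • b‖ • u y) x⟫_ℂ).im = 0 := by
  simp only [inner_sum, Complex.im_sum, inner_weighted_lapl ha _ hu, Complex.ofReal_im,
    Finset.sum_const_zero]

theorem kinetic_le_total (ha : 0 < a) (hσ : 0 ≤ σ) (b : Rn n) (N : ℕ) {V : Rn n → ℝ}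
    (hV : Continuous V) {ε : ℝ}
    (h : ∀ v : Rn n → ℝ, IsCc ∞ v →
      0 ≤ ∑ k ∈ Finset.Icc (-(N : ℤ)) (N : ℤ),
        (ε * (-2 * ∫ x, lapl v x * dilation a σ ((k : ℝ) • b) v x)
          + 2 * ∫ x, V x * (v x * dilation a σ ((k : ℝ) • b) v x)))
    {u : Rn n → ℂ} (hu : IsCc ∞ u) :
    (1 - ε) * (2 * (⟪-toL2 (lapl u), ∑ k ∈ Finset.Icc (-(N : ℤ)) (N : ℤ),
        toL2 (dilation a σ ((k : ℝ) • b) u)⟫_ℂ).re)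
      ≤ 2 * (⟪-toL2 (lapl u) + toL2 fun x => V x • u x, ∑ k ∈ Finset.Icc (-(N : ℤ)) (N : ℤ),
        toL2 (dilation a σ ((k : ℝ) • b) u)⟫_ℂ).re := by
  have h1 := add_nonneg (h _ hu.re) (h _ hu.im)
  rw [← Finset.sum_add_distrib] at h1
  simp only [inner_sum, Complex.re_sum, inner_neg_left, inner_add_left, Complex.neg_re,
    Complex.add_re, re_inner_lapl_dilation ha hσ _ hu, re_inner_mul_dilation ha hσ _ hV hu,
    Finset.mul_sum]
  rw [← sub_nonneg, ← Finset.sum_sub_distrib]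
  refine h1.trans_eq (Finset.sum_congr rfl fun k _ => ?_)
  ring

end Forms

end

end MultiCenter

/-! ### Passage from test functions to the whole domain -/

theorem mainTheorem2 (n : ℕ) (hn : 3 ≤ n) (a σ : ℝ) (ha : 0 < a)
    (hσ : 1 / 2 < σ) (hσ' : σ < 4 * ((n : ℝ) - 2) ^ 2)
    (b : EuclideanSpace ℝ (Fin n)) (Vm Vp : ℝ → ℝ)
    (hVm_smooth : ContDiff ℝ ∞ (fun x : EuclideanSpace ℝ (Fin n) => Vm ‖x + b‖))
    (hVp_smooth : ContDiff ℝ ∞ (fun x : EuclideanSpace ℝ (Fin n) => Vp ‖x - b‖))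
    (hVm_supp : HasCompactSupport (fun x : EuclideanSpace ℝ (Fin n) => Vm ‖x + b‖))
    (hVp_supp : HasCompactSupport (fun x : EuclideanSpace ℝ (Fin n) => Vp ‖x - b‖))
    (hVm_anti : AntitoneOn Vm (Set.Ici 0)) (hVp_anti : AntitoneOn Vp (Set.Ici 0))
    (ε : ℝ) (hε : 0 < ε) (hε' : ε < 1) :
    ∃ Nε : ℕ, ∀ N : ℕ, Nε ≤ N → ∀ ψ : MultiCenter.L2 n, ψ ∈ (MultiCenter.lap n).domain →
      ∃ (h₀ : ψ ∈ (-(MultiCenter.lap n)).domain)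
        (hH : ψ ∈ (MultiCenter.schrodinger (fun x => Vm ‖x + b‖ + Vp ‖x - b‖)).domain)
        (hγ : ψ ∈ (MultiCenter.gamN a σ b N).domain)
        (hw : ψ ∈ (MultiCenter.weightedLapN a σ b N).domain),
        ((1 - ε : ℝ) : ℂ) *
            MultiCenter.commForm (-(MultiCenter.lap n)) (MultiCenter.gamN a σ b N) ψ h₀ hγ ≤
          MultiCenter.commForm (MultiCenter.schrodinger (fun x => Vm ‖x + b‖ + Vp ‖x - b‖))
            (MultiCenter.gamN a σ b N) ψ hH hγ ∧
        -(((1 - ε) * (4 - σ / ((n : ℝ) - 2) ^ 2) : ℝ) : ℂ) *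
            MultiCenter.opForm (MultiCenter.weightedLapN a σ b N) ψ hw ≤
          ((1 - ε : ℝ) : ℂ) *
            MultiCenter.commForm (-(MultiCenter.lap n)) (MultiCenter.gamN a σ b N) ψ h₀ hγ := by
  have hσ0 : 0 < σ := by linarith
  have hcont : Continuous fun x : MultiCenter.Rn n => Vm ‖x + b‖ + Vp ‖x - b‖ :=
    hVm_smooth.continuous.add hVp_smooth.continuous
  obtain ⟨C₁, hC₁⟩ := hVm_supp.exists_bound_of_continuous hVm_smooth.continuous
  obtain ⟨C₂, hC₂⟩ := hVp_supp.exists_bound_of_continuous hVp_smooth.continuous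
  have hC (x : MultiCenter.Rn n) : |Vm ‖x + b‖ + Vp ‖x - b‖| ≤ C₁ + C₂ :=
    (abs_add_le _ _).trans (add_le_add (hC₁ x) (hC₂ x))
  obtain ⟨N₀, hN₀⟩ := MultiCenter.exists_potentials_bound hn ha hσ hσ' (hVm_smooth.of_le (by simp))
    (hVp_smooth.of_le (by simp)) hVm_supp hVp_supp hVm_anti hVp_anti hε
  refine ⟨N₀, fun N hN ψ hψ => ?_⟩
  have hL : (ψ, MultiCenter.lap n ⟨ψ, hψ⟩) ∈ (MultiCenter.lap n).graph := (MultiCenter.lap n).mem_graph ⟨ψ, hψ⟩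
  -- `N₀` was fixed before `ψ`, and the bounds for test functions hold for each `u m` with the same
  -- `N`, so they survive the limit.
  obtain ⟨u, hu⟩ := MultiCenter.exists_approx hL
  obtain ⟨D, hD, hγ⟩ := hu.gamN ha hσ b N
  obtain ⟨W, hW, hw⟩ := hu.weightedLapN ha hσ0.le b N
  obtain ⟨S, hS, hH⟩ := hu.schrodinger hcont hC
  have h₀ := hu.lap.neg
  refine ⟨LinearPMap.mem_domain_of_mem_graph h₀.lim, LinearPMap.mem_domain_of_mem_graph hH,
    LinearPMap.mem_domain_of_mem_graph hγ, LinearPMap.mem_domain_of_mem_graph hw, ?_, ?_⟩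
  · rw [MultiCenter.commForm_eq h₀.lim hγ, MultiCenter.commForm_eq hH hγ, ← Complex.ofReal_mul, Complex.real_le_real]
    have h1 := (Complex.continuous_re.tendsto _).comp (h₀.tendsto.inner (𝕜 := ℂ) hD)
    have h2 := (Complex.continuous_re.tendsto _).comp (hS.inner (𝕜 := ℂ) hD)
    exact le_of_tendsto_of_tendsto' ((h1.const_mul 2).const_mul (1 - ε)) (h2.const_mul 2)
      fun m => MultiCenter.kinetic_le_total ha hσ0.le b N hcont (hN₀ N hN) (hu.test m)
  · have h1 := (Complex.continuous_re.tendsto _).comp (h₀.tendsto.inner (𝕜 := ℂ) hD)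
    have h2 := hu.tendsto.inner (𝕜 := ℂ) hW
    -- The order on `ℂ` demands equal imaginary parts, so reality of the weighted form has to be
    -- carried to the limit as well.
    have him : (⟪ψ, W⟫_ℂ).im = 0 :=
      tendsto_nhds_unique ((Complex.continuous_im.tendsto _).comp h2)
        (tendsto_const_nhds.congr fun m => (MultiCenter.im_inner_weighted ha b N (hu.test m)).symm)
    have hre := le_of_tendsto_of_tendsto'
      (((Complex.continuous_re.tendsto _).comp h2).const_mul (-(4 - σ / ((n : ℝ) - 2) ^ 2)))
      (h1.const_mul 2) fun m => MultiCenter.weighted_le_kinetic hn ha hσ0 b N (hu.test m)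
    have hW' : ⟪ψ, W⟫_ℂ = (((⟪ψ, W⟫_ℂ).re : ℝ) : ℂ) := Complex.ext (by simp) (by simp [him])
    rw [MultiCenter.commForm_eq h₀.lim hγ, MultiCenter.opForm, MultiCenter.apply_eq_of_mem_graph hw, hW', ← Complex.ofReal_neg,
      ← Complex.ofReal_mul, ← Complex.ofReal_mul, Complex.real_le_real]
    have := mul_le_mul_of_nonneg_left hre (show 0 ≤ 1 - ε by linarith)
    exact (le_of_eq (by ring)).trans this
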